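/- **Setting.** Let $p$ be a prime, $k$ an algebraically closed field of characteristic $p$, $L=\operatorname{Frac} W(k)$ with Frobenius automorphism $\sigma$ and absolute value normalised by $|p|=1/p$. Let $V$ be a finite-dimensional $\mathbb{Q}_p$-vector space, $G=GL(V)$, $b\in G(L)$, $N=V\otimes_{\mathbb{Q}_p}L$ and $\mathcal F=b\circ(\mathrm{Id}_V\otimes\sigma)$. For a ring $A$ with absolute value and an $A$-module $X$, an $A$-norm on $X$ is a map $\alpha:X\to\mathbb{R}_+$ with $\alpha(x)=0\iff x=0$, $\alpha(x+y)\le\max(\alpha(x),\alpha(y))$ and $\alpha(ax)=|a|\alpha(x)$; write $\mathcal N(X,A)$ for the set of $A$-norms. A (semi)linear bijection $g$ acts by $(g\cdot\alpha)(x)=\alpha(g^{-1}x)$. The Bruhat–Tits building $\mathcal I(G,L)$ is identified with $\mathcal N(N,L)$: its apartments are the sets of norms split by a basis $(e_i)$ of $N$, i.e. $\alpha(\sum a_ie_i)=\max|a_i|\alpha(e_i)$, with affine coordinates $\log\alpha(e_i)$. Fix any metric $d$ on $\mathcal N(N,L)$ which is invariant under $G(L)\rtimes\langle\sigma\rangle$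 and Euclidean on each apartment (i.e. there $d(\alpha,\beta)^2$ is a positive definite quadratic form in the numbers $\log\alpha(e_i)-\log\beta(e_i)$), and put $$\operatorname{Min}(\mathcal F)=\{\alpha\in\mathcal N(N,L): d(\alpha,\mathcal F\cdot\alpha)=\inf_\beta d(\beta,\mathcal F\cdot\beta)\}.$$ For $\lambda\in\mathbb{Q}$ write $\lambda=d(\lambda)/h(\lambda)$ in lowest terms with $h(\lambda)>0$. Let $N_\lambda\subset N$ be the isoclinic part of slope $\lambda$ (the sum of all sub-isocrystals that contain a full $W(k)$-lattice $M$ with $\mathcal F^{h(\lambda)}M=p^{d(\lambda)}M$), $\mathcal F_\lambda=\mathcal F|_{N_\lambda}$, $K(\lambda)=\{x\in L:\sigma^{h(\lambda)}x=x\}$, $N_\lambda^0=\{x\in N_\lambda:\mathcal F^{h(\lambda)}x=p^{d(\lambda)}x\}$. Let $\mathbb D(\lambda)$ be the algebra generated over $K(\lambda)$ by an element $\pi_\lambda$ with $\pi_\lambda a=\sigma(a)\pi_\lambda$ for $a\in K(\lambda)$ and $\pi_\lambda^{h(\lambda)}=p^{d(\lambda)}$, realised as the subring of $M_{h(\lambda)}(L)$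 generated by the matrices $\mathrm{diag}(a,\sigma a,\dots,\sigma^{h(\lambda)-1}a)$, $a\in K(\lambda)$, and by the matrix with ones just above the diagonal and $p^{d(\lambda)}$ in the lower left corner (for $h(\lambda)=1$, the $1\times1$ matrix $p^{d(\lambda)}$); its absolute value is $|x|=|\det x|^{1/h(\lambda)}$, and it acts on $N^0_\lambda$ with $K(\lambda)$ acting by scalars and $\pi_\lambda$ by $\mathcal F$. Let $J(\mathbb{Q}_p)=\{g\in GL_L(N): g\mathcal F=\mathcal Fg\}$. In the norm model, the building of $J$ is $\mathcal I(J,\mathbb{Q}_p)=\prod_\lambda\mathcal N(N_\lambda^0,\mathbb D(\lambda))$, with apartments given by families of $\mathbb D(\lambda)$-bases of the $N_\lambda^0$. All products are over $\lambda\in\mathbb{Q}$; only the finitely many $\lambda$ with $N_\lambda\ne0$ contribute. **Statement.** 1. $N=\bigoplus_\lambda N_\lambda$, and each $\mathbb D(\lambda)$ is a division algebra with centre $\mathbb{Q}_p$. 2. Restriction to the $N_\lambda$ is a bijection from the set of $L$-norms of $N$ which decompose along $N=\bigoplus N_\lambda$ (i.e. $\alpha(\sum x_\lambda)=\max\alpha(x_\lambda)$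 for $x_\lambda\in N_\lambda$) onto $\prod_\lambda\mathcal N(N_\lambda,L)$. Under it, $$\operatorname{Min}(\mathcal F)=\prod_\lambda\operatorname{Min}(\mathcal F_\lambda)\subset\prod_\lambda\operatorname{Min}(\mathcal F_\lambda^{h(\lambda)})\subset\prod_\lambda\mathcal N(N_\lambda,L)\subset\mathcal N(N,L),$$ where $\operatorname{Min}(\mathcal F_\lambda)=\{\alpha\in\mathcal N(N_\lambda,L):\mathcal F_\lambda\cdot\alpha=p^{\lambda}\alpha\}$ and $\operatorname{Min}(\mathcal F_\lambda^{h(\lambda)})=\{\alpha\in\mathcal N(N_\lambda,L):\mathcal F_\lambda^{h(\lambda)}\cdot\alpha=p^{d(\lambda)}\alpha\}=\{\alpha:\alpha(\mathcal F_\lambda^{h(\lambda)}x)=\alpha(p^{d(\lambda)}x)\ \forall x\}$. 3. For each $\lambda$, restriction to $N_\lambda^0$ is a bijection $\operatorname{Min}(\mathcal F_\lambda^{h(\lambda)})\cong\mathcal N(N_\lambda^0,K(\lambda))$, which carries $\operatorname{Min}(\mathcal F_\lambda)$ onto $$\{\alpha\in\mathcal N(N_\lambda^0,K(\lambda)):\alpha(\pi_\lambda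 x)=|\pi_\lambda|\alpha(x)\ \forall x\}=\mathcal N(N_\lambda^0,\mathbb D(\lambda)).$$ 4. Restriction of automorphisms is a group isomorphism $J(\mathbb{Q}_p)\cong\prod_\lambda\operatorname{Aut}_{\mathbb D(\lambda)}(N_\lambda^0)$. 5. The group $J(\mathbb{Q}_p)$ stabilises $\operatorname{Min}(\mathcal F)$, and $\alpha\mapsto(\alpha|_{N_\lambda^0})_\lambda$ is a $J(\mathbb{Q}_p)$-equivariant bijection $$\operatorname{Min}(\mathcal F)\;\xrightarrow{\ \sim\ }\;\prod_\lambda\mathcal N(N_\lambda^0,\mathbb D(\lambda))=\mathcal I(J,\mathbb{Q}_p);$$ the metric $d$ transported by it is Euclidean on each apartment of $\mathcal I(J,\mathbb{Q}_p)$. -/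

import Mathlib

open scoped NNReal TensorProduct

set_option linter.unusedSectionVars false

noncomputable section

namespace IsocNorm

/-! ### Norms over a ring with an absolute value -/

/-- The set `𝒩(X, A)` of (ultrametric) `A`-norms on an `A`-module `X`, where `A` is
a ring equipped with an absolute value `abs`. -/
structure VNorm (A : Type*) [Ring A] (abs : A → ℝ≥0) (X : Type*) [AddCommGroup X] [Module A X] where
  toFun : X → ℝ≥0
  eq_zero_iff' : ∀ x, toFun x = 0 ↔ x = 0
  add_le_max' : ∀ x y, toFun (x + y) ≤ max (toFun x) (toFun y)
  smul' : ∀ (a : A) (x : X), toFun (a • x) = abs a * toFun x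

namespace VNorm

variable {A : Type*} [Ring A] {abs : A → ℝ≥0} {X : Type*} [AddCommGroup X] [Module A X]

instance : CoeFun (VNorm A abs X) (fun _ => X → ℝ≥0) := ⟨VNorm.toFun⟩

@[ext] theorem ext {α β : VNorm A abs X} (h : ∀ x, α x = β x) : α = β := by
  cases α; cases β; congr; funext x; exact h x

/-- The action `(g · α)(x) = α (g⁻¹ x)` of a bijective semilinear map `g` on norms; the ring
automorphism `τ` attached to `g` has to preserve the absolute value. -/
def push {τ τ' : A →+* A} [RingHomInvPair τ τ'] [RingHomInvPair τ' τ]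
    (hτ : ∀ a, abs (τ a) = abs a) (g : X ≃ₛₗ[τ] X) (α : VNorm A abs X) : VNorm A abs X where
  toFun x := α (g.symm x)
  eq_zero_iff' x := by rw [α.eq_zero_iff']; simp
  add_le_max' x y := by rw [map_add]; exact α.add_le_max' _ _
  smul' a x := by
    rw [LinearEquiv.map_smulₛₗ, α.smul', ← hτ (τ' a), RingHomInvPair.comp_apply_eq₂]

/-- The group `GL_A(X)` acts on the set of norms by `(g · α)(x) = α (g⁻¹ x)`. -/
instance : MulAction (X ≃ₗ[A] X) (VNorm A abs X) where
  smul g α := push (fun _ => rfl) g α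
  one_smul _ := rfl
  mul_smul _ _ _ := rfl

theorem smul_apply (g : X ≃ₗ[A] X) (α : VNorm A abs X) (x : X) : (g • α) x = α (g.symm x) := rfl

/-- Restriction of a norm to a submodule. -/
def restrict (α : VNorm A abs X) (P : Submodule A X) : VNorm A abs P where
  toFun x := α x
  eq_zero_iff' x := by rw [α.eq_zero_iff']; simp
  add_le_max' x y := α.add_le_max' _ _
  smul' a x := α.smul' a _

/-- A norm is split by the basis `e` if `α (∑ aᵢ eᵢ) = max |aᵢ| α(eᵢ)`. The norms split by `e`
are the points of the apartment attached to `e`. -/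
def IsSplitBy (α : VNorm A abs X) {ι : Type*} (e : Module.Basis ι A X) : Prop :=
  ∀ x, α x = (e.repr x).support.sup fun i => abs (e.repr x i) * α (e i)

/-- A norm decomposes along a family of submodules if `α (∑ xᵢ) = max α(xᵢ)` whenever the `xᵢ`
lie in the members of the family. -/
def DecomposesAlong (α : VNorm A abs X) {ι : Type*} (P : ι → Submodule A X) : Prop :=
  ∀ (s : Finset ι) (x : ι → X), (∀ i ∈ s, x i ∈ P i) →
    α (∑ i ∈ s, x i) = s.sup fun i => α (x i)

end VNorm

/-! ### Displacement of a self-map of a metric space -/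

/-- `Min(f)`: the points at which the displacement `x ↦ d(x, f x)` attains its infimum. -/
def minSet {I : Type*} [MetricSpace I] (f : I → I) : Set I :=
  {x | dist x (f x) = ⨅ y, dist y (f y)}

/-! ### The field `L`, its Frobenius and its absolute value -/

variable (p : ℕ) [hp : Fact p.Prime] (k : Type*) [Field k] [CharP k p] [PerfectRing k p]

/-- `L`, the field of fractions of `W(k)`. -/
def LField : Type _ := FractionRing (WittVector p k)

instance : Field (LField p k) := inferInstanceAs (Field (FractionRing (WittVector p k)))

instance : Algebra (WittVector p k) (LField p k) :=
  inferInstanceAs (Algebra (WittVector p k) (FractionRing (WittVector p k)))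

instance : IsFractionRing (WittVector p k) (LField p k) :=
  inferInstanceAs (IsFractionRing (WittVector p k) (FractionRing (WittVector p k)))

/-- The Frobenius automorphism `σ` of `L`, induced by the Frobenius of `W(k)`. -/
def sigma : LField p k ≃+* LField p k :=
  IsFractionRing.ringEquivOfRingEquiv (WittVector.frobeniusEquiv p k)

/-- The Frobenius automorphism of `L` as a ring homomorphism. -/
def sigmaHom : LField p k →+* LField p k := sigma p k

/-- The inverse of the Frobenius automorphism of `L` as a ring homomorphism. -/
def sigmaInvHom : LField p k →+* LField p k := (sigma p k).symm

instance : RingHomInvPair (sigmaHom p k) (sigmaInvHom p k) :=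
  RingHomInvPair.of_ringEquiv (sigma p k)

instance : RingHomInvPair (sigmaInvHom p k) (sigmaHom p k) :=
  RingHomInvPair.of_ringEquiv (sigma p k).symm

/-- The absolute value on `L`, normalised by `|p| = 1/p`. -/
def absL (x : LField p k) : ℝ≥0 :=
  WithZeroMulInt.toNNReal (e := (p : ℝ≥0)) (by exact_mod_cast hp.out.ne_zero)
    ((IsDiscreteValuationRing.maximalIdeal (WittVector p k)).valuation (LField p k) x)

theorem absL_mul (x y : LField p k) : absL p k (x * y) = absL p k x * absL p k y := by
  simp [absL]

theorem absL_one : absL p k 1 = 1 := by simp [absL]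

theorem absL_unit (u : (WittVector p k)ˣ) : absL p k (algebraMap _ _ (u : WittVector p k)) = 1 := by
  have : (IsDiscreteValuationRing.maximalIdeal (WittVector p k)).valuation (LField p k)
      (algebraMap _ _ (u : WittVector p k)) = 1 := by
    rw [IsDedekindDomain.HeightOneSpectrum.valuation_of_algebraMap]
    exact IsDedekindDomain.HeightOneSpectrum.intValuation_eq_one_iff.2
      (fun h => (IsDiscreteValuationRing.maximalIdeal (WittVector p k)).isPrime.ne_top
        (Ideal.eq_top_of_isUnit_mem _ h u.isUnit))
  simp [absL, this]

theorem sigma_algebraMap (a : WittVector p k) :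
    sigma p k (algebraMap _ _ a) = algebraMap _ _ (WittVector.frobenius a) := by
  simp [sigma]

theorem absL_sigma_algebraMap (a : WittVector p k) :
    absL p k (sigma p k (algebraMap _ _ a)) = absL p k (algebraMap _ _ a) := by
  by_cases ha : a = 0
  · simp [ha]
  obtain ⟨m, u, rfl⟩ := WittVector.exists_eq_pow_p_mul' a ha
  have hu : (WittVector.frobenius (u : WittVector p k)) =
      ((Units.map (WittVector.frobenius (p := p) (R := k)).toMonoidHom u : (WittVector p k)ˣ) :
        WittVector p k) := rfl
  rw [sigma_algebraMap, map_mul, map_mul, map_mul, absL_mul, absL_mul, hu, absL_unit, absL_unit]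
  simp

theorem absL_sigma (x : LField p k) : absL p k (sigma p k x) = absL p k x := by
  obtain ⟨a, b, hb, rfl⟩ := IsFractionRing.div_surjective (A := WittVector p k) x
  have hb0 : (algebraMap (WittVector p k) (LField p k) b) ≠ 0 := by
    simpa using nonZeroDivisors.ne_zero hb
  have key : ∀ x y : LField p k, absL p k (x / y) = absL p k x / absL p k y := by
    intro x y; simp [absL]
  rw [map_div₀, key, key, absL_sigma_algebraMap, absL_sigma_algebraMap]

theorem absL_sigmaHom (x : LField p k) : absL p k (sigmaHom p k x) = absL p k x := by
  rw [← absL_sigma p k x]; rfl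

theorem absL_p : absL p k (p : LField p k) = (p : ℝ≥0)⁻¹ := by
  have h0 : (p : LField p k) = algebraMap (WittVector p k) _ (p : WittVector p k) := by simp
  have : (IsDiscreteValuationRing.maximalIdeal (WittVector p k)).valuation (LField p k)
      (algebraMap _ _ (p : WittVector p k)) = WithZero.exp (-1 : ℤ) := by
    rw [IsDedekindDomain.HeightOneSpectrum.valuation_of_algebraMap]
    refine IsDedekindDomain.HeightOneSpectrum.intValuation_singleton _
      (WittVector.irreducible p).ne_zero ?_
    exact (WittVector.irreducible p).maximalIdeal_eq
  rw [h0, absL, this]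
  change WithZeroMulInt.toNNReal _ ((Multiplicative.ofAdd (-1 : ℤ) : Multiplicative ℤ) :
    WithZero (Multiplicative ℤ)) = _
  rw [WithZeroMulInt.toNNReal_neg_apply _ WithZero.coe_ne_zero, WithZero.unzero_coe]
  simp

/-- The embedding of `ℤ_p = W(𝔽_p)` into `W(k)`. -/
def zpToW : ℤ_[p] →+* WittVector p k :=
  (WittVector.map (ZMod.castHom dvd_rfl k)).comp (WittVector.equiv p).symm.toRingHom

/-- The embedding of `ℚ_p` into `L`. -/
def qpToL : ℚ_[p] →+* LField p k :=
  IsFractionRing.lift (A := ℤ_[p]) (g := (algebraMap (WittVector p k) (LField p k)).comp (zpToW p k))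
    (by
      rw [injective_iff_map_eq_zero]
      intro a ha
      have h1 : zpToW p k a = 0 := by
        apply IsFractionRing.injective (WittVector p k) (LField p k)
        simpa using ha
      have h2 : (WittVector.equiv p).symm a = 0 :=
        WittVector.map_injective _ (ZMod.castHom_injective k) (by simpa [zpToW] using h1)
      simpa using h2)

instance : Algebra ℚ_[p] (LField p k) := (qpToL p k).toAlgebra

theorem sigma_qp (a : ℚ_[p]) :
    sigma p k (algebraMap ℚ_[p] (LField p k) a) = algebraMap ℚ_[p] (LField p k) a := by
  have h : (sigma p k).toRingHom.comp (qpToL p k) = qpToL p k := by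
    apply IsLocalization.ringHom_ext (nonZeroDivisors ℤ_[p])
    ext z
    have hz : qpToL p k (algebraMap ℤ_[p] ℚ_[p] z) =
        algebraMap (WittVector p k) (LField p k) (zpToW p k z) := by
      rw [qpToL, IsFractionRing.lift_algebraMap]; rfl
    have hf : WittVector.frobenius (zpToW p k z) = zpToW p k z := by
      ext n
      rw [WittVector.coeff_frobenius_charP]
      simp [zpToW, WittVector.map_coeff, ← ZMod.cast_pow dvd_rfl]
    change sigma p k (qpToL p k (algebraMap ℤ_[p] ℚ_[p] z)) = qpToL p k (algebraMap ℤ_[p] ℚ_[p] z)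
    rw [hz, sigma_algebraMap, hf]
  exact RingHom.congr_fun h a

/-! ### Isocrystals -/

section Isocrystal

variable {p k}
variable {N : Type*} [AddCommGroup N] [Module (LField p k) N]

/-- The action of a Frobenius-semilinear bijection on the set of `L`-norms,
`(Φ · α)(x) = α (Φ⁻¹ x)`. -/
def frobAct (Φ : N ≃ₛₗ[sigmaHom p k] N) (α : VNorm (LField p k) (absL p k) N) :
    VNorm (LField p k) (absL p k) N :=
  VNorm.push (absL_sigmaHom p k) Φ α

/-- The group `J(ℚ_p)` of automorphisms of the isocrystal `(N, Φ)`. -/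
def isocAut (Φ : N ≃ₛₗ[sigmaHom p k] N) : Subgroup (N ≃ₗ[LField p k] N) where
  carrier := {g | ∀ x, g (Φ x) = Φ (g x)}
  mul_mem' {g h} hg hh x := by
    change g (h (Φ x)) = Φ (g (h x))
    rw [hh, hg]
  one_mem' _ := rfl
  inv_mem' {g} hg x := by
    change g.symm (Φ x) = Φ (g.symm x)
    rw [LinearEquiv.symm_apply_eq, hg, LinearEquiv.apply_symm_apply]

/-- A subspace `P` of `N` is an isoclinic sub-isocrystal of slope `r = d / h` (in lowest terms) if
it is stable under `Φ` and `Φ⁻¹` and contains a `W(k)`-lattice `M` with `Φ^h M = p^d M`. -/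
def IsIsoclinic (Φ : N ≃ₛₗ[sigmaHom p k] N) (r : ℚ) (P : Submodule (LField p k) N) : Prop :=
  (∀ x, Φ x ∈ P ↔ x ∈ P) ∧
  ∃ M : Submodule (algebraMap (WittVector p k) (LField p k)).range N,
    M.FG ∧ Submodule.span (LField p k) (M : Set N) = P ∧
    ∀ x, x ∈ M ↔ (p : LField p k) ^ (-r.num) • Φ^[r.den] x ∈ M

/-- The isoclinic part `N_r` of slope `r` of `(N, Φ)`. -/
def slopePart (Φ : N ≃ₛₗ[sigmaHom p k] N) (r : ℚ) : Submodule (LField p k) N :=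
  sSup {P | IsIsoclinic Φ r P}

theorem frob_mem_slopePart (Φ : N ≃ₛₗ[sigmaHom p k] N) (r : ℚ) {x : N} (hx : x ∈ slopePart Φ r) :
    Φ x ∈ slopePart Φ r := by
  have : slopePart Φ r ≤ (slopePart Φ r).comap (Φ : N →ₛₗ[sigmaHom p k] N) :=
    sSup_le fun P hP y hy => le_sSup (a := P) hP ((hP.1 y).2 hy)
  exact this hx

theorem frob_symm_mem_slopePart (Φ : N ≃ₛₗ[sigmaHom p k] N) (r : ℚ) {x : N}
    (hx : x ∈ slopePart Φ r) : Φ.symm x ∈ slopePart Φ r := by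
  have : slopePart Φ r ≤ (slopePart Φ r).comap (Φ.symm : N →ₛₗ[_] N) :=
    sSup_le fun P hP y hy => le_sSup (a := P) hP ((hP.1 _).1 (by
      change Φ (Φ.symm y) ∈ P
      simpa using hy))
  exact this hx

/-- The Frobenius `Φ_r` of the isoclinic part `N_r`. -/
def slopeFrob (Φ : N ≃ₛₗ[sigmaHom p k] N) (r : ℚ) :
    slopePart Φ r ≃ₛₗ[sigmaHom p k] slopePart Φ r where
  toFun x := ⟨Φ x, frob_mem_slopePart Φ r x.2⟩
  invFun x := ⟨Φ.symm x, frob_symm_mem_slopePart Φ r x.2⟩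
  map_add' x y := by ext; simp
  map_smul' a x := Subtype.ext (LinearEquiv.map_smulₛₗ Φ a (x : N))
  left_inv x := by ext; simp
  right_inv x := by ext; simp

variable (p k) in
/-- The field `K(r)` of elements of `L` that are fixed by `σ^h`, where `r = d / h`. -/
def fixedField (r : ℚ) : Subfield (LField p k) :=
  RingHom.eqLocusField ((sigmaHom p k) ^ r.den) (RingHom.id _)

theorem mem_fixedField (r : ℚ) (a : LField p k) :
    a ∈ fixedField p k r ↔ (sigmaHom p k)^[r.den] a = a := by
  rw [← RingHom.coe_pow]; rfl

variable (p k) in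
/-- The absolute value on `K(r)`. -/
def absK (r : ℚ) (a : fixedField p k r) : ℝ≥0 := absL p k (a : LField p k)

theorem iterate_frob_smul (Φ : N ≃ₛₗ[sigmaHom p k] N) (n : ℕ) (a : LField p k) (x : N) :
    Φ^[n] (a • x) = (sigmaHom p k)^[n] a • Φ^[n] x := by
  induction n with
  | zero => rfl
  | succ n ih => rw [Function.iterate_succ_apply', ih, Function.iterate_succ_apply',
      Function.iterate_succ_apply', LinearEquiv.map_smulₛₗ]

theorem iterate_frob_add (Φ : N ≃ₛₗ[sigmaHom p k] N) (n : ℕ) (x y : N) :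
    Φ^[n] (x + y) = Φ^[n] x + Φ^[n] y := by
  induction n with
  | zero => rfl
  | succ n ih => rw [Function.iterate_succ_apply', ih, Function.iterate_succ_apply',
      Function.iterate_succ_apply', map_add]

/-- The `K(r)`-space `N_r⁰ = {x ∈ N_r | Φ^h x = p^d x}`, where `r = d / h`. -/
def slopeFix (Φ : N ≃ₛₗ[sigmaHom p k] N) (r : ℚ) : Submodule (fixedField p k r) N where
  carrier := {x | x ∈ slopePart Φ r ∧ Φ^[r.den] x = (p : LField p k) ^ r.num • x}
  add_mem' {x y} hx hy := ⟨add_mem hx.1 hy.1, by rw [iterate_frob_add, hx.2, hy.2, smul_add]⟩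
  zero_mem' := ⟨zero_mem _, by
    have h := iterate_frob_smul Φ r.den 0 0
    simp only [smul_zero] at h ⊢
    rw [h, iterate_map_zero, zero_smul]⟩
  smul_mem' a x hx := by
    refine ⟨(slopePart Φ r).smul_mem (a : LField p k) hx.1, ?_⟩
    change Φ^[r.den] ((a : LField p k) • x) = _ • ((a : LField p k) • x)
    rw [iterate_frob_smul, (mem_fixedField r _).1 a.2, hx.2, smul_comm]

theorem sigma_zpow (d : ℤ) : sigmaHom p k ((p : LField p k) ^ d) = (p : LField p k) ^ d := by
  rw [map_zpow₀, map_natCast]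

theorem frob_mem_slopeFix (Φ : N ≃ₛₗ[sigmaHom p k] N) (r : ℚ) {x : N} (hx : x ∈ slopeFix Φ r) :
    Φ x ∈ slopeFix Φ r := by
  refine ⟨frob_mem_slopePart Φ r hx.1, ?_⟩
  rw [← Function.iterate_succ_apply, Function.iterate_succ_apply', hx.2, LinearEquiv.map_smulₛₗ,
    sigma_zpow]

theorem iterate_frob_mem_slopeFix (Φ : N ≃ₛₗ[sigmaHom p k] N) (r : ℚ) (n : ℕ) {x : N}
    (hx : x ∈ slopeFix Φ r) : Φ^[n] x ∈ slopeFix Φ r := by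
  induction n with
  | zero => exact hx
  | succ n ih => rw [Function.iterate_succ_apply']; exact frob_mem_slopeFix Φ r ih

end Isocrystal

/-! ### The division algebra `D(r)` -/

section DivisionAlgebra

instance (r : ℚ) : NeZero r.den := ⟨r.den_nz⟩

/-- The embedding `a ↦ diag(a, σ a, …, σ^(h-1) a)` of `K(r)` into the matrices of size `h`. -/
def inclMat (r : ℚ) (a : LField p k) : Matrix (Fin r.den) (Fin r.den) (LField p k) :=
  Matrix.diagonal fun i => (sigmaHom p k)^[i.val] a

/-- The matrix `π_r`, where `r = d / h`: ones above the diagonal and `p^d` in the lower left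
corner. -/
def piMat (r : ℚ) : Matrix (Fin r.den) (Fin r.den) (LField p k) :=
  Matrix.of fun i j => if i.val + 1 = j.val then 1
    else if i.val + 1 = r.den ∧ j.val = 0 then (p : LField p k) ^ r.num else 0

/-- The division algebra `D(r)`, generated over `K(r)` by an element `π_r` such that
`π_r a = σ(a) π_r` for `a ∈ K(r)` and `π_r ^ h = p^d`, where `r = d / h`. It is realised as
a subring of the matrices of size `h` over `L`. -/
def slopeAlg (r : ℚ) : Subring (Matrix (Fin r.den) (Fin r.den) (LField p k)) :=
  Subring.closure (inclMat p k r '' (fixedField p k r) ∪ {piMat p k r})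

/-- The element `π_r` of `D(r)`. -/
def slopePi (r : ℚ) : slopeAlg p k r := ⟨piMat p k r, Subring.subset_closure (Or.inr rfl)⟩

/-- The inclusion of `K(r)` in `D(r)`. -/
def slopeIncl (r : ℚ) (a : fixedField p k r) : slopeAlg p k r :=
  ⟨inclMat p k r a, Subring.subset_closure (Or.inl ⟨a, a.2, rfl⟩)⟩

/-- The absolute value of `D(r)`, normalised by `|p| = 1/p`: the `h`-th root of the absolute value
of the reduced norm, `h` being the degree of `D(r)`. -/
def absD (r : ℚ) (x : slopeAlg p k r) : ℝ≥0 :=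
  absL p k (x : Matrix (Fin r.den) (Fin r.den) (LField p k)).det ^ (1 / (r.den : ℝ))

variable {p k}

theorem piMat_mul_apply_succ (r : ℚ) (y : Matrix (Fin r.den) (Fin r.den) (LField p k))
    (i j l : Fin r.den) (hl : i.val + 1 = l.val) : (piMat p k r * y) i j = y l j := by
  rw [Matrix.mul_apply, Finset.sum_eq_single l]
  · simp [piMat, hl]
  · intro m _ hm
    have h1 : i.val + 1 ≠ m.val := fun h => hm (Fin.ext (h ▸ hl.symm ▸ rfl : m.val = l.val))
    have h2 : i.val + 1 ≠ r.den := by have := l.2; omega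
    simp [piMat, h1, h2]
  · simp

theorem piMat_mul_apply_last (r : ℚ) (y : Matrix (Fin r.den) (Fin r.den) (LField p k))
    (i j : Fin r.den) (hl : i.val + 1 = r.den) :
    (piMat p k r * y) i j = (p : LField p k) ^ r.num * y 0 j := by
  rw [Matrix.mul_apply, Finset.sum_eq_single 0]
  · simp [piMat, hl]
  · intro m _ hm
    have h1 : i.val + 1 ≠ m.val := by have := m.2; omega
    have h2 : m.val ≠ 0 := fun h => hm (Fin.ext h)
    simp [piMat, h1, hm]
  · simp

theorem slopePi_mul_slopeIncl (r : ℚ) (a b : fixedField p k r)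
    (hb : (b : LField p k) = sigma p k a) :
    slopePi p k r * slopeIncl p k r a = slopeIncl p k r b * slopePi p k r := by
  apply Subtype.ext
  change piMat p k r * inclMat p k r a = inclMat p k r b * piMat p k r
  have ha := (mem_fixedField r _).1 a.2
  ext i j
  rw [inclMat, inclMat, Matrix.mul_diagonal, Matrix.diagonal_mul, hb]
  change _ = (sigmaHom p k)^[i.val] (sigmaHom p k a) * _
  rw [← Function.iterate_succ_apply]
  simp only [piMat, Matrix.of_apply]
  split_ifs with h1 h2
  · rw [← h1, one_mul, mul_one]
  · rw [h2.2, Nat.succ_eq_add_one, h2.1, ha, mul_comm]; rfl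
  · simp

/-- Entries in `K(r)`, and commutation with `π_r` up to `σ`: a property of all elements of
`D(r)`. -/
theorem slopeAlg_spec (r : ℚ) {y : Matrix (Fin r.den) (Fin r.den) (LField p k)}
    (hy : y ∈ slopeAlg p k r) :
    (∀ i j, y i j ∈ fixedField p k r) ∧
      piMat p k r * y = (sigmaHom p k).mapMatrix y * piMat p k r := by
  have hnat : ∀ n : ℕ, ∀ a ∈ fixedField p k r, (sigmaHom p k)^[n] a ∈ fixedField p k r := by
    intro n a ha
    rw [mem_fixedField] at ha ⊢
    rw [← Function.iterate_add_apply, add_comm, Function.iterate_add_apply, ha]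
  have hp' : (p : LField p k) ^ r.num ∈ fixedField p k r :=
    zpow_mem (natCast_mem _ p) _
  induction hy using Subring.closure_induction with
  | mem x hx =>
    rcases hx with ⟨a, ha, rfl⟩ | hx
    · constructor
      · intro i j
        rw [inclMat, Matrix.diagonal_apply]
        split_ifs
        · exact hnat _ _ ha
        · exact zero_mem _
      · have h := congrArg Subtype.val
          (slopePi_mul_slopeIncl r ⟨a, ha⟩ ⟨sigmaHom p k a, hnat 1 a ha⟩ rfl)
        change piMat p k r * inclMat p k r a = inclMat p k r (sigmaHom p k a) * piMat p k r at h
        rw [h]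
        congr 1
        ext i j
        simp only [inclMat, RingHom.mapMatrix_apply, Matrix.map_apply, Matrix.diagonal_apply]
        split_ifs
        · rw [← Function.iterate_succ_apply, Function.iterate_succ_apply']
        · simp
    · rw [Set.mem_singleton_iff] at hx
      subst hx
      constructor
      · intro i j
        simp only [piMat, Matrix.of_apply]
        split_ifs
        · exact one_mem _
        · exact hp'
        · exact zero_mem _
      · congr 1
        ext i j
        simp only [piMat, RingHom.mapMatrix_apply, Matrix.map_apply, Matrix.of_apply]
        split_ifs
        · simp
        · rw [sigma_zpow]
        · simp
  | zero => exact ⟨fun i j => zero_mem _, by simp⟩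
  | one =>
    refine ⟨fun i j => ?_, by simp⟩
    rw [Matrix.one_apply]
    split_ifs
    · exact one_mem _
    · exact zero_mem _
  | add x y _ _ hx hy =>
    exact ⟨fun i j => add_mem (hx.1 i j) (hy.1 i j), by rw [mul_add, hx.2, hy.2, map_add, add_mul]⟩
  | neg x _ hx => exact ⟨fun i j => neg_mem (hx.1 i j), by rw [mul_neg, hx.2, map_neg, neg_mul]⟩
  | mul x y _ _ hx hy =>
    refine ⟨fun i j => ?_, ?_⟩
    · rw [Matrix.mul_apply]
      exact sum_mem fun l _ => mul_mem (hx.1 i l) (hy.1 l j)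
    · rw [← mul_assoc, hx.2, mul_assoc, hy.2, map_mul, mul_assoc]

variable {N : Type*} [AddCommGroup N] [Module (LField p k) N]

/-- The operator `∑ⱼ vⱼ Φ^j`. -/
def rowAct (Φ : N ≃ₛₗ[sigmaHom p k] N) (r : ℚ) (v : Fin r.den → LField p k) (x : N) : N :=
  ∑ j, v j • Φ^[j.val] x

theorem sum_piMat_smul (Φ : N ≃ₛₗ[sigmaHom p k] N) (r : ℚ) {x : N}
    (hx : Φ^[r.den] x = (p : LField p k) ^ r.num • x) (i : Fin r.den) :
    ∑ j, piMat p k r i j • Φ^[j.val] x = Φ^[i.val + 1] x := by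
  by_cases h : i.val + 1 = r.den
  · rw [Finset.sum_eq_single 0]
    · simp [piMat, h, hx]
    · intro m _ hm
      have h1 : i.val + 1 ≠ m.val := by have := m.2; omega
      simp [piMat, h1, hm]
    · simp
  · rw [Finset.sum_eq_single ⟨i.val + 1, by have := i.2; omega⟩]
    · simp [piMat]
    · intro m _ hm
      have h1 : i.val + 1 ≠ m.val := fun e => hm (Fin.ext e.symm)
      simp [piMat, h1, h]
    · simp

theorem frob_rowAct (Φ : N ≃ₛₗ[sigmaHom p k] N) (r : ℚ) {x : N}
    (hx : Φ^[r.den] x = (p : LField p k) ^ r.num • x)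
    (y : Matrix (Fin r.den) (Fin r.den) (LField p k)) (i : Fin r.den) :
    Φ (rowAct Φ r (y i) x) = rowAct Φ r (((sigmaHom p k).mapMatrix y * piMat p k r) i) x := by
  have h1 : ∀ j, ((sigmaHom p k).mapMatrix y * piMat p k r) i j • Φ^[j.val] x =
      ∑ l, sigmaHom p k (y i l) • piMat p k r l j • Φ^[j.val] x := by
    intro j
    rw [Matrix.mul_apply, Finset.sum_smul]
    exact Finset.sum_congr rfl fun l _ => by
      rw [RingHom.mapMatrix_apply, Matrix.map_apply, mul_smul]
  rw [rowAct, rowAct, map_sum, Finset.sum_congr rfl fun j _ => h1 j, Finset.sum_comm]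
  refine Finset.sum_congr rfl fun l _ => ?_
  rw [← Finset.smul_sum, sum_piMat_smul Φ r hx, LinearEquiv.map_smulₛₗ,
    Function.iterate_succ_apply']

theorem rowAct_row (Φ : N ≃ₛₗ[sigmaHom p k] N) (r : ℚ) {x : N}
    (hx : Φ^[r.den] x = (p : LField p k) ^ r.num • x)
    {y : Matrix (Fin r.den) (Fin r.den) (LField p k)} (hy : y ∈ slopeAlg p k r) :
    ∀ (n : ℕ) (hn : n < r.den), rowAct Φ r (y ⟨n, hn⟩) x = Φ^[n] (rowAct Φ r (y 0) x)
  | 0, _ => rfl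
  | n + 1, hn => by
    rw [Function.iterate_succ_apply', ← rowAct_row Φ r hx hy n (by omega), frob_rowAct Φ r hx,
      ← (slopeAlg_spec r hy).2]
    congr 1
    funext j
    exact (piMat_mul_apply_succ r y _ j ⟨n + 1, hn⟩ rfl).symm

theorem rowAct_mem (Φ : N ≃ₛₗ[sigmaHom p k] N) (r : ℚ) {x : N} (hx : x ∈ slopeFix Φ r)
    {y : Matrix (Fin r.den) (Fin r.den) (LField p k)} (hy : y ∈ slopeAlg p k r) (i : Fin r.den) :
    rowAct Φ r (y i) x ∈ slopeFix Φ r :=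
  sum_mem fun j _ => (slopeFix Φ r).smul_mem ⟨y i j, (slopeAlg_spec r hy).1 i j⟩
    (iterate_frob_mem_slopeFix Φ r j.val hx)

/-- The action of `D(r)` on `N_r⁰`, where `K(r)` acts by scalars and `π_r` acts by `Φ`: an
element `∑ⱼ aⱼ π_r^j` (`j < h`), whose matrix has first row `(a₀, …, a_(h-1))`, acts by
`∑ⱼ aⱼ Φ^j`. -/
instance slopeSMul (Φ : N ≃ₛₗ[sigmaHom p k] N) (r : ℚ) : SMul (slopeAlg p k r) (slopeFix Φ r) where
  smul y x := ⟨rowAct Φ r (y.1 0) x, rowAct_mem Φ r x.2 y.2 0⟩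

/-- `N_r⁰` as a left `D(r)`-module. -/
instance slopeModule (Φ : N ≃ₛₗ[sigmaHom p k] N) (r : ℚ) :
    Module (slopeAlg p k r) (slopeFix Φ r) where
  one_smul x := by
    apply Subtype.ext
    change ∑ j : Fin r.den, (1 : Matrix (Fin r.den) (Fin r.den) (LField p k)) 0 j • Φ^[j.val] _ = _
    rw [Finset.sum_eq_single 0]
    · simp
    · intro m _ hm
      rw [Matrix.one_apply_ne hm.symm, zero_smul]
    · simp
  mul_smul y z x := by
    apply Subtype.ext
    change ∑ j : Fin r.den, (y.1 * z.1) 0 j • Φ^[j.val] (x : N) =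
      ∑ i : Fin r.den, y.1 0 i • Φ^[i.val] (rowAct Φ r (z.1 0) x)
    have h1 : ∀ i : Fin r.den, Φ^[i.val] (rowAct Φ r (z.1 0) (x : N)) =
        ∑ j, z.1 i j • Φ^[j.val] (x : N) :=
      fun i => (rowAct_row Φ r x.2.2 z.2 i.val i.2).symm
    simp only [h1, Matrix.mul_apply, Finset.sum_smul, Finset.smul_sum, mul_smul]
    exact Finset.sum_comm
  smul_zero y := by
    apply Subtype.ext
    change ∑ j : Fin r.den, y.1 0 j • Φ^[j.val] (0 : N) = 0
    exact Finset.sum_eq_zero fun j _ => by rw [iterate_map_zero, smul_zero]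
  smul_add y x x' := by
    apply Subtype.ext
    change ∑ j : Fin r.den, y.1 0 j • Φ^[j.val] ((x : N) + x') =
      (∑ j : Fin r.den, y.1 0 j • Φ^[j.val] (x : N)) +
        ∑ j : Fin r.den, y.1 0 j • Φ^[j.val] (x' : N)
    rw [← Finset.sum_add_distrib]
    exact Finset.sum_congr rfl fun j _ => by rw [iterate_frob_add, smul_add]
  add_smul y z x := by
    apply Subtype.ext
    change ∑ j : Fin r.den, (y.1 + z.1) 0 j • Φ^[j.val] (x : N) =
      (∑ j : Fin r.den, y.1 0 j • Φ^[j.val] (x : N)) +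
        ∑ j : Fin r.den, z.1 0 j • Φ^[j.val] (x : N)
    rw [← Finset.sum_add_distrib]
    exact Finset.sum_congr rfl fun j _ => by rw [Matrix.add_apply, add_smul]
  zero_smul x := by
    apply Subtype.ext
    change ∑ j : Fin r.den, (0 : Matrix _ _ (LField p k)) (0 : Fin r.den) j • Φ^[j.val] (x : N) = 0
    exact Finset.sum_eq_zero fun j _ => by rw [Matrix.zero_apply, zero_smul]

theorem slopeAlg_smul_def (Φ : N ≃ₛₗ[sigmaHom p k] N) (r : ℚ) (y : slopeAlg p k r)
    (x : slopeFix Φ r) :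
    ((y • x : slopeFix Φ r) : N) = rowAct Φ r (y.1 0) x := rfl

theorem slopePi_smul (Φ : N ≃ₛₗ[sigmaHom p k] N) (r : ℚ) (x : slopeFix Φ r) :
    ((slopePi p k r • x : slopeFix Φ r) : N) = Φ x := by
  rw [slopeAlg_smul_def]
  exact sum_piMat_smul Φ r x.2.2 0

theorem slopeIncl_smul (Φ : N ≃ₛₗ[sigmaHom p k] N) (r : ℚ) (a : fixedField p k r)
    (x : slopeFix Φ r) : slopeIncl p k r a • x = a • x := by
  apply Subtype.ext
  rw [slopeAlg_smul_def]
  change ∑ j : Fin r.den, inclMat p k r a 0 j • Φ^[j.val] (x : N) = (a : LField p k) • (x : N)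
  rw [Finset.sum_eq_single 0]
  · simp [inclMat]
  · intro m _ hm
    rw [inclMat, Matrix.diagonal_apply_ne _ hm.symm, zero_smul]
  · simp

theorem slopePi_pow (r : ℚ) : (slopePi p k r).1 ^ r.den =
    Matrix.scalar _ ((p : LField p k) ^ r.num) := by
  have key : ∀ n : ℕ, n ≤ r.den → ∀ i j : Fin r.den, (piMat p k r ^ n) i j =
      if i.val + n = j.val then 1
        else if i.val + n = j.val + r.den then (p : LField p k) ^ r.num else 0 := by
    intro n
    induction n with
    | zero =>
      intro _ i j
      have := i.2
      rw [pow_zero, Matrix.one_apply, add_zero, if_neg (by omega : ¬ i.val = j.val + r.den)]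
      simp [Fin.ext_iff]
    | succ n ih =>
      intro hn i j
      have hj := j.2
      rw [pow_succ']
      by_cases h : i.val + 1 = r.den
      · rw [piMat_mul_apply_last r _ i j h, ih (by omega), Fin.val_zero]
        rw [if_neg (by omega : ¬ 0 + n = j.val + r.den),
          if_neg (by omega : ¬ i.val + (n + 1) = j.val)]
        by_cases h2 : n = j.val
        · rw [if_pos (by omega), if_pos (by omega), mul_one]
        · rw [if_neg (by omega), if_neg (by omega), mul_zero]
      · have hi := i.2
        rw [piMat_mul_apply_succ r _ i j ⟨i.val + 1, by omega⟩ rfl, ih (by omega)]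
        simp only [add_assoc, add_comm 1 n]
  ext i j
  have hi := i.2
  have hj := j.2
  change (piMat p k r ^ r.den) i j = _
  rw [key r.den le_rfl, if_neg (by omega : ¬ i.val + r.den = j.val), Matrix.scalar_apply,
    Matrix.diagonal_apply]
  simp [Fin.ext_iff]

end DivisionAlgebra

/-! ### The slopes of a norm -/

section Slopes

variable {p k} {N : Type*} [AddCommGroup N] [Module (LField p k) N]

/-- `Min(Φ_r)`: the `L`-norms `α` of `N_r` with `Φ_r · α = p^r α`. -/
def minSlope (Φ : N ≃ₛₗ[sigmaHom p k] N) (r : ℚ) :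
    Set (VNorm (LField p k) (absL p k) (slopePart Φ r)) :=
  {α | ∀ x, frobAct (slopeFrob Φ r) α x = (p : ℝ≥0) ^ (r : ℝ) * α x}

/-- `Min(Φ_r^h)`, where `r = d / h`: the `L`-norms `α` of `N_r` with `Φ_r^h · α = p^d α`. -/
def minSlopePow (Φ : N ≃ₛₗ[sigmaHom p k] N) (r : ℚ) :
    Set (VNorm (LField p k) (absL p k) (slopePart Φ r)) :=
  {α | ∀ x, (frobAct (slopeFrob Φ r))^[r.den] α x = (p : ℝ≥0) ^ r.num * α x}

end Slopes

/-! ### The isocrystal attached to `b ∈ GL(V ⊗ L)` and the building of `GL(V)` over `L` -/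

section Building

variable (V : Type*) [AddCommGroup V] [Module ℚ_[p] V]

/-- The `L`-vector space `N = V ⊗ L`. -/
abbrev NSpace := LField p k ⊗[ℚ_[p]] V

/-- The Frobenius of `L` as a `ℚ_p`-linear automorphism. -/
def sigmaLin : LField p k ≃ₗ[ℚ_[p]] LField p k where
  toFun := sigma p k
  invFun := (sigma p k).symm
  map_add' := map_add _
  map_smul' a x := by
    rw [Algebra.smul_def, map_mul, sigma_qp, RingHom.id_apply, Algebra.smul_def]
  left_inv x := by simp
  right_inv x := by simp

/-- The semilinear bijection `Id_V ⊗ σ` of `N = V ⊗ L`. -/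
def baseFrob : NSpace p k V ≃ₛₗ[sigmaHom p k] NSpace p k V where
  toFun := (sigmaLin p k).rTensor V
  invFun := ((sigmaLin p k).rTensor V).symm
  map_add' x y := map_add _ x y
  map_smul' a x := by
    induction x using TensorProduct.induction_on with
    | zero => simp
    | add x y hx hy => rw [smul_add, map_add, hx, hy, map_add, smul_add]
    | tmul c v =>
      rw [TensorProduct.smul_tmul', LinearEquiv.rTensor_tmul, LinearEquiv.rTensor_tmul,
        TensorProduct.smul_tmul']
      congr 1
      exact map_mul (sigma p k) a c
  left_inv x := ((sigmaLin p k).rTensor V).symm_apply_apply x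
  right_inv x := ((sigmaLin p k).rTensor V).apply_symm_apply x

variable {p k V} in
/-- `Φ = b ∘ (Id_V ⊗ σ)`. -/
def twistFrob (b : NSpace p k V ≃ₗ[LField p k] NSpace p k V) :
    NSpace p k V ≃ₛₗ[sigmaHom p k] NSpace p k V :=
  (baseFrob p k V).trans b

/-- The set of `L`-norms of `N = V ⊗ L`, the norm model of the Bruhat-Tits building of `GL(V)`
over `L`. -/
abbrev NormBuilding := VNorm (LField p k) (absL p k) (NSpace p k V)

/-- A metric on the building is an invariant Euclidean metric if it is invariant under `G(L)` and
under `σ`, and Euclidean on each apartment. In the apartment attached to a basis `e` of `N`, the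
affine coordinates of a norm `α` are the numbers `log α(eᵢ)`. -/
structure IsInvariantEuclidean [MetricSpace (NormBuilding p k V)] : Prop where
  dist_smul : ∀ (g : NSpace p k V ≃ₗ[LField p k] NSpace p k V) (α β : NormBuilding p k V),
    dist (g • α) (g • β) = dist α β
  dist_sigma : ∀ α β : NormBuilding p k V,
    dist (frobAct (baseFrob p k V) α) (frobAct (baseFrob p k V) β) = dist α β
  euclidean : ∀ (n : ℕ) (e : Module.Basis (Fin n) (LField p k) (NSpace p k V)),
    ∃ Q : QuadraticForm ℝ (Fin n → ℝ), Q.PosDef ∧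
      ∀ α β : NormBuilding p k V, α.IsSplitBy e → β.IsSplitBy e →
        dist α β ^ 2 = Q fun i => Real.log (α (e i)) - Real.log (β (e i))

end Building

end IsocNorm
end

open IsocNorm

/-!
The field `L` is complete and discretely valued, so every norm on a finite dimensional `L`-space
is split by a basis, and any two norms are split by a common basis (`VNorm.exists_isSplitBy₂`);
the same holds over the subfields `K(r)`.

*The slope decomposition.* A relation `Φ^m x = ∑ aᵢ Φ^i x` of minimal degree and the extremal
slope `d / h` of its Newton polygon give a lattice that is stable under `p^{-d} Φ^h`, on which
this operator is not nilpotent modulo `p`. Solving Frobenius-linear equations, first over the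
algebraically closed field `k` and then over `W(k)` by lifting, one finds a vector `w ≠ 0` with
`Φ^h w = p^d w` (`exists_frob_eigenvector`). Since `Φ^h - p^d` is surjective on the span of all
such eigenvectors, they span `N` (`span_frobEigenvectors`). Averaging brings `d / h` into lowest
terms, so the `N_r⁰` span, and they are independent by a shortest relation argument. Thus `N` is
the direct sum of the `N_r`, and a `K(r)`-basis of `N_r⁰` is an `L`-basis of `N_r`
(`isInternal_slopePart`, `slopePartBasis`).

*The algebra `D(r)`.* Its elements are the sums `∑_{j < h} aⱼ π_r^j`, and the absolute values of
the terms lie in different cosets of the value group of `L`. So the determinant is dominated by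
one term, whence `|∑ aⱼ π_r^j| = max |aⱼ| |π_r|^j`; in particular nonzero elements are invertible
(`absL_det`, `isUnit_of_ne_zero`). For the same reason a `K(r)`-norm on `N_r⁰` which is
multiplicative for `π_r` is a `D(r)`-norm (`map_slopeAlg_smul`).

*Norms of `N_r`.* A norm of `N_r` in `Min(Φ_r^h)` is split by every `K(r)`-basis of `N_r⁰` that
splits its restriction (`orth_slopePartBasis`): elements of `L` are approximated by elements of
`K(r)` as well as `σ^h` permits. So `Min(Φ_r^h)` is the set of `K(r)`-norms of `N_r⁰`, and since
`Φ` acts as `π_r` on `N_r⁰`, the subset `Min(Φ_r)` is the set of `D(r)`-norms.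

*Minimal displacement.* By invariance the metric is given in all apartments by one quadratic form
`Q`, which is invariant under permutations of the coordinates (`exists_quadraticForm`). The square
of the displacement of a norm `β` is `Q(u)`, where `u` lists the logarithms of the ratios of `Φ ·
β` and `β` in decreasing order on a basis splitting both. If `v` is the vector of the slopes,
multiplied by `log p`, then the partial sums of `u` at the jumps of `v` are at least those of `v`,
and the total sums agree: Frobenius changes the volume of a stable subspace by a factor that does
not depend on the norm (`exists_sorted_orth_stable`), and the minimax principle bounds the ratios
on a subspace by those on the whole space. Hence `Q(v) + Q(u - v) ≤ Q(u)`
(`quadratic_le_of_partial_sums`), and `Q(v)` is the square of the displacement of every norm that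
decomposes along the `N_r` with components in the `Min(Φ_r)`. If conversely `u = v`, the same
bounds show that `Φ · β` is at most `p^s β` on the sum of the parts of slope at most `s` and equal
to it on `N_s`, which forces `β` to decompose (`mem_minNorms_of_logRatio_eq`).

*The group `J`.* An automorphism of `N` that commutes with `Φ` is determined by its restrictions
to the `N_r⁰`, which can be prescribed (`isocAutEquiv`). Finally, an apartment of the building of
`J`, attached to `D(r)`-bases `B`, is mapped into the apartment attached to the `L`-basis of the
`π_r^j B_i`, by repeating coordinates, up to a translation (`exists_quadraticForm_apartment`).
-/

namespace IsocNorm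

/-! ### Complete discretely valued fields and norms over them -/

/-- `abs` is a nonarchimedean absolute value on the field `E` whose nonzero values are powers of
`q > 1` and for which every sequence with differences tending to `0` converges. -/
structure IsCompleteDiscrete {E : Type*} [Field E] (q : ℝ≥0) (abs : E → ℝ≥0) : Prop where
  one_lt : 1 < q
  zero : abs 0 = 0
  one : abs 1 = 1
  mul : ∀ x y, abs (x * y) = abs x * abs y
  add_le : ∀ x y, abs (x + y) ≤ max (abs x) (abs y)
  exists_zpow : ∀ x, x ≠ 0 → ∃ n : ℤ, abs x = q ^ n
  complete : ∀ a : ℕ → E, Filter.Tendsto (fun n => abs (a (n + 1) - a n)) Filter.atTop (nhds 0) →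
    ∃ l, Filter.Tendsto (fun n => abs (a n - l)) Filter.atTop (nhds 0)

namespace IsCompleteDiscrete

variable {E : Type*} [Field E] {q : ℝ≥0} {abs : E → ℝ≥0} (h : IsCompleteDiscrete q abs)
include h

theorem q_pos : 0 < q := lt_trans one_pos h.one_lt

theorem ne_zero {x : E} (hx : x ≠ 0) : abs x ≠ 0 := by
  obtain ⟨n, hn⟩ := h.exists_zpow x hx
  rw [hn]
  exact zpow_ne_zero _ h.q_pos.ne'

theorem eq_zero {x : E} : abs x = 0 ↔ x = 0 :=
  ⟨fun hx => by_contra fun h0 => h.ne_zero h0 hx, fun hx => hx ▸ h.zero⟩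

/-- The absolute value as a homomorphism of monoids with zero. -/
def hom : E →*₀ ℝ≥0 where
  toFun := abs
  map_zero' := h.zero
  map_one' := h.one
  map_mul' := h.mul

theorem pow (x : E) (n : ℕ) : abs (x ^ n) = abs x ^ n := map_pow h.hom x n

theorem prod {ι : Type*} (s : Finset ι) (f : ι → E) : abs (∏ i ∈ s, f i) = ∏ i ∈ s, abs (f i) :=
  map_prod h.hom f s

theorem neg_one : abs (-1) = 1 := by
  have h1 : abs (-1) * abs (-1) = 1 := by rw [← h.mul]; simp [h.one]
  rw [← sq] at h1
  exact (pow_eq_one_iff_of_nonneg zero_le two_ne_zero).1 h1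

theorem neg (x : E) : abs (-x) = abs x := by
  rw [← neg_one_mul, h.mul, h.neg_one, one_mul]

theorem sub_le (x y : E) : abs (x - y) ≤ max (abs x) (abs y) := by
  rw [sub_eq_add_neg, ← h.neg y]
  exact h.add_le _ _

/-- The field as a one-dimensional normed space over itself. -/
def selfNorm : VNorm E abs E where
  toFun := abs
  eq_zero_iff' _ := h.eq_zero
  add_le_max' := h.add_le
  smul' := h.mul

end IsCompleteDiscrete

namespace VNorm

section Ring
variable {A : Type*} [Ring A] {abs : A → ℝ≥0} {X : Type*} [AddCommGroup X] [Module A X]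
  (α : VNorm A abs X)

theorem map_zero : α 0 = 0 := (α.eq_zero_iff' 0).2 rfl

theorem eq_zero_iff {x : X} : α x = 0 ↔ x = 0 := α.eq_zero_iff' x

theorem pos {x : X} (hx : x ≠ 0) : 0 < α x := pos_iff_ne_zero.2 fun h => hx (α.eq_zero_iff.1 h)

theorem map_smul (a : A) (x : X) : α (a • x) = abs a * α x := α.smul' a x

theorem add_le (x y : X) : α (x + y) ≤ max (α x) (α y) := α.add_le_max' x y

theorem sum_le {ι : Type*} (s : Finset ι) (f : ι → X) {C : ℝ≥0} (h : ∀ i ∈ s, α (f i) ≤ C) :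
    α (∑ i ∈ s, f i) ≤ C := by
  classical
  induction s using Finset.induction_on with
  | empty => simp [α.map_zero]
  | insert i s hi ih =>
    rw [Finset.sum_insert hi]
    exact (α.add_le _ _).trans (max_le (h _ (Finset.mem_insert_self _ _))
      (ih fun j hj => h j (Finset.mem_insert_of_mem hj)))

end Ring

section Field
variable {E : Type*} [Field E] {q : ℝ≥0} {abs : E → ℝ≥0} {X : Type*} [AddCommGroup X] [Module E X]
  (h : IsCompleteDiscrete q abs) (α β : VNorm E abs X)
include h

theorem map_neg (x : X) : α (-x) = α x := by
  rw [← neg_one_smul E x, α.map_smul, h.neg_one, one_mul]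

theorem sub_le (x y : X) : α (x - y) ≤ max (α x) (α y) := by
  rw [sub_eq_add_neg, ← α.map_neg h y]
  exact α.add_le _ _

/-- If two vectors have different norms, the larger norm is the norm of the sum. -/
theorem add_eq_of_lt {x y : X} (hxy : α y < α x) : α (x + y) = α x := by
  refine le_antisymm ((α.add_le _ _).trans (max_le le_rfl hxy.le)) ?_
  by_contra! hlt
  have := α.sub_le h (x + y) y
  rw [add_sub_cancel_right] at this
  exact absurd this (not_le.2 (max_lt hlt hxy))

end Field

section Orth
variable {E : Type*} [Field E] {q : ℝ≥0} {abs : E → ℝ≥0} {X : Type*} [AddCommGroup X] [Module E X]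

/-- A finite family of vectors is orthogonal for `α` if `α (∑ cᵢ vᵢ) = max |cᵢ| α(vᵢ)` for all
coefficients; the inequality `≤` being automatic, only `≥` is recorded. -/
def Orth {ι : Type*} [Fintype ι] (α : VNorm E abs X) (v : ι → X) : Prop :=
  ∀ (c : ι → E) (i : ι), abs (c i) * α (v i) ≤ α (∑ j, c j • v j)

theorem sum_smul_le {ι : Type*} (s : Finset ι) (α : VNorm E abs X) (v : ι → X) (c : ι → E) {C : ℝ≥0}
    (hC : ∀ i ∈ s, abs (c i) * α (v i) ≤ C) : α (∑ i ∈ s, c i • v i) ≤ C :=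
  α.sum_le _ _ fun i hi => by rw [α.map_smul]; exact hC i hi

theorem isSplitBy_iff {ι : Type*} (h : IsCompleteDiscrete q abs) {α : VNorm E abs X}
    {e : Module.Basis ι E X} :
    α.IsSplitBy e ↔ ∀ x i, abs (e.repr x i) * α (e i) ≤ α x := by
  constructor
  · intro H x i
    by_cases hi : e.repr x i = 0
    · simp [hi, h.zero]
    rw [H x]
    exact Finset.le_sup (f := fun i => abs (e.repr x i) * α (e i)) (Finsupp.mem_support_iff.2 hi)
  · intro H x
    refine le_antisymm ?_ (Finset.sup_le fun i _ => H x i)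
    conv_lhs => rw [← e.linearCombination_repr x, Finsupp.linearCombination_apply, Finsupp.sum]
    exact sum_smul_le _ _ _ _ fun i hi =>
      Finset.le_sup (f := fun i => abs (e.repr x i) * α (e i)) hi

theorem isSplitBy_iff_orth {ι : Type*} [Fintype ι] (h : IsCompleteDiscrete q abs)
    {α : VNorm E abs X} {e : Module.Basis ι E X} : α.IsSplitBy e ↔ α.Orth e := by
  rw [isSplitBy_iff h]
  constructor
  · intro H c i
    have := H (∑ j, c j • e j) i
    rwa [e.repr_sum_self] at this
  · intro H x i
    have := H (e.repr x) i
    rwa [e.sum_repr] at this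

theorem Orth.linearIndependent {ι : Type*} [Fintype ι] (h : IsCompleteDiscrete q abs)
    {α : VNorm E abs X} {v : ι → X} (hv : α.Orth v) (h0 : ∀ i, v i ≠ 0) :
    LinearIndependent E v := by
  rw [Fintype.linearIndependent_iff]
  intro c hc i
  have := hv c i
  rw [hc, α.map_zero, nonpos_iff_eq_zero, mul_eq_zero] at this
  rcases this with h1 | h1
  · exact h.eq_zero.1 h1
  · exact absurd (α.eq_zero_iff.1 h1) (h0 i)

/-- If a family is orthogonal for `β` and `α ≤ C β` on its members, then `α ≤ C β` on its span. -/
theorem Orth.le_mul_of_mem_span {ι : Type*} [Fintype ι] {α β : VNorm E abs X} {v : ι → X}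
    (hv : β.Orth v) {C : ℝ≥0} (hC : ∀ i, α (v i) ≤ C * β (v i)) {x : X}
    (hx : x ∈ Submodule.span E (Set.range v)) : α x ≤ C * β x := by
  obtain ⟨c, rfl⟩ := (Submodule.mem_span_range_iff_exists_fun E).1 hx
  refine sum_smul_le _ _ _ _ fun i _ => ?_
  calc abs (c i) * α (v i) ≤ abs (c i) * (C * β (v i)) := by gcongr; exact hC i
    _ = C * (abs (c i) * β (v i)) := by ring
    _ ≤ _ := by gcongr; exact hv c i

theorem Orth.comp {ι κ : Type*} [Fintype ι] [Fintype κ]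
    {α : VNorm E abs X} {v : ι → X} (hv : α.Orth v) (f : κ → ι) (hf : Function.Injective f) :
    α.Orth (v ∘ f) := by
  classical
  intro c i
  have key := hv (fun j => if hj : ∃ k, f k = j then c hj.choose else 0) (f i)
  have hch : ∀ k, ∀ hj : ∃ k', f k' = f k, hj.choose = k := fun k hj => hf hj.choose_spec
  have h1 : (∑ j, (if hj : ∃ k, f k = j then c hj.choose else 0) • v j) =
      ∑ k, c k • (v ∘ f) k := by
    symm
    apply Finset.sum_of_injOn f hf.injOn (fun _ _ => Finset.mem_coe.2 (Finset.mem_univ _))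
    · intro j _ hj
      rw [dif_neg, zero_smul]
      rintro ⟨k, rfl⟩
      exact hj ⟨k, by simp, rfl⟩
    · intro k _
      rw [dif_pos ⟨k, rfl⟩, hch k]
      rfl
  rw [h1, dif_pos ⟨i, rfl⟩, hch i] at key
  exact key

/-- Adding to an orthogonal family a vector that is orthogonal to its span. -/
theorem Orth.cons (h : IsCompleteDiscrete q abs) {n : ℕ} {α : VNorm E abs X} {v : Fin n → X}
    (hv : α.Orth v) {y : X}
    (hy : ∀ x ∈ Submodule.span E (Set.range v), ∀ a : E, abs a * α y ≤ α (a • y + x)) :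
    α.Orth (Fin.cons y v : Fin (n + 1) → X) := by
  intro c i
  rw [Fin.sum_univ_succ]
  simp only [Fin.cons_zero, Fin.cons_succ]
  have hx : (∑ j : Fin n, c j.succ • v j) ∈ Submodule.span E (Set.range v) :=
    sum_mem fun j _ => Submodule.smul_mem _ _ (Submodule.subset_span ⟨j, rfl⟩)
  have h0 := hy _ hx (c 0)
  cases i using Fin.cases with
  | zero => exact h0
  | succ i =>
    simp only [Fin.cons_succ]
    refine (hv (fun j => c j.succ) i).trans ?_
    have := α.sub_le h (c 0 • y + ∑ j : Fin n, c j.succ • v j) (c 0 • y)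
    rw [add_sub_cancel_left] at this
    refine this.trans (max_le le_rfl ?_)
    rw [α.map_smul]
    exact h0

end Orth

end VNorm

/-! ### Existence of splitting bases -/

/-- In finitely many cosets of `q ^ ℤ` only finitely many elements lie between two positive
bounds. -/
theorem finite_inter_zpow_cosets {q : ℝ≥0} (hq : 1 < q) {ι : Type*} [Finite ι] (d : ι → ℝ≥0)
    {c : ℝ≥0} (hc : 0 < c) (C : ℝ≥0) :
    {r : ℝ≥0 | (∃ (i : ι) (m : ℤ), r = q ^ m * d i) ∧ c ≤ r ∧ r ≤ C}.Finite := by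
  have key : ∀ i, {m : ℤ | c ≤ q ^ m * d i ∧ q ^ m * d i ≤ C}.Finite := by
    intro i
    rcases eq_or_ne (d i) 0 with hd | hd
    · refine Set.finite_empty.subset fun m hm => ?_
      have := hm.1
      rw [hd, mul_zero] at this
      exact absurd hc (not_lt.2 this)
    have hd' : 0 < d i := pos_iff_ne_zero.2 hd
    obtain ⟨n₁, hn₁⟩ := exists_nat_gt (C / d i)
    obtain ⟨N, hN⟩ := pow_unbounded_of_one_lt (C / d i) hq
    obtain ⟨M, hM⟩ := pow_unbounded_of_one_lt (d i / c) hq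
    refine (Set.finite_Icc (-(M : ℤ)) N).subset fun m hm => ⟨?_, ?_⟩
    · by_contra! hlt
      have h1 : q ^ m ≤ (q ^ M)⁻¹ := by
        rw [← zpow_natCast, ← zpow_neg]
        exact zpow_le_zpow_right₀ hq.le hlt.le
      have h2 : q ^ m * d i < c := by
        calc q ^ m * d i ≤ (q ^ M)⁻¹ * d i := by gcongr
          _ < c := by
            rw [inv_mul_lt_iff₀ (pow_pos (one_pos.trans hq) _)]
            rwa [div_lt_iff₀ hc] at hM
      exact absurd hm.1 (not_le.2 h2)
    · by_contra! hlt
      have h1 : q ^ N ≤ q ^ m := by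
        rw [← zpow_natCast]
        exact zpow_le_zpow_right₀ hq.le hlt.le
      have h2 : C < q ^ m * d i := by
        calc C < q ^ N * d i := by rwa [div_lt_iff₀ hd'] at hN
          _ ≤ _ := by gcongr
      exact absurd hm.2 (not_le.2 h2)
  refine (Set.finite_iUnion fun i => (key i).image fun m => q ^ m * d i).subset ?_
  rintro r ⟨⟨i, m, rfl⟩, h1, h2⟩
  exact Set.mem_iUnion.2 ⟨i, m, ⟨h1, h2⟩, rfl⟩

namespace VNorm
variable {E : Type*} [Field E] {q : ℝ≥0} {abs : E → ℝ≥0} {X : Type*} [AddCommGroup X] [Module E X]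
  (h : IsCompleteDiscrete q abs)
include h

theorem Orth.exists_eq {ι : Type*} [Fintype ι] [Nonempty ι] {α : VNorm E abs X} {v : ι → X}
    (hv : α.Orth v) (c : ι → E) : ∃ i, α (∑ j, c j • v j) = abs (c i) * α (v i) := by
  obtain ⟨i, -, hi⟩ := Finset.exists_max_image Finset.univ (fun i => abs (c i) * α (v i))
    Finset.univ_nonempty
  exact ⟨i, le_antisymm (sum_smul_le _ _ _ _ fun j hj => hi j hj) (hv c i)⟩

/-- On the span of an orthogonal family, the values of a norm lie in finitely many cosets of `q ^
ℤ`. -/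
theorem Orth.exists_value {ι : Type*} [Fintype ι] {α : VNorm E abs X} {v : ι → X}
    (hv : α.Orth v) {x : X} (hx : x ∈ Submodule.span E (Set.range v)) (hx0 : x ≠ 0) :
    ∃ (i : ι) (m : ℤ), α x = q ^ m * α (v i) := by
  obtain ⟨c, rfl⟩ := (Submodule.mem_span_range_iff_exists_fun E).1 hx
  rcases isEmpty_or_nonempty ι with hι | hι
  · simp at hx0
  obtain ⟨i, hi⟩ := hv.exists_eq h c
  have hci : c i ≠ 0 := by
    intro hci
    rw [hci, h.zero, zero_mul] at hi
    exact hx0 (α.eq_zero_iff.1 hi)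
  obtain ⟨m, hm⟩ := h.exists_zpow _ hci
  exact ⟨i, m, by rw [hi, hm]⟩

/-- The distance from a vector to a subspace with an orthogonal basis is attained: a strictly
decreasing sequence of distances takes its values in finitely many cosets of `q ^ ℤ`, hence
tends to `0`, and then the vector lies in the (complete) subspace. -/
theorem Orth.exists_nearest {N : ℕ} {α : VNorm E abs X} {v : Fin N → X} (hv : α.Orth v)
    (hv0 : ∀ i, v i ≠ 0) {x : X} (hx : x ∉ Submodule.span E (Set.range v)) :
    ∃ w ∈ Submodule.span E (Set.range v), ∀ w' ∈ Submodule.span E (Set.range v),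
      α (x + w) ≤ α (x + w') := by
  by_contra! hcon
  choose! f hf hlt using hcon
  set W := Submodule.span E (Set.range v)
  let w : ℕ → X := fun m => f^[m] 0
  have hw : ∀ n, w n ∈ W := by
    intro n
    induction n with
    | zero => exact zero_mem _
    | succ n ih =>
      change f^[n + 1] 0 ∈ W
      rw [Function.iterate_succ_apply']
      exact hf _ ih
  have hdec : ∀ n, α (x + w (n + 1)) < α (x + w n) := by
    intro n
    have := hlt (w n) (hw n)
    change α (x + f^[n + 1] 0) < _
    rwa [Function.iterate_succ_apply']
  have hanti : StrictAnti fun n => α (x + w n) := strictAnti_nat_of_succ_lt hdec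
  have hdiff : ∀ n, α (w (n + 1) - w n) = α (x + w n) := by
    intro n
    have : w (n + 1) - w n = -((x + w n) + -(x + w (n + 1))) := by abel
    rw [this, α.map_neg h]
    exact α.add_eq_of_lt h (by rw [α.map_neg h]; exact hdec n)
  have hval : ∀ n, ∃ (i : Fin N) (m : ℤ), α (x + w n) = q ^ m * α (v i) := by
    intro n
    rw [← hdiff n]
    refine hv.exists_value h (sub_mem (hw _) (hw _)) fun h0 => ?_
    have h1 := hdiff n
    rw [h0, α.map_zero] at h1
    exact absurd (hdec n) (by rw [← h1]; exact not_lt_zero)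
  have hlim : Filter.Tendsto (fun n => α (x + w n)) Filter.atTop (nhds 0) := by
    rw [tendsto_order]
    refine ⟨fun a ha => absurd ha not_lt_zero, fun c hc => ?_⟩
    have hex : ∃ n, α (x + w n) < c := by
      by_contra! hge
      exact Set.infinite_range_of_injective hanti.injective
        ((finite_inter_zpow_cosets h.one_lt (fun i => α (v i)) hc (α (x + w 0))).subset
          (by rintro _ ⟨n, rfl⟩; exact ⟨hval n, hge n, hanti.antitone (Nat.zero_le n)⟩))
    obtain ⟨n, hn⟩ := hex
    exact Filter.eventually_atTop.2 ⟨n, fun m hm => (hanti.antitone hm).trans_lt hn⟩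
  choose c hc using fun n => (Submodule.mem_span_range_iff_exists_fun E).1 (hw n)
  have hconv : ∀ i, ∃ l, Filter.Tendsto (fun n => abs (c n i - l)) Filter.atTop (nhds 0) := by
    intro i
    refine h.complete (fun n => c n i) ?_
    have hpos : 0 < α (v i) := α.pos (hv0 i)
    have h1 : ∀ n, abs (c (n + 1) i - c n i) ≤ α (x + w n) * (α (v i))⁻¹ := by
      intro n
      rw [← div_eq_mul_inv, le_div_iff₀ hpos, ← hdiff n, ← hc (n + 1), ← hc n,
        ← Finset.sum_sub_distrib]
      have := hv (fun j => c (n + 1) j - c n j) i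
      simpa only [sub_smul] using this
    have h2 := hlim.mul_const (α (v i))⁻¹
    rw [zero_mul] at h2
    exact tendsto_of_tendsto_of_tendsto_of_le_of_le tendsto_const_nhds h2 (fun _ => zero_le) h1
  choose l hl using hconv
  have hfin : x + ∑ i, l i • v i = 0 := by
    rw [← α.eq_zero_iff, ← nonpos_iff_eq_zero]
    have h1 : ∀ n, α (x + ∑ i, l i • v i) ≤
        α (x + w n) + ∑ i, abs (c n i - l i) * α (v i) := by
      intro n
      have : x + ∑ i, l i • v i = (x + w n) - ∑ i, (c n i - l i) • v i := by
        rw [← hc n]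
        simp only [sub_smul, Finset.sum_sub_distrib]
        abel
      rw [this]
      refine (α.sub_le h _ _).trans (max_le le_self_add ?_)
      refine le_trans (sum_smul_le _ _ _ _ fun i hi => ?_) le_add_self
      exact Finset.single_le_sum (f := fun i => abs (c n i - l i) * α (v i))
        (fun _ _ => zero_le) hi
    have h2 : Filter.Tendsto (fun n => α (x + w n) + ∑ i, abs (c n i - l i) * α (v i))
        Filter.atTop (nhds (0 + ∑ i, 0 * α (v i))) :=
      hlim.add (tendsto_finsetSum _ fun i _ => (hl i).mul_const _)
    simp only [zero_mul, Finset.sum_const_zero, add_zero] at h2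
    exact ge_of_tendsto' h2 h1
  apply hx
  rw [eq_neg_of_add_eq_zero_left hfin]
  exact neg_mem (sum_mem fun i _ => Submodule.smul_mem _ _ (Submodule.subset_span ⟨i, rfl⟩))

omit h in
theorem span_range_cons {n : ℕ} (y : X) (v : Fin n → X) :
    Submodule.span E (Set.range (Fin.cons y v : Fin (n + 1) → X)) =
      Submodule.span E {y} ⊔ Submodule.span E (Set.range v) := by
  rw [Fin.range_cons, Submodule.span_insert]

/-- Every subspace of finite dimension has an orthogonal basis. -/
theorem exists_orth_of_finrank (α : VNorm E abs X) :
    ∀ (n : ℕ) (W : Submodule E X), FiniteDimensional E W → Module.finrank E W = n →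
      ∃ v : Fin n → X, (∀ i, v i ≠ 0) ∧ Submodule.span E (Set.range v) = W ∧ α.Orth v := by
  intro n
  induction n with
  | zero =>
    intro W _ hW
    refine ⟨Fin.elim0, fun i => i.elim0, ?_, fun c i => i.elim0⟩
    have h1 : W = ⊥ := Submodule.finrank_eq_zero.1 hW
    rw [h1, Set.range_eq_empty, Submodule.span_empty]
  | succ n ih =>
    intro W _ hW
    let b := Module.finBasisOfFinrankEq E W hW
    let u : Fin (n + 1) → X := fun i => b i
    have hu : LinearIndependent E u := b.linearIndependent.map' W.subtype (Submodule.ker_subtype W)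
    have hus : Submodule.span E (Set.range u) = W := by
      have : Set.range u = W.subtype '' Set.range b := by
        rw [← Set.range_comp]; rfl
      rw [this, Submodule.span_image, b.span_eq, Submodule.map_subtype_top]
    rw [← Fin.cons_self_tail u] at hu hus
    rw [span_range_cons] at hus
    have hli := (linearIndependent_finCons.1 hu)
    obtain ⟨v, hv0, hvs, hv⟩ := ih (Submodule.span E (Set.range (Fin.tail u)))
      (FiniteDimensional.span_of_finite E (Set.finite_range _))
      (by rw [finrank_span_eq_card hli.1, Fintype.card_fin])
    have hx : u 0 ∉ Submodule.span E (Set.range v) := by rw [hvs]; exact hli.2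
    obtain ⟨w, hw, hmin⟩ := hv.exists_nearest h hv0 hx
    have hy0 : u 0 + w ≠ 0 := fun h0 => hx (by
      rw [eq_neg_of_add_eq_zero_left h0]; exact neg_mem hw)
    refine ⟨Fin.cons (u 0 + w) v, ?_, ?_, hv.cons h ?_⟩
    · intro i
      cases i using Fin.cases with
      | zero => exact hy0
      | succ i => exact hv0 i
    · rw [span_range_cons, ← hus, ← hvs]
      apply le_antisymm
      · refine sup_le ?_ le_sup_right
        rw [Submodule.span_singleton_le_iff_mem]
        exact add_mem (Submodule.mem_sup_left (Submodule.mem_span_singleton_self _))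
          (Submodule.mem_sup_right hw)
      · refine sup_le ?_ le_sup_right
        rw [Submodule.span_singleton_le_iff_mem]
        have := sub_mem (S := Submodule E X)
          (Submodule.mem_sup_left (Submodule.mem_span_singleton_self (R := E) (u 0 + w)))
          (Submodule.mem_sup_right hw)
        rwa [add_sub_cancel_right] at this
    · intro x hx a
      rcases eq_or_ne a 0 with rfl | ha
      · simp [h.zero]
      have h1 : a • (u 0 + w) + x = a • (u 0 + (w + a⁻¹ • x)) := by
        rw [← add_assoc, smul_add _ _ (a⁻¹ • x), smul_smul, mul_inv_cancel₀ ha, one_smul]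
      rw [h1, α.map_smul]
      gcongr
      exact hmin _ (add_mem hw (Submodule.smul_mem _ _ hx))

/-- A nonzero vector of a subspace of finite dimension has an orthogonal hyperplane there. -/
theorem exists_orth_hyperplane (α : VNorm E abs X) {n : ℕ} {W : Submodule E X}
    [FiniteDimensional E W] (hW : Module.finrank E W = n + 1) {e : X} (he : e ∈ W) (he0 : e ≠ 0) :
    ∃ H : Submodule E X, H ≤ W ∧ FiniteDimensional E H ∧ Module.finrank E H = n ∧
      Submodule.span E {e} ⊔ H = W ∧ ∀ x ∈ H, ∀ a : E, abs a * α e ≤ α (a • e + x) := by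
  obtain ⟨v, hv0, hvs, hv⟩ := α.exists_orth_of_finrank h (n + 1) W inferInstance hW
  obtain ⟨c, hc⟩ := (Submodule.mem_span_range_iff_exists_fun E).1 (hvs ▸ he)
  obtain ⟨i, hi⟩ := hv.exists_eq h c
  rw [hc] at hi
  have hci : c i ≠ 0 := by
    intro hci
    rw [hci, h.zero, zero_mul] at hi
    exact he0 (α.eq_zero_iff.1 hi)
  have hli : LinearIndependent E v := hv.linearIndependent h hv0
  have hle : Submodule.span E (Set.range (v ∘ i.succAbove)) ≤ W := by
    rw [← hvs]
    exact Submodule.span_mono (Set.range_comp_subset_range _ _)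
  refine ⟨Submodule.span E (Set.range (v ∘ i.succAbove)), hle,
    FiniteDimensional.span_of_finite E (Set.finite_range _), ?_, ?_, ?_⟩
  · rw [finrank_span_eq_card (hli.comp _ Fin.succAbove_right_injective), Fintype.card_fin]
  · refine le_antisymm (sup_le ((Submodule.span_singleton_le_iff_mem _ _).2 he) hle) ?_
    rw [← hvs, Submodule.span_le]
    have hrest : ∀ j, v (i.succAbove j) ∈ Submodule.span E {e} ⊔
        Submodule.span E (Set.range (v ∘ i.succAbove)) :=
      fun j => Submodule.mem_sup_right (Submodule.subset_span ⟨j, rfl⟩)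
    rintro _ ⟨j, rfl⟩
    rcases Fin.eq_self_or_eq_succAbove i j with rfl | ⟨j, rfl⟩
    · have h1 : v j = (c j)⁻¹ • (e - ∑ l, c (j.succAbove l) • v (j.succAbove l)) := by
        rw [← hc, Fin.sum_univ_succAbove _ j, add_sub_cancel_right, smul_smul, inv_mul_cancel₀ hci,
          one_smul]
      rw [SetLike.mem_coe, h1]
      exact Submodule.smul_mem _ _ (sub_mem
        (Submodule.mem_sup_left (Submodule.mem_span_singleton_self _))
        (sum_mem fun l _ => Submodule.smul_mem _ _ (hrest l)))
    · exact hrest j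
  · intro x hx a
    obtain ⟨d, rfl⟩ := (Submodule.mem_span_range_iff_exists_fun E).1 hx
    let g : Fin (n + 1) → E := i.insertNth (a * c i) fun l => a * c (i.succAbove l) + d l
    have h1 : a • e + ∑ l, d l • (v ∘ i.succAbove) l = ∑ j, g j • v j := by
      rw [← hc, Fin.sum_univ_succAbove _ i, Fin.sum_univ_succAbove _ i, smul_add, smul_smul,
        Finset.smul_sum, add_assoc, ← Finset.sum_add_distrib]
      simp [g, add_smul, mul_smul]
    have h2 := hv g i
    rw [h1, hi, ← mul_assoc, ← h.mul]
    simpa [g] using h2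

/-- Two norms on a space of finite dimension have a common orthogonal basis: take a vector at
which the ratio of the norms is maximal, and a hyperplane that is orthogonal to it for one of
the norms; it is orthogonal to it for the other one as well. -/
theorem exists_orth₂_of_finrank (α β : VNorm E abs X) :
    ∀ (n : ℕ) (W : Submodule E X), FiniteDimensional E W → Module.finrank E W = n →
      ∃ v : Fin n → X, (∀ i, v i ≠ 0) ∧ Submodule.span E (Set.range v) = W ∧
        α.Orth v ∧ β.Orth v := by
  intro n
  induction n with
  | zero =>
    intro W _ hW
    refine ⟨Fin.elim0, fun i => i.elim0, ?_, fun c i => i.elim0, fun c i => i.elim0⟩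
    have h1 : W = ⊥ := Submodule.finrank_eq_zero.1 hW
    rw [h1, Set.range_eq_empty, Submodule.span_empty]
  | succ n ih =>
    intro W _ hW
    obtain ⟨v, hv0, hvs, hv⟩ := α.exists_orth_of_finrank h (n + 1) W inferInstance hW
    obtain ⟨w, hw0, hws, hw⟩ := β.exists_orth_of_finrank h (n + 1) W inferInstance hW
    obtain ⟨j, -, hj⟩ := Finset.exists_max_image Finset.univ (fun i => α (w i) / β (w i))
      Finset.univ_nonempty
    have hbd : ∀ x ∈ W, α x ≤ α (w j) / β (w j) * β x := by
      intro x hx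
      refine hw.le_mul_of_mem_span (fun i => ?_) (hws ▸ hx)
      rw [← div_le_iff₀ (β.pos (hw0 i))]
      exact hj i (Finset.mem_univ _)
    have hwW : w j ∈ W := hws ▸ Submodule.subset_span ⟨j, rfl⟩
    let r₀ := α (w j) / β (w j)
    have hr₀ : 0 < r₀ := div_pos (α.pos (hw0 j)) (β.pos (hw0 j))
    -- the vector `w j` already realises the maximal ratio
    obtain ⟨H, hHW, hHfin, hHrank, hHs, hHα⟩ := α.exists_orth_hyperplane h hW hwW (hw0 j)
    have hHβ : ∀ x ∈ H, ∀ a : E, abs a * β (w j) ≤ β (a • w j + x) := by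
      intro x hx a
      have h1 := (hHα x hx a).trans (hbd _ (add_mem (W.smul_mem a hwW) (hHW hx)))
      have h2 : abs a * α (w j) = α (w j) / β (w j) * (abs a * β (w j)) := by
        have := (β.pos (hw0 j)).ne'
        field_simp
      rw [h2] at h1
      exact le_of_mul_le_mul_left h1 hr₀
    obtain ⟨u, hu0, hus, huα, huβ⟩ := ih H hHfin hHrank
    rw [← hus] at hHα hHβ hHs
    refine ⟨Fin.cons (w j) u, ?_, by rw [span_range_cons, hHs], huα.cons h hHα, huβ.cons h hHβ⟩
    intro i
    cases i using Fin.cases with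
    | zero => exact hw0 j
    | succ i => exact hu0 i

theorem exists_isSplitBy₂ [FiniteDimensional E X] (α β : VNorm E abs X) :
    ∃ b : Module.Basis (Fin (Module.finrank E X)) E X, α.IsSplitBy b ∧ β.IsSplitBy b := by
  obtain ⟨v, hv0, hvs, hα, hβ⟩ := exists_orth₂_of_finrank h α β (Module.finrank E X) ⊤ inferInstance
    (finrank_top E X)
  refine ⟨Module.Basis.mk (hα.linearIndependent h hv0) hvs.ge, ?_, ?_⟩
  · rw [isSplitBy_iff_orth h, Module.Basis.coe_mk]
    exact hα
  · rw [isSplitBy_iff_orth h, Module.Basis.coe_mk]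
    exact hβ

theorem exists_isSplitBy [FiniteDimensional E X] (α : VNorm E abs X) :
    ∃ b : Module.Basis (Fin (Module.finrank E X)) E X, α.IsSplitBy b :=
  let ⟨b, hb, _⟩ := exists_isSplitBy₂ h α α
  ⟨b, hb⟩

end VNorm

/-! ### Volumes, and relative positions of norms on subspaces -/

/-- A finite family in a linear order can be listed in decreasing order. -/
theorem exists_equiv_antitone {ι : Type*} [Fintype ι] {n : ℕ} (hn : Fintype.card ι = n)
    {R : Type*} [LinearOrder R] (f : ι → R) : ∃ e : Fin n ≃ ι, Antitone (f ∘ e) := by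
  let e₀ : Fin n ≃ ι := (Fintype.equivFinOfCardEq hn).symm
  let g : Fin n → Rᵒᵈ := fun i => OrderDual.toDual (f (e₀ i))
  exact ⟨(Tuple.sort g).trans e₀, fun i j hij => Tuple.monotone_sort g hij⟩

namespace VNorm
variable {E : Type*} [Field E] {q : ℝ≥0} {abs : E → ℝ≥0} {X : Type*} [AddCommGroup X] [Module E X]
  (h : IsCompleteDiscrete q abs)
include h

/-- The norm that is split by the basis `b` and takes the value `w i` at `b i`. -/
noncomputable def ofBasis {ι : Type*} [Fintype ι] (b : Module.Basis ι E X) (w : ι → ℝ≥0)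
    (hw : ∀ i, w i ≠ 0) : VNorm E abs X where
  toFun x := Finset.univ.sup fun i => abs (b.repr x i) * w i
  eq_zero_iff' x := by
    rw [← bot_eq_zero', Finset.sup_eq_bot_iff]
    constructor
    · intro H
      apply b.repr.injective
      ext i
      have := H i (Finset.mem_univ i)
      rw [bot_eq_zero', mul_eq_zero, or_iff_left (hw i), h.eq_zero] at this
      simpa using this
    · rintro rfl i -
      simp [h.zero]
  add_le_max' x y := by
    refine Finset.sup_le fun i _ => ?_
    rw [map_add, Finsupp.add_apply]
    refine (mul_le_mul_left (h.add_le _ _) _).trans ?_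
    rw [max_mul]
    exact max_le_max (Finset.le_sup (f := fun i => abs (b.repr x i) * w i) (Finset.mem_univ i))
      (Finset.le_sup (f := fun i => abs (b.repr y i) * w i) (Finset.mem_univ i))
  smul' a x := by
    rw [NNReal.mul_finset_sup]
    refine Finset.sup_congr rfl fun i _ => ?_
    rw [_root_.map_smul, Finsupp.smul_apply, smul_eq_mul, h.mul, mul_assoc]

theorem ofBasis_basis {ι : Type*} [Fintype ι] (b : Module.Basis ι E X) (w : ι → ℝ≥0)
    (hw : ∀ i, w i ≠ 0) (i : ι) : ofBasis h b w hw (b i) = w i := by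
  classical
  change (Finset.univ.sup fun j => abs (b.repr (b i) j) * w j) = w i
  apply le_antisymm
  · refine Finset.sup_le fun j _ => ?_
    rw [b.repr_self, Finsupp.single_apply]
    split_ifs with hij
    · rw [h.one, one_mul, hij]
    · rw [h.zero, zero_mul]
      exact zero_le
  · refine le_trans ?_ (Finset.le_sup (Finset.mem_univ i))
    simp [h.one]

theorem orth_ofBasis {ι : Type*} [Fintype ι] (b : Module.Basis ι E X) (w : ι → ℝ≥0)
    (hw : ∀ i, w i ≠ 0) : (ofBasis h b w hw).Orth b := by
  intro c i
  rw [ofBasis_basis]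
  change _ ≤ Finset.univ.sup fun j => abs (b.repr (∑ l, c l • b l) j) * w j
  rw [b.repr_sum_self]
  exact Finset.le_sup (f := fun j => abs (c j) * w j) (Finset.mem_univ i)

/-- Hadamard's inequality. -/
theorem Orth.abs_det_mul_prod_le {ι : Type*} [Fintype ι] [DecidableEq ι] {α : VNorm E abs X}
    {a : Module.Basis ι E X} (ha : α.Orth a) (v : ι → X) :
    abs (a.det v) * ∏ i, α (a i) ≤ ∏ i, α (v i) := by
  have hpos : 0 < ∏ i, α (a i) := Finset.prod_pos fun i _ => α.pos (a.ne_zero i)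
  have hM : ∀ i j, abs (a.toMatrix v i j) * α (a i) ≤ α (v j) := by
    intro i j
    have := ha (a.repr (v j)) i
    rwa [a.sum_repr] at this
  rw [← le_div_iff₀ hpos, Module.Basis.det_apply, Matrix.det_apply]
  refine h.selfNorm.sum_le _ _ fun s _ => ?_
  have h1 : h.selfNorm (Equiv.Perm.sign s • ∏ i, a.toMatrix v (s i) i) =
      ∏ i, abs (a.toMatrix v (s i) i) := by
    rw [← h.prod]
    rcases Int.units_eq_one_or (Equiv.Perm.sign s) with hs | hs
    · rw [hs, one_smul]; rfl
    · rw [hs, Units.neg_smul, one_smul]; exact h.neg _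
  rw [h1, le_div_iff₀ hpos, ← Equiv.prod_comp s fun i => α (a i), ← Finset.prod_mul_distrib]
  exact Finset.prod_le_prod' fun i _ => hM _ _

/-- The change of volume between two orthogonal bases. -/
theorem Orth.abs_det_mul_prod {ι : Type*} [Fintype ι] [DecidableEq ι] {α : VNorm E abs X}
    {a b : Module.Basis ι E X} (ha : α.Orth a) (hb : α.Orth b) :
    abs (a.det b) * ∏ i, α (a i) = ∏ i, α (b i) := by
  refine le_antisymm (ha.abs_det_mul_prod_le h b) ?_
  have h1 := mul_le_mul_right (hb.abs_det_mul_prod_le h a) (abs (a.det b))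
  rwa [← mul_assoc, ← h.mul, Module.Basis.det_mul_det, Module.Basis.det_self, h.one, one_mul] at h1

/-- The ratio of the volumes of two norms `α'`, `α` equals the ratio of the volumes of two other
norms `β'`, `β` if `(α', β')` is the image of `(α, β)` by some bijection. -/
theorem Orth.prod_mul_prod_eq {ι : Type*} [Fintype ι] {α α' β β' : VNorm E abs X}
    {w g z z' : Module.Basis ι E X} (hw : α.Orth w) (hw' : α'.Orth w) (hg : β.Orth g)
    (hg' : β'.Orth g) (hzα : α.Orth z) (hzβ : β.Orth z) (hzα' : α'.Orth z') (hzβ' : β'.Orth z')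
    (hα : ∀ i, α' (z' i) = α (z i)) (hβ : ∀ i, β' (z' i) = β (z i)) :
    (∏ i, α' (w i)) * ∏ i, β (g i) = (∏ i, β' (g i)) * ∏ i, α (w i) := by
  classical
  rw [← hzα'.abs_det_mul_prod h hw', ← hzα.abs_det_mul_prod h hw, ← hzβ.abs_det_mul_prod h hg,
    ← hzβ'.abs_det_mul_prod h hg']
  simp only [hα, hβ]
  have key : abs (z'.det w) * abs (z.det g) = abs (z'.det g) * abs (z.det w) := by
    rw [← Module.Basis.det_mul_det z' g w, ← Module.Basis.det_mul_det z g w, h.mul, h.mul]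
    ring
  calc _ = (abs (z'.det w) * abs (z.det g)) * ((∏ i, α (z i)) * ∏ i, β (z i)) := by ring
    _ = _ := by rw [key]; ring

omit h in
theorem exists_mem_span_of_card [FiniteDimensional E X] {ι κ : Type*} [Fintype ι] [Fintype κ]
    {v : ι → X} {w : κ → X} (hv : LinearIndependent E v) (hw : LinearIndependent E w)
    (hcard : Module.finrank E X < Fintype.card ι + Fintype.card κ) :
    ∃ x ≠ 0, x ∈ Submodule.span E (Set.range v) ∧ x ∈ Submodule.span E (Set.range w) := by
  by_contra! hcon
  have hdis : Disjoint (Submodule.span E (Set.range v)) (Submodule.span E (Set.range w)) := by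
    rw [Submodule.disjoint_def]
    intro x hx hx'
    by_contra h0
    exact hcon x h0 hx hx'
  have := Submodule.finrank_add_finrank_le_of_disjoint hdis
  rw [finrank_span_eq_card hv, finrank_span_eq_card hw] at this
  omega

/-- The minimax principle for the relative position of two norms. -/
theorem Orth.ratio_le_of_card [FiniteDimensional E X] {ι κ : Type*} [Fintype ι] [Fintype κ]
    {α β : VNorm E abs X} {v : ι → X} {w : κ → X} (hv : α.Orth v) (hw : β.Orth w)
    (hv0 : ∀ i, v i ≠ 0) (hw0 : ∀ i, w i ≠ 0)
    (hcard : Module.finrank E X < Fintype.card ι + Fintype.card κ) {C C' : ℝ≥0}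
    (hC : ∀ i, C ≤ α (v i) / β (v i)) (hC' : ∀ i, α (w i) / β (w i) ≤ C') : C ≤ C' := by
  rcases eq_or_ne C 0 with rfl | hC0
  · exact zero_le
  obtain ⟨x, hx0, hxv, hxw⟩ := exists_mem_span_of_card (hv.linearIndependent h hv0)
    (hw.linearIndependent h hw0) hcard
  have h1 : β x ≤ C⁻¹ * α x := by
    refine hv.le_mul_of_mem_span (fun i => ?_) hxv
    rw [le_inv_mul_iff₀ (pos_iff_ne_zero.2 hC0)]
    exact (le_div_iff₀ (β.pos (hv0 i))).1 (hC i)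
  have h2 : α x ≤ C' * β x :=
    hw.le_mul_of_mem_span (fun i => (div_le_iff₀ (β.pos (hw0 i))).1 (hC' i)) hxw
  rw [le_inv_mul_iff₀ (pos_iff_ne_zero.2 hC0)] at h1
  exact le_of_mul_le_mul_right (h1.trans h2) (β.pos hx0)

/-- A common splitting basis, ordered by decreasing ratio. -/
theorem exists_sorted_orth [FiniteDimensional E X] {n : ℕ} (hn : Module.finrank E X = n)
    (α β : VNorm E abs X) : ∃ b : Module.Basis (Fin n) E X, α.Orth b ∧ β.Orth b ∧
      Antitone fun i => β (b i) / α (b i) := by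
  obtain ⟨b, hα, hβ⟩ := exists_isSplitBy₂ h α β
  rw [isSplitBy_iff_orth h] at hα hβ
  obtain ⟨e, he⟩ := exists_equiv_antitone (n := n) (by simp [hn]) fun i => β (b i) / α (b i)
  refine ⟨b.reindex e.symm, ?_, ?_, ?_⟩
  · rw [Module.Basis.coe_reindex]
    exact hα.comp _ e.injective
  · rw [Module.Basis.coe_reindex]
    exact hβ.comp _ e.injective
  · simpa [Function.comp_def] using he

/-- The ratios of two norms on a subspace are bounded by the largest ratios on the whole space. -/
theorem Orth.ratio_subspace_le [FiniteDimensional E X] {n m : ℕ} {α β : VNorm E abs X}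
    {f : Module.Basis (Fin n) E X} (hfα : α.Orth f)
    (hf : Antitone fun i => β (f i) / α (f i))
    {w : Fin m → X} (hwβ : β.Orth w) (hw0 : ∀ i, w i ≠ 0)
    (hw : Antitone fun i => β (w i) / α (w i)) (j : Fin m) (i : Fin n) (hij : i.val = j.val) :
    β (w j) / α (w j) ≤ β (f i) / α (f i) := by
  have h1 := hwβ.comp (fun l : {l // l ≤ j} => l.1) Subtype.val_injective
  have h2 := hfα.comp (fun l : {l // i ≤ l} => l.1) Subtype.val_injective
  refine h1.ratio_le_of_card h h2 (fun _ => hw0 _) (fun _ => f.ne_zero _) ?_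
    (fun l => hw l.2) (fun l => hf l.2)
  have e1 : Fintype.card {l // l ≤ j} = j.val + 1 := by
    rw [Fintype.card_subtype, ← Fin.card_Iic]
    congr 1; ext; simp
  have e2 : Fintype.card {l // i ≤ l} = n - i.val := by
    rw [Fintype.card_subtype, ← Fin.card_Ici]
    congr 1; ext; simp
  rw [e1, e2, Module.finrank_eq_card_basis f, Fintype.card_fin]
  have := i.2
  omega

/-- The ratios of two norms on a subspace of codimension `c` are bounded below by the ratios on the
whole space, shifted by `c`. -/
theorem Orth.le_ratio_subspace [FiniteDimensional E X] {n m : ℕ} {α β : VNorm E abs X}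
    {f : Module.Basis (Fin n) E X} (hfβ : β.Orth f)
    (hf : Antitone fun i => β (f i) / α (f i))
    {w : Fin m → X} (hwα : α.Orth w) (hw0 : ∀ i, w i ≠ 0)
    (hw : Antitone fun i => β (w i) / α (w i)) (j : Fin m) (i : Fin n)
    (hij : i.val + m = j.val + n) :
    β (f i) / α (f i) ≤ β (w j) / α (w j) := by
  have h1 := hfβ.comp (fun l : {l // l ≤ i} => l.1) Subtype.val_injective
  have h2 := hwα.comp (fun l : {l // j ≤ l} => l.1) Subtype.val_injective
  refine h1.ratio_le_of_card h h2 (fun _ => f.ne_zero _) (fun _ => hw0 _) ?_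
    (fun l => hf l.2) (fun l => hw l.2)
  have e1 : Fintype.card {l // l ≤ i} = i.val + 1 := by
    rw [Fintype.card_subtype, ← Fin.card_Iic]
    congr 1; ext; simp
  have e2 : Fintype.card {l // j ≤ l} = m - j.val := by
    rw [Fintype.card_subtype, ← Fin.card_Ici]
    congr 1; ext; simp
  rw [e1, e2, Module.finrank_eq_card_basis f, Fintype.card_fin]
  have := i.2
  have := j.2
  omega

end VNorm

/-! ### The field `L` is complete and discretely valued -/

section LField
variable {p : ℕ} [hp : Fact p.Prime] {k : Type*} [Field k] [CharP k p] [PerfectRing k p]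

theorem one_lt_p_nnreal : (1 : ℝ≥0) < p := by exact_mod_cast hp.out.one_lt

theorem p_ne_zero_L : (p : LField p k) ≠ 0 := by
  intro h0
  have h1 := absL_p p k
  rw [h0] at h1
  have h2 : absL p k 0 = 0 := by simp [absL]
  rw [h2] at h1
  have := one_lt_p_nnreal (p := p)
  exact inv_ne_zero (one_pos.trans this).ne' h1.symm

theorem absL_p_zpow (n : ℤ) : absL p k ((p : LField p k) ^ n) = (p : ℝ≥0) ^ (-n) := by
  have : absL p k ((p : LField p k) ^ n) = absL p k (p : LField p k) ^ n := by
    simp [absL]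
  rw [this, absL_p, inv_zpow, zpow_neg]

theorem exists_eq_zpow_mul_unit (x : LField p k) (hx : x ≠ 0) :
    ∃ (n : ℤ) (u : (WittVector p k)ˣ),
      x = (p : LField p k) ^ n * algebraMap _ _ (u : WittVector p k) := by
  obtain ⟨a, b, hb, rfl⟩ := IsFractionRing.div_surjective (A := WittVector p k) x
  have hb0 : b ≠ 0 := nonZeroDivisors.ne_zero hb
  have ha0 : a ≠ 0 := by rintro rfl; simp at hx
  obtain ⟨m, u, rfl⟩ := WittVector.exists_eq_pow_p_mul' a ha0
  obtain ⟨n, v, rfl⟩ := WittVector.exists_eq_pow_p_mul' b hb0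
  refine ⟨m - n, u * v⁻¹, ?_⟩
  have hp0 := p_ne_zero_L (p := p) (k := k)
  have hv : algebraMap (WittVector p k) (LField p k) (v : WittVector p k) *
      algebraMap (WittVector p k) (LField p k) ((v⁻¹ : (WittVector p k)ˣ) : WittVector p k) = 1 := by
    rw [← map_mul]; simp
  have hv0 : algebraMap (WittVector p k) (LField p k) (v : WittVector p k) ≠ 0 :=
    left_ne_zero_of_mul_eq_one hv
  rw [Units.val_mul, map_mul _ (u : WittVector p k), eq_inv_of_mul_eq_one_right hv, map_mul, map_mul,
    map_pow, map_pow, map_natCast, zpow_sub₀ hp0, zpow_natCast, zpow_natCast]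
  field_simp

theorem absL_zpow_mul_unit (n : ℤ) (u : (WittVector p k)ˣ) :
    absL p k ((p : LField p k) ^ n * algebraMap _ _ (u : WittVector p k)) = (p : ℝ≥0) ^ (-n) := by
  rw [absL_mul, absL_unit, mul_one, absL_p_zpow]

theorem absL_zero : absL p k 0 = 0 := by simp [absL]

theorem absL_add_le (x y : LField p k) : absL p k (x + y) ≤ max (absL p k x) (absL p k y) := by
  have hmono := (WithZeroMulInt.toNNReal_strictMono (one_lt_p_nnreal (p := p))).monotone
  have := hmono ((IsDiscreteValuationRing.maximalIdeal (WittVector p k)).valuation (LField p k) |>.map_add x y)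
  rwa [hmono.map_max] at this

theorem absL_le_one_iff {x : LField p k} :
    absL p k x ≤ 1 ↔ ∃ w : WittVector p k, algebraMap _ _ w = x := by
  constructor
  · intro hx
    rcases eq_or_ne x 0 with rfl | hx0
    · exact ⟨0, map_zero _⟩
    obtain ⟨n, u, rfl⟩ := exists_eq_zpow_mul_unit x hx0
    rw [absL_zpow_mul_unit, zpow_le_one_iff_right₀ one_lt_p_nnreal] at hx
    obtain ⟨m, rfl⟩ := Int.eq_ofNat_of_zero_le (by omega : 0 ≤ n)
    exact ⟨p ^ m * u, by simp⟩
  · rintro ⟨w, rfl⟩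
    rcases eq_or_ne w 0 with rfl | hw
    · simp [absL_zero]
    obtain ⟨m, u, rfl⟩ := WittVector.exists_eq_pow_p_mul' w hw
    have := absL_zpow_mul_unit (k := k) (m : ℤ) u
    rw [zpow_natCast] at this
    rw [map_mul, map_pow, map_natCast, this]
    exact zpow_le_one_of_nonpos₀ one_lt_p_nnreal.le (by omega)

theorem absL_algebraMap_le_iff {w : WittVector p k} {m : ℕ} :
    absL p k (algebraMap _ _ w) ≤ (p : ℝ≥0) ^ (-(m : ℤ)) ↔ (p : WittVector p k) ^ m ∣ w := by
  have hp0 := p_ne_zero_L (p := p) (k := k)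
  have hpp : (0 : ℝ≥0) < (p : ℝ≥0) ^ m := pow_pos (one_pos.trans one_lt_p_nnreal) _
  have h1 : absL p k (algebraMap _ _ w) ≤ (p : ℝ≥0) ^ (-(m : ℤ)) ↔
      absL p k ((p : LField p k) ^ (-(m : ℤ)) * algebraMap _ _ w) ≤ 1 := by
    rw [absL_mul, absL_p_zpow, neg_neg, zpow_neg, zpow_natCast, ← le_inv_mul_iff₀ hpp, mul_one]
  rw [h1, absL_le_one_iff]
  constructor
  · rintro ⟨v, hv⟩
    refine ⟨v, IsFractionRing.injective (WittVector p k) (LField p k) ?_⟩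
    rw [map_mul, hv, map_pow, map_natCast, zpow_neg, zpow_natCast,
      mul_inv_cancel_left₀ (pow_ne_zero _ hp0)]
  · rintro ⟨v, rfl⟩
    exact ⟨v, by rw [map_mul, map_pow, map_natCast, zpow_neg, zpow_natCast,
      inv_mul_cancel_left₀ (pow_ne_zero _ hp0)]⟩

theorem isCompleteDiscrete_absL : IsCompleteDiscrete (p : ℝ≥0) (absL p k) where
  one_lt := one_lt_p_nnreal
  zero := absL_zero
  one := absL_one p k
  mul := absL_mul p k
  add_le := absL_add_le
  exists_zpow x hx := by
    obtain ⟨n, u, rfl⟩ := exists_eq_zpow_mul_unit x hx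
    exact ⟨-n, absL_zpow_mul_unit n u⟩
  complete a ha := by
    have hqpos : (0 : ℝ≥0) < p := one_pos.trans one_lt_p_nnreal
    have habs_sub : ∀ x y, absL p k (x - y) ≤ max (absL p k x) (absL p k y) := by
      intro x y
      have h1 : absL p k (-y) = absL p k y := by simp [absL, Valuation.map_neg]
      rw [sub_eq_add_neg, ← h1]
      exact absL_add_le _ _
    have hN : ∀ m : ℕ, ∃ N, ∀ n ≥ N, absL p k (a (n + 1) - a n) ≤ (p : ℝ≥0) ^ (-(m : ℤ)) := by
      intro m
      have := (tendsto_order.1 ha).2 ((p : ℝ≥0) ^ (-(m : ℤ))) (zpow_pos hqpos _)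
      obtain ⟨N, hN⟩ := Filter.eventually_atTop.1 this
      exact ⟨N, fun n hn => (hN n hn).le⟩
    choose N₀ hN₀ using hN
    let N : ℕ → ℕ := fun m => ∑ i ∈ Finset.range (m + 1), N₀ i
    have hNmono : Monotone N := fun i j hij =>
      Finset.sum_le_sum_of_subset (Finset.range_mono (by omega))
    have hN₀N : ∀ m, N₀ m ≤ N m := fun m =>
      Finset.single_le_sum (fun _ _ => Nat.zero_le _) (Finset.self_mem_range_succ m)
    have hstep : ∀ m n n' : ℕ, N m ≤ n → n ≤ n' →
        absL p k (a n' - a n) ≤ (p : ℝ≥0) ^ (-(m : ℤ)) := by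
      intro m n n' hn hnn'
      induction n', hnn' using Nat.le_induction with
      | base => simp [absL_zero]
      | succ n' hn' ih =>
        have : a (n' + 1) - a n = (a (n' + 1) - a n') + (a n' - a n) := by ring
        rw [this]
        exact (absL_add_le _ _).trans
          (max_le (hN₀ m n' ((hN₀N m).trans (hn.trans hn'))) ih)
    have hw : ∀ m, ∃ w : WittVector p k, algebraMap _ _ w = a (N m) - a (N 0) := by
      intro m
      rw [← absL_le_one_iff]
      simpa using hstep 0 (N 0) (N m) le_rfl (hNmono (Nat.zero_le m))
    choose w hw using hw
    have hcauchy : ∀ {m n : ℕ}, m ≤ n → w m ≡ w n [SMOD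
        ((Ideal.span {(p : WittVector p k)}) ^ m • ⊤ : Submodule (WittVector p k) (WittVector p k))] := by
      intro m n hmn
      rw [SModEq.comm, SModEq.sub_mem, smul_eq_mul, Ideal.mul_top, Ideal.span_singleton_pow,
        Ideal.mem_span_singleton, ← absL_algebraMap_le_iff, map_sub, hw, hw, sub_sub_sub_cancel_right]
      exact hstep m (N m) (N n) le_rfl (hNmono hmn)
    obtain ⟨l, hl⟩ := IsPrecomplete.prec (I := Ideal.span {(p : WittVector p k)}) inferInstance hcauchy
    refine ⟨algebraMap _ _ l + a (N 0), ?_⟩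
    rw [tendsto_order]
    refine ⟨fun c hc => absurd hc not_lt_zero, fun c hc => ?_⟩
    obtain ⟨m, hm⟩ : ∃ m : ℕ, (p : ℝ≥0) ^ (-(m : ℤ)) < c := by
      obtain ⟨m, hm⟩ := exists_pow_lt_of_lt_one hc (inv_lt_one_of_one_lt₀ (one_lt_p_nnreal (p := p)))
      exact ⟨m, by rwa [zpow_neg, zpow_natCast, ← inv_pow]⟩
    refine Filter.eventually_atTop.2 ⟨N m, fun n hn => lt_of_le_of_lt ?_ hm⟩
    have h1 := hl m
    rw [SModEq.sub_mem, smul_eq_mul, Ideal.mul_top, Ideal.span_singleton_pow,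
      Ideal.mem_span_singleton, ← absL_algebraMap_le_iff, map_sub, hw] at h1
    have : a n - (algebraMap _ _ l + a (N 0)) =
        (a n - a (N m)) + (a (N m) - a (N 0) - algebraMap _ _ l) := by ring
    rw [this]
    exact (absL_add_le _ _).trans (max_le (hstep m (N m) n le_rfl hn) h1)

theorem absL_iterate_sigma (n : ℕ) (x : LField p k) :
    absL p k ((sigmaHom p k)^[n] x) = absL p k x := by
  induction n with
  | zero => rfl
  | succ n ih => rw [Function.iterate_succ_apply', absL_sigmaHom, ih]

theorem iterate_sigma_algebraMap (n : ℕ) (w : WittVector p k) :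
    (sigmaHom p k)^[n] (algebraMap _ _ w) =
      algebraMap _ _ ((WittVector.frobenius (p := p) (R := k))^[n] w) := by
  induction n with
  | zero => rfl
  | succ n ih =>
    rw [Function.iterate_succ_apply', ih, Function.iterate_succ_apply']
    exact sigma_algebraMap p k _

theorem iterate_sigma_p_zpow (n : ℕ) (d : ℤ) :
    (sigmaHom p k)^[n] ((p : LField p k) ^ d) = (p : LField p k) ^ d := by
  induction n with
  | zero => rfl
  | succ n ih => rw [Function.iterate_succ_apply', ih, sigma_zpow]

/-- The field `K(r)` inherits from `L` that it is complete and discretely valued. -/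
theorem isCompleteDiscrete_absK (r : ℚ) : IsCompleteDiscrete (p : ℝ≥0) (absK p k r) where
  one_lt := one_lt_p_nnreal
  zero := absL_zero
  one := absL_one p k
  mul _ _ := absL_mul p k _ _
  add_le _ _ := absL_add_le _ _
  exists_zpow x hx := isCompleteDiscrete_absL.exists_zpow x.1 (by simpa using hx)
  complete a ha := by
    obtain ⟨l, hl⟩ := isCompleteDiscrete_absL.complete (fun n => (a n : LField p k)) ha
    have hfix : (sigmaHom p k)^[r.den] l = l := by
      have hL := isCompleteDiscrete_absL (p := p) (k := k)
      rw [← sub_eq_zero, ← hL.eq_zero, ← nonpos_iff_eq_zero]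
      refine ge_of_tendsto' hl fun n => ?_
      have h1 : (sigmaHom p k)^[r.den] l - l =
          (a n - l) - (sigmaHom p k)^[r.den] (a n - l) := by
        rw [iterate_map_sub, (mem_fixedField r _).1 (a n).2]
        ring
      rw [h1]
      refine (hL.sub_le _ _).trans (max_le le_rfl ?_)
      rw [absL_iterate_sigma]
    exact ⟨⟨l, (mem_fixedField r l).2 hfix⟩, hl⟩

end LField

/-! ### Frobenius-linear equations over an algebraically closed field -/

/-- The first term of a sequence that depends linearly on its predecessors. -/
theorem exists_linearIndependent_relation {K V : Type*} [Field K] [AddCommGroup V] [Module K V]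
    [FiniteDimensional K V] (x : ℕ → V) : ∃ (m : ℕ) (a : ℕ → K),
      LinearIndependent K (fun i : Fin m => x i) ∧ x m = ∑ i ∈ Finset.range m, a i • x i := by
  classical
  have hex : ∃ m, ¬ LinearIndependent K (fun i : Fin (m + 1) => x i) := by
    refine ⟨Module.finrank K V, fun hli => ?_⟩
    have := hli.fintype_card_le_finrank
    simp at this
  have hmin : ∀ m < Nat.find hex, ¬¬ LinearIndependent K (fun i : Fin (m + 1) => x i) :=
    fun m hm => Nat.find_min hex hm
  have hspec := Nat.find_spec hex
  have hli : LinearIndependent K (fun i : Fin (Nat.find hex) => x i) := by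
    rcases Nat.eq_zero_or_pos (Nat.find hex) with h0 | h0
    · rw [h0]
      exact linearIndependent_empty_type
    · have := hmin (Nat.find hex - 1) (by omega)
      rw [not_not] at this
      rwa [Nat.sub_add_cancel h0] at this
  rw [linearIndependent_finSucc'] at hspec
  have hmem : x (Nat.find hex) ∈ Submodule.span K (Set.range fun i : Fin (Nat.find hex) => x i) := by
    by_contra hn
    exact hspec ⟨hli, hn⟩
  obtain ⟨c, hc⟩ := (Submodule.mem_span_range_iff_exists_fun K).1 hmem
  refine ⟨Nat.find hex, fun i => if hi : i < Nat.find hex then c ⟨i, hi⟩ else 0, hli, ?_⟩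
  rw [← hc, Finset.sum_range]
  exact Finset.sum_congr rfl fun i _ => by simp only [dif_pos i.2]

section Lang
open Polynomial
variable {p : ℕ} [hp : Fact p.Prime] {k : Type*} [Field k] [CharP k p] [IsAlgClosed k]

/-- The polynomials in `t` expressing the coefficients `cᵢ` of `w = ∑ cᵢ φ^i x` such that
`φ w - w = ε x` through the last one of them. -/
noncomputable def langPoly (q : ℕ) (a : ℕ → k) (ε : k) : ℕ → k[X]
  | 0 => C (a 0) * X ^ q - C ε
  | i + 1 => langPoly q a ε i ^ q + C (a (i + 1)) * X ^ q

theorem derivative_langPoly {q : ℕ} (hq : (q : k) = 0) (a : ℕ → k) (ε : k) (i : ℕ) :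
    derivative (langPoly q a ε i) = 0 := by
  cases i <;> simp [langPoly, derivative_pow, hq]

theorem X_pow_dvd_langPoly {q : ℕ} (hq : 2 ≤ q) (a : ℕ → k) (i : ℕ) :
    X ^ q ∣ langPoly q a 0 i := by
  induction i with
  | zero => simp [langPoly]
  | succ i ih =>
    rw [langPoly]
    exact dvd_add (dvd_pow ih (by omega)) (dvd_mul_left _ _)

/-- The coefficient of `X ^ q` recovers the last of the `aⱼ`, the other summand being divisible by a
higher power of `X`. -/
theorem coeff_eq_zero_of_langPoly_eq_zero {q : ℕ} (hq : 2 ≤ q) (a : ℕ → k) (i : ℕ)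
    (h0 : langPoly q a 0 i = 0) : ∀ j ≤ i, a j = 0 := by
  induction i with
  | zero =>
    intro j hj
    obtain rfl : j = 0 := by omega
    simpa [langPoly] using h0
  | succ i ih =>
    have hcoeff : (langPoly q a 0 i ^ q).coeff q = 0 := by
      obtain ⟨g, hg⟩ := X_pow_dvd_langPoly hq a i
      rw [hg, mul_pow, ← pow_mul, coeff_X_pow_mul', if_neg]
      nlinarith
    have ha : a (i + 1) = 0 := by
      have := congrArg (fun f => coeff f q) h0
      simpa [langPoly, hcoeff] using this
    have hprev : langPoly q a 0 i = 0 := by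
      rw [langPoly, ha] at h0
      simpa [show q ≠ 0 by omega] using h0
    intro j hj
    rcases Nat.lt_or_ge i j with h1 | h1
    · obtain rfl : j = i + 1 := by omega
      exact ha
    · exact ih hprev j h1

/-- The equation for the last coefficient is solvable: its derivative is constant and not zero, as
`q = 0` in `k`, so it is not a constant polynomial. -/
theorem exists_root_langPoly {q : ℕ} (hq : (q : k) = 0) (a : ℕ → k) (ε : k) (i : ℕ) :
    ∃ t, (langPoly q a ε i).eval t = t := by
  have hd : derivative (langPoly q a ε i - X) = -1 := by
    rw [derivative_sub, derivative_langPoly hq, derivative_X, zero_sub]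
  obtain ⟨t, ht⟩ := IsAlgClosed.exists_root (langPoly q a ε i - X) (fun hdeg => by
    rw [eq_C_of_degree_eq_zero hdeg, derivative_C] at hd
    exact neg_ne_zero.2 one_ne_zero hd.symm)
  exact ⟨t, by simpa [sub_eq_zero] using ht⟩

/-- The equation for the last coefficient of a fixed vector has the form `t ^ q * g(t) = t` with
`g ≠ 0`, so it has a nonzero solution. -/
theorem exists_ne_zero_root_langPoly {q : ℕ} (hq2 : 2 ≤ q) (a : ℕ → k) (i : ℕ)
    (ha : ∃ j ≤ i, a j ≠ 0) : ∃ t, t ≠ 0 ∧ (langPoly q a 0 i).eval t = t := by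
  obtain ⟨g, hg⟩ := X_pow_dvd_langPoly hq2 a i
  obtain ⟨r, rfl⟩ : ∃ r, q = r + 2 := ⟨q - 2, by omega⟩
  have hg0 : g ≠ 0 := by
    rintro rfl
    obtain ⟨j, hj, hj0⟩ := ha
    exact hj0 (coeff_eq_zero_of_langPoly_eq_zero hq2 a i (by rw [hg, mul_zero]) j hj)
  have hdeg : (X ^ (r + 1) * g - 1).degree ≠ 0 := by
    have h1 : (1 : k[X]).degree < (X ^ (r + 1) * g).degree := by
      rw [degree_one, degree_mul, degree_X_pow, degree_eq_natDegree hg0]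
      exact_mod_cast (by omega : 0 < r + 1 + g.natDegree)
    rw [degree_sub_eq_left_of_degree_lt h1]
    rw [degree_one] at h1
    exact h1.ne'
  obtain ⟨t, ht⟩ := IsAlgClosed.exists_root _ hdeg
  have ht' : t ^ (r + 1) * g.eval t = 1 := by simpa [sub_eq_zero] using ht
  refine ⟨t, ?_, ?_⟩
  · rintro rfl
    simp at ht'
  · rw [hg, eval_mul, eval_pow, eval_X]
    calc t ^ (r + 2) * g.eval t = t * (t ^ (r + 1) * g.eval t) := by ring
      _ = t := by rw [ht', mul_one]

variable {V : Type*} [AddCommGroup V] [Module k V] {q : ℕ} (φ : V →+ V)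

/-- A solution `t` of the equation for the last coefficient gives a solution `w` of `φ w - w = ε
x`. -/
theorem langPoly_solution (hφ : ∀ (a : k) (v : V), φ (a • v) = a ^ q • φ v) (a : ℕ → k) (ε t : k)
    (x : V) (m : ℕ) (ht : (langPoly q a ε m).eval t = t)
    (hx : φ^[m + 1] x = ∑ i ∈ Finset.range (m + 1), a i • φ^[i] x) :
    φ (∑ i ∈ Finset.range (m + 1), (langPoly q a ε i).eval t • φ^[i] x) -
      ∑ i ∈ Finset.range (m + 1), (langPoly q a ε i).eval t • φ^[i] x = ε • x := by
  have h1 : φ (∑ i ∈ Finset.range (m + 1), (langPoly q a ε i).eval t • φ^[i] x) =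
      (∑ i ∈ Finset.range m, (langPoly q a ε i).eval t ^ q • φ^[i + 1] x) +
        t ^ q • ∑ i ∈ Finset.range (m + 1), a i • φ^[i] x := by
    rw [map_sum, Finset.sum_range_succ, ht, hφ t, ← Function.iterate_succ_apply' φ, hx]
    congr 1
    exact Finset.sum_congr rfl fun i _ => by rw [hφ, ← Function.iterate_succ_apply' φ]
  rw [h1, Finset.sum_range_succ' (fun i => a i • φ^[i] x), Finset.sum_range_succ'
    (fun i => (langPoly q a ε i).eval t • φ^[i] x)]
  simp only [langPoly, eval_add, eval_sub, eval_mul, eval_pow, eval_X, eval_C, add_smul, sub_smul,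
    Finset.sum_add_distrib, smul_add, Finset.smul_sum, smul_smul, mul_comm (t ^ q),
    Function.iterate_zero, id_eq]
  abel

variable [FiniteDimensional k V]

/-- For a Frobenius-linear map `φ`, the map `φ - 1` is surjective. -/
theorem frobeniusLinear_sub_surjective (hq : (q : k) = 0)
    (hφ : ∀ (a : k) (v : V), φ (a • v) = a ^ q • φ v) (x : V) : ∃ w, φ w - w = x := by
  obtain ⟨m, a, -, hx⟩ := exists_linearIndependent_relation (K := k) fun i => φ^[i] x
  cases m with
  | zero =>
    refine ⟨0, ?_⟩
    simp only [Function.iterate_zero, id_eq, Finset.range_zero, Finset.sum_empty] at hx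
    simp [hx]
  | succ m =>
    obtain ⟨t, ht⟩ := exists_root_langPoly hq a 1 m
    exact ⟨_, by rw [langPoly_solution φ hφ a 1 t x m ht hx, one_smul]⟩

/-- A Frobenius-linear map that is not locally nilpotent has a nonzero fixed vector. -/
theorem frobeniusLinear_exists_fixed (hq : 2 ≤ q)
    (hφ : ∀ (a : k) (v : V), φ (a • v) = a ^ q • φ v) (x : V) (hx0 : ∀ n, φ^[n] x ≠ 0) :
    ∃ w, w ≠ 0 ∧ φ w = w := by
  obtain ⟨m, a, hli, hx⟩ := exists_linearIndependent_relation (K := k) fun i => φ^[i] x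
  have ha : ∃ j < m, a j ≠ 0 := by
    by_contra! hcon
    exact hx0 m (hx.trans (Finset.sum_eq_zero fun i hi => by
      rw [hcon i (Finset.mem_range.1 hi), zero_smul]))
  cases m with
  | zero => obtain ⟨j, hj, -⟩ := ha; omega
  | succ m =>
    obtain ⟨j, hj, hj0⟩ := ha
    obtain ⟨t, ht0, ht⟩ := exists_ne_zero_root_langPoly hq a m ⟨j, by omega, hj0⟩
    refine ⟨_, fun hw => ?_, sub_eq_zero.1 ((langPoly_solution φ hφ a 0 t x m ht hx).trans
      (zero_smul _ _))⟩
    rw [Finset.sum_range] at hw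
    have := Fintype.linearIndependent_iff.1 hli (fun i => (langPoly q a 0 i).eval t) hw
      (Fin.last m)
    simp only [Fin.val_last, ht] at this
    exact ht0 this

end Lang

/-! ### Frobenius-linear equations over the Witt vectors and over `L` -/

section Witt
variable {p : ℕ} [hp : Fact p.Prime] {k : Type*} [Field k] [CharP k p] [PerfectRing k p]

/-- An additive endomorphism of `W(k)^n` that is surjective modulo `p` is surjective, by successive
approximation. -/
theorem surjective_of_surjective_mod_p {n : ℕ}
    (T : (Fin n → WittVector p k) →+ (Fin n → WittVector p k))
    (hT : ∀ c, ∃ v w, c - T v = (p : WittVector p k) • w) : Function.Surjective T := by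
  intro c
  choose v w hvw using hT
  have hTp : ∀ (m : ℕ) u, T ((p : WittVector p k) ^ m • u) = (p : WittVector p k) ^ m • T u := by
    intro m u
    have h1 : ∀ u : Fin n → WittVector p k, (p : WittVector p k) ^ m • u = (p ^ m : ℕ) • u := by
      intro u
      rw [← Nat.cast_smul_eq_nsmul (WittVector p k) (p ^ m) u, Nat.cast_pow]
    rw [h1, h1, map_nsmul]
  -- `c' i` is the error after `i` steps, divided by `p ^ i`, and `V i` is the approximate solution
  let c' : ℕ → (Fin n → WittVector p k) := fun i => w^[i] c
  have hc' : ∀ i, c' i - T (v (c' i)) = (p : WittVector p k) • c' (i + 1) := by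
    intro i
    have : c' (i + 1) = w (c' i) := Function.iterate_succ_apply' w i c
    rw [this, hvw]
  let V : ℕ → (Fin n → WittVector p k) := fun i =>
    ∑ j ∈ Finset.range i, (p : WittVector p k) ^ j • v (c' j)
  have hV : ∀ i, c - T (V i) = (p : WittVector p k) ^ i • c' i := by
    intro i
    induction i with
    | zero => simp [V, c']
    | succ i ih =>
      have : V (i + 1) = V i + (p : WittVector p k) ^ i • v (c' i) := Finset.sum_range_succ _ _
      rw [this, map_add, ← sub_sub, ih, hTp, ← smul_sub, hc', smul_smul, ← pow_succ]
  have hlim : ∀ l : Fin n, ∃ x : WittVector p k, ∀ i, (p : WittVector p k) ^ i ∣ V i l - x := by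
    intro l
    have hcauchy : ∀ {i j : ℕ}, i ≤ j → V i l ≡ V j l [SMOD
        ((Ideal.span {(p : WittVector p k)}) ^ i • ⊤ :
          Submodule (WittVector p k) (WittVector p k))] := by
      intro i j hij
      rw [SModEq.comm, SModEq.sub_mem, smul_eq_mul, Ideal.mul_top, Ideal.span_singleton_pow,
        Ideal.mem_span_singleton]
      induction j, hij using Nat.le_induction with
      | base => simp
      | succ j hj ih =>
        have : V (j + 1) l - V i l = (V j l - V i l) + (p : WittVector p k) ^ j * v (c' j) l := by
          have : V (j + 1) = V j + (p : WittVector p k) ^ j • v (c' j) := Finset.sum_range_succ _ _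
          rw [this, Pi.add_apply, Pi.smul_apply, smul_eq_mul]
          ring
        rw [this]
        exact dvd_add ih (Dvd.dvd.mul_right (pow_dvd_pow _ hj) _)
    obtain ⟨x, hx⟩ := IsPrecomplete.prec (I := Ideal.span {(p : WittVector p k)}) inferInstance
      hcauchy
    refine ⟨x, fun i => ?_⟩
    have := hx i
    rwa [SModEq.sub_mem, smul_eq_mul, Ideal.mul_top, Ideal.span_singleton_pow,
      Ideal.mem_span_singleton] at this
  choose x hx using hlim
  refine ⟨x, ?_⟩
  have hdvd : ∀ i l, (p : WittVector p k) ^ i ∣ (T x - c) l := by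
    intro i l
    choose y hy using fun l => hx l i
    have h1 : V i = x + (p : WittVector p k) ^ i • y := by
      funext l
      rw [Pi.add_apply, Pi.smul_apply, smul_eq_mul, ← hy l]
      ring
    have h2 := hV i
    rw [h1, map_add, hTp] at h2
    have h3 : T x - c = (p : WittVector p k) ^ i • (-(c' i) - T y) := by
      rw [smul_sub, smul_neg, ← h2]
      abel
    rw [h3]
    exact ⟨_, rfl⟩
  funext l
  have h0 : (T x - c) l = 0 := by
    by_contra h0
    obtain ⟨m, u, hu⟩ := WittVector.exists_eq_pow_p_mul' _ h0
    have h1 := hdvd (m + 1) l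
    rw [hu, pow_succ] at h1
    have h2 : (p : WittVector p k) ∣ u :=
      (mul_dvd_mul_iff_left (pow_ne_zero m (WittVector.irreducible p).ne_zero)).1 h1
    exact (WittVector.irreducible p).not_isUnit (isUnit_of_dvd_unit h2 u.isUnit)
  exact sub_eq_zero.1 h0

theorem p_dvd_iff_coeff_zero {w : WittVector p k} : (p : WittVector p k) ∣ w ↔ w.coeff 0 = 0 := by
  rw [← Ideal.mem_span_singleton, WittVector.mem_span_p_iff_coeff_zero_eq_zero]

/-- The operator `v ↦ A σ^H(v)` on `W(k)^n`. -/
noncomputable def matFrob {n : ℕ} (A : Matrix (Fin n) (Fin n) (WittVector p k)) (H : ℕ) :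
    (Fin n → WittVector p k) →+ (Fin n → WittVector p k) where
  toFun v := A.mulVec fun i => (WittVector.frobenius)^[H] (v i)
  map_zero' := by
    funext i
    simp [Matrix.mulVec, dotProduct]
  map_add' v w := by
    rw [← Matrix.mulVec_add]
    congr 1
    funext i
    exact iterate_map_add _ _ _ _

/-- The reduction of `matFrob A H` modulo `p`. -/
noncomputable def matFrobRes {n : ℕ} (A : Matrix (Fin n) (Fin n) k) (p : ℕ) [ExpChar k p] (H : ℕ) :
    (Fin n → k) →+ (Fin n → k) where
  toFun v := A.mulVec fun i => v i ^ p ^ H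
  map_zero' := by
    funext i
    simp [Matrix.mulVec, dotProduct, (expChar_pos k p).ne']
  map_add' v w := by
    rw [← Matrix.mulVec_add]
    congr 1
    funext i
    exact add_pow_expChar_pow _ _ _ _

theorem matFrobRes_smul {n : ℕ} (A : Matrix (Fin n) (Fin n) k) (H : ℕ) (a : k) (v : Fin n → k) :
    matFrobRes A p H (a • v) = a ^ p ^ H • matFrobRes A p H v := by
  change A.mulVec _ = _ • A.mulVec _
  rw [← Matrix.mulVec_smul]
  congr 1
  funext i
  exact mul_pow _ _ _

/-- Reduction modulo `p` of a vector with Witt vector entries. -/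
noncomputable def resVec {n : ℕ} : (Fin n → WittVector p k) →+ (Fin n → k) where
  toFun v i := WittVector.constantCoeff (v i)
  map_zero' := by funext i; simp
  map_add' v w := funext fun i => map_add WittVector.constantCoeff (v i) (w i)

theorem resVec_surjective {n : ℕ} : Function.Surjective (resVec (p := p) (k := k) (n := n)) :=
  fun v => ⟨fun i => WittVector.teichmuller p (v i),
    funext fun i => WittVector.teichmuller_coeff_zero p (v i)⟩

theorem resVec_eq_zero {n : ℕ} {v : Fin n → WittVector p k} (hv : resVec v = 0) :
    ∃ w, v = (p : WittVector p k) • w := by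
  have : ∀ i, (p : WittVector p k) ∣ v i := fun i => p_dvd_iff_coeff_zero.2 (congrFun hv i)
  choose w hw using this
  exact ⟨w, funext hw⟩

theorem resVec_p_smul {n : ℕ} (w : Fin n → WittVector p k) :
    resVec ((p : WittVector p k) • w) = 0 :=
  funext fun i => p_dvd_iff_coeff_zero.1 ⟨w i, rfl⟩

theorem resVec_matFrob {n : ℕ} (A : Matrix (Fin n) (Fin n) (WittVector p k)) (H : ℕ)
    (v : Fin n → WittVector p k) :
    resVec (matFrob A H v) = matFrobRes (A.map WittVector.constantCoeff) p H (resVec v) := by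
  funext i
  change WittVector.constantCoeff (∑ j, A i j * (WittVector.frobenius)^[H] (v j)) =
    ∑ j, WittVector.constantCoeff (A i j) * WittVector.constantCoeff (v j) ^ p ^ H
  rw [map_sum]
  refine Finset.sum_congr rfl fun j _ => ?_
  rw [map_mul]
  congr 1
  exact WittVector.iterate_frobenius_coeff _ _ _

end Witt

section WittClosed
variable {p : ℕ} [hp : Fact p.Prime] {k : Type*} [Field k] [CharP k p] [IsAlgClosed k]

/-- `v ↦ A σ^H(v) - v` is surjective on `W(k)^n`, because it is so modulo `p`. -/
theorem matFrob_sub_surjective {n : ℕ} (A : Matrix (Fin n) (Fin n) (WittVector p k)) {H : ℕ}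
    (hH : 0 < H) (c : Fin n → WittVector p k) : ∃ v, matFrob A H v - v = c := by
  refine surjective_of_surjective_mod_p (matFrob A H - AddMonoidHom.id (Fin n → WittVector p k))
    (fun c => ?_) c
  obtain ⟨v, hv⟩ := frobeniusLinear_sub_surjective (q := p ^ H)
    (matFrobRes (A.map WittVector.constantCoeff) p H) (by simp [hH.ne']) (matFrobRes_smul _ _)
    (resVec c)
  obtain ⟨v, rfl⟩ := resVec_surjective v
  obtain ⟨w, hw⟩ := resVec_eq_zero (v := c - (matFrob A H - AddMonoidHom.id (Fin n → WittVector p k)) v) (by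
    rw [map_sub, AddMonoidHom.sub_apply, map_sub, resVec_matFrob, AddMonoidHom.id_apply, hv,
      sub_self])
  exact ⟨v, w, hw⟩

/-- If `v ↦ A σ^H(v)` is not locally nilpotent modulo `p`, it has a nonzero fixed vector: lift
a fixed vector modulo `p` and correct it. -/
theorem matFrob_exists_fixed {n : ℕ} (A : Matrix (Fin n) (Fin n) (WittVector p k)) {H : ℕ}
    (hH : 0 < H) (x : Fin n → WittVector p k)
    (hx : ∀ j, resVec ((matFrob A H)^[j] x) ≠ 0) : ∃ w, w ≠ 0 ∧ matFrob A H w = w := by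
  have hiter : ∀ j, (matFrobRes (A.map WittVector.constantCoeff) p H)^[j] (resVec x) =
      resVec ((matFrob A H)^[j] x) := by
    intro j
    induction j with
    | zero => rfl
    | succ j ih => rw [Function.iterate_succ_apply', Function.iterate_succ_apply', ih,
        resVec_matFrob]
  obtain ⟨w, hw0, hw⟩ := frobeniusLinear_exists_fixed (q := p ^ H)
    (matFrobRes (A.map WittVector.constantCoeff) p H)
    (hp.out.two_le.trans (Nat.le_self_pow hH.ne' p)) (matFrobRes_smul _ _) (resVec x)
    (fun j => by rw [hiter]; exact hx j)
  obtain ⟨w, rfl⟩ := resVec_surjective w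
  obtain ⟨y, hy⟩ := resVec_eq_zero (v := matFrob A H w - w) (by
    rw [map_sub, resVec_matFrob, hw, sub_self])
  obtain ⟨z, hz⟩ := matFrob_sub_surjective A hH (-y)
  have hp1 : ∀ u : Fin n → WittVector p k, (p : WittVector p k) • u = p • u :=
    fun u => Nat.cast_smul_eq_nsmul _ _ _
  refine ⟨w + (p : WittVector p k) • z, fun h0 => hw0 ?_, ?_⟩
  · have := congrArg resVec h0
    rwa [map_add, resVec_p_smul, add_zero, map_zero] at this
  · rw [map_add, hp1, map_nsmul, ← sub_eq_zero]
    have : matFrob A H w + p • matFrob A H z - (w + p • z) =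
        (matFrob A H w - w) + p • (matFrob A H z - z) := by
      rw [smul_sub]; abel
    rw [this, hy, hz, hp1, smul_neg, add_neg_cancel]

/-- The equation `σ^H(c) - c = b` has a solution with `|c| ≤ |b|`. -/
theorem exists_sigma_sub_eq {H : ℕ} (hH : 0 < H) (b : LField p k) :
    ∃ c, (sigmaHom p k)^[H] c - c = b ∧ absL p k c ≤ absL p k b := by
  rcases eq_or_ne b 0 with rfl | hb
  · exact ⟨0, by rw [iterate_map_zero, sub_zero], le_rfl⟩
  obtain ⟨n, u, rfl⟩ := exists_eq_zpow_mul_unit b hb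
  obtain ⟨v, hv⟩ := matFrob_sub_surjective (n := 1) (1 : Matrix _ _ (WittVector p k)) hH
    (fun _ => (u : WittVector p k))
  have hv0 : (WittVector.frobenius)^[H] (v 0) - v 0 = u := by
    have := congrFun hv 0
    simpa [matFrob, Matrix.one_mulVec] using this
  refine ⟨(p : LField p k) ^ n * algebraMap _ _ (v 0), ?_, ?_⟩
  · rw [iterate_map_mul, iterate_sigma_p_zpow, iterate_sigma_algebraMap, ← mul_sub, ← map_sub, hv0]
  · rw [absL_mul, absL_mul, absL_unit]
    gcongr
    exact absL_le_one_iff.2 ⟨_, rfl⟩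

/-- Elements of `L` are approximated by elements fixed by `σ^H`. -/
theorem exists_fixed_approx {H : ℕ} (hH : 0 < H) (a : LField p k) :
    ∃ c, (sigmaHom p k)^[H] c = c ∧ absL p k (a - c) ≤ absL p k ((sigmaHom p k)^[H] a - a) := by
  obtain ⟨t, ht, hle⟩ := exists_sigma_sub_eq hH ((sigmaHom p k)^[H] a - a)
  refine ⟨a - t, ?_, by rwa [sub_sub_cancel]⟩
  rw [iterate_map_sub, sub_eq_sub_iff_sub_eq_sub]
  exact ht.symm

/-- The equation `p^e σ^H(c) - c = b` is solvable in `L`. -/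
theorem exists_zpow_mul_sigma_sub_eq {H : ℕ} (hH : 0 < H) (e : ℤ) (b : LField p k) :
    ∃ c, (p : LField p k) ^ e * (sigmaHom p k)^[H] c - c = b := by
  have hp0 := p_ne_zero_L (p := p) (k := k)
  rcases eq_or_ne b 0 with rfl | hb
  · exact ⟨0, by rw [iterate_map_zero, mul_zero, sub_zero]⟩
  rcases le_or_gt 0 e with he | he
  · obtain ⟨e, rfl⟩ := Int.eq_ofNat_of_zero_le he
    obtain ⟨n, u, rfl⟩ := exists_eq_zpow_mul_unit b hb
    obtain ⟨v, hv⟩ := matFrob_sub_surjective (n := 1)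
      (Matrix.of fun _ _ => (p : WittVector p k) ^ e) hH (fun _ => (u : WittVector p k))
    have hv0 : (p : WittVector p k) ^ e * (WittVector.frobenius)^[H] (v 0) - v 0 = u := by
      have := congrFun hv 0
      simpa [matFrob, Matrix.mulVec, dotProduct] using this
    refine ⟨(p : LField p k) ^ n * algebraMap _ _ (v 0), ?_⟩
    rw [iterate_map_mul, iterate_sigma_p_zpow, iterate_sigma_algebraMap, ← hv0]
    simp only [map_sub, map_mul, map_pow, map_natCast, zpow_natCast]
    ring
  · obtain ⟨e, rfl⟩ : ∃ m : ℕ, e = -(m + 1 : ℕ) := ⟨(-e - 1).toNat, by omega⟩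
    -- with `c = σ^{-H}(c')`, the equation becomes `c' - p^(e+1) σ^{-H}(c') = p^(e+1) b`,
    -- whose left hand side is the identity modulo `p`
    let τ : WittVector p k ≃+* WittVector p k := (WittVector.frobeniusEquiv p k).symm
    let T : (Fin 1 → WittVector p k) →+ (Fin 1 → WittVector p k) :=
      { toFun := fun v _ => v 0 - (p : WittVector p k) ^ (e + 1) * τ^[H] (v 0)
        map_zero' := by funext; simp [iterate_map_zero]
        map_add' := by
          intro v w
          funext
          simp only [Pi.add_apply, iterate_map_add]
          ring }
    have hT : Function.Surjective T := by
      refine surjective_of_surjective_mod_p T fun c =>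
        ⟨c, fun i => (p : WittVector p k) ^ e * τ^[H] (c 0), ?_⟩
      funext i
      obtain rfl : i = 0 := Subsingleton.elim _ _
      change c 0 - (c 0 - (p : WittVector p k) ^ (e + 1) * τ^[H] (c 0)) =
        (p : WittVector p k) * ((p : WittVector p k) ^ e * τ^[H] (c 0))
      ring
    obtain ⟨n, u, rfl⟩ := exists_eq_zpow_mul_unit b hb
    obtain ⟨v, hv⟩ := hT fun _ => (u : WittVector p k)
    have hv0 : v 0 - (p : WittVector p k) ^ (e + 1) * τ^[H] (v 0) = u := congrFun hv 0
    have hτ : (WittVector.frobenius)^[H] (τ^[H] (v 0)) = v 0 :=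
      Function.LeftInverse.iterate (g := WittVector.frobenius) (f := τ)
        (fun x => (WittVector.frobeniusEquiv p k).apply_symm_apply x) H (v 0)
    refine ⟨(p : LField p k) ^ n * ((p : LField p k) ^ (e + 1) * algebraMap _ _ (τ^[H] (v 0))), ?_⟩
    rw [iterate_map_mul, iterate_map_mul, iterate_sigma_p_zpow, ← zpow_natCast _ (e + 1),
      iterate_sigma_p_zpow, iterate_sigma_algebraMap, hτ, ← hv0]
    simp only [map_sub, map_mul, map_pow, map_natCast, zpow_natCast, zpow_neg]
    field_simp

/-- For `n > 0` there is an element fixed by `σ^n` on which `σ` has order exactly `n`: the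
Teichmüller representative of a primitive root of unity. -/
theorem exists_sigma_order {n : ℕ} (hn : 0 < n) : ∃ c : LField p k, (sigmaHom p k)^[n] c = c ∧
    ∀ j, 0 < j → j < n → (sigmaHom p k)^[j] c ≠ c := by
  have hpn : 1 < p ^ n := Nat.one_lt_pow hn.ne' hp.out.one_lt
  have hne : NeZero ((p ^ n - 1 : ℕ) : k) := ⟨by
    rw [Nat.cast_sub hpn.le]
    simp [hn.ne']⟩
  obtain ⟨ζ, hζ⟩ := HasEnoughRootsOfUnity.exists_primitiveRoot k (p ^ n - 1)
  have hσ : ∀ j, (sigmaHom p k)^[j] (algebraMap _ (LField p k) (WittVector.teichmuller p ζ)) =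
      algebraMap _ (LField p k) (WittVector.teichmuller p (ζ ^ p ^ j)) := by
    intro j
    rw [iterate_sigma_algebraMap]
    congr 1
    induction j with
    | zero => simp
    | succ j ih =>
      rw [Function.iterate_succ_apply', ih, WittVector.frobenius_eq_map_frobenius,
        WittVector.map_teichmuller, frobenius_def, ← pow_mul, pow_succ]
  have hinj : ∀ x y : k, algebraMap _ (LField p k) (WittVector.teichmuller p x) =
      algebraMap _ (LField p k) (WittVector.teichmuller p y) → x = y := by
    intro x y hxy
    have := IsFractionRing.injective (WittVector p k) (LField p k) hxy
    rw [← WittVector.teichmuller_coeff_zero p x, this, WittVector.teichmuller_coeff_zero]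
  have hζ0 : ζ ≠ 0 := hζ.ne_zero (by omega)
  refine ⟨algebraMap _ _ (WittVector.teichmuller p ζ), ?_, fun j hj hjn hcon => ?_⟩
  · rw [hσ]
    congr 2
    obtain ⟨m, hm⟩ : ∃ m, p ^ n = m + 1 := ⟨p ^ n - 1, by omega⟩
    have h1 := hζ.pow_eq_one
    rw [hm, Nat.add_sub_cancel] at h1
    rw [hm, pow_succ, h1, one_mul]
  · rw [hσ] at hcon
    have h1 := hinj _ _ hcon
    have hpj : 1 < p ^ j := Nat.one_lt_pow hj.ne' hp.out.one_lt
    have h2 : ζ ^ (p ^ j - 1) = 1 := by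
      apply mul_right_cancel₀ hζ0
      rw [← pow_succ, Nat.sub_add_cancel hpj.le, h1, one_mul]
    have h3 := Nat.le_of_dvd (by omega) (hζ.dvd_of_pow_eq_one _ h2)
    have h4 := Nat.pow_lt_pow_right hp.out.one_lt hjn
    omega

/-- The elements of `L` that are fixed by `σ` are those of `ℚ_p`. -/
theorem exists_qp_of_sigma_eq {x : LField p k} (hx : sigmaHom p k x = x) :
    ∃ a : ℚ_[p], algebraMap ℚ_[p] (LField p k) a = x := by
  rcases eq_or_ne x 0 with rfl | hx0
  · exact ⟨0, map_zero _⟩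
  obtain ⟨n, u, rfl⟩ := exists_eq_zpow_mul_unit x hx0
  have hp0 := zpow_ne_zero n (p_ne_zero_L (p := p) (k := k))
  rw [map_mul, sigma_zpow] at hx
  have h1 : WittVector.frobenius (u : WittVector p k) = u := by
    apply IsFractionRing.injective (WittVector p k) (LField p k)
    rw [← sigma_algebraMap]
    exact mul_left_cancel₀ hp0 hx
  have h2 : ∀ i, ∃ c : ZMod p, ZMod.castHom dvd_rfl k c = (u : WittVector p k).coeff i := by
    intro i
    have h3 : (u : WittVector p k).coeff i ^ p = (u : WittVector p k).coeff i := by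
      rw [← WittVector.coeff_frobenius_charP, h1]
    have h4 := (Subfield.mem_bot_iff_pow_eq_self k p).2 h3
    have h5 : (⊥ : Subfield k) ≤ (ZMod.castHom dvd_rfl k : ZMod p →+* k).fieldRange := bot_le
    exact h5 h4
  choose c hc using h2
  let w : WittVector p (ZMod p) := WittVector.mk p c
  have hw : WittVector.map (ZMod.castHom dvd_rfl k) w = u := by
    ext i
    rw [WittVector.map_coeff, ← hc]
    rfl
  refine ⟨(p : ℚ_[p]) ^ n * algebraMap ℤ_[p] ℚ_[p] (WittVector.equiv p w), ?_⟩
  rw [map_mul, map_zpow₀, map_natCast]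
  congr 1
  change qpToL p k _ = _
  rw [qpToL, IsFractionRing.lift_algebraMap, ← hw]
  simp [zpToW]

end WittClosed

/-! ### Existence of eigenvectors of powers of the Frobenius -/

section Cyclic
variable {p : ℕ} [hp : Fact p.Prime] {k : Type*} [Field k] [CharP k p] [PerfectRing k p]

/-- If `Φ^m x = ∑ aᵢ Φ^i x`, then `Φ` maps the vector with coefficients `c` with respect to the
`Φ^i x` (`i < m`) to the vector with coefficients `cycStep m a c`. -/
noncomputable def cycStep (m : ℕ) (a c : ℕ → LField p k) (i : ℕ) : LField p k :=
  (if i = 0 then 0 else sigmaHom p k (c (i - 1))) + sigmaHom p k (c (m - 1)) * a i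

/-- The vector with coefficients `c` has norm at most `B`, where `Φ^i x` is given norm `ρ^i`. -/
def CycBound (m : ℕ) (ρ B : ℝ≥0) (c : ℕ → LField p k) : Prop :=
  ∀ i < m, absL p k (c i) * ρ ^ i ≤ B

/-- The vector with coefficients `c` has norm `B`, where `Φ^i x` is given norm `ρ^i`, and the
norm is attained only at coefficients of index at least `i₀`. -/
structure CycDominant (m i₀ : ℕ) (ρ B : ℝ≥0) (c : ℕ → LField p k) : Prop where
  bound : CycBound m ρ B c
  lt : ∀ i < i₀, absL p k (c i) * ρ ^ i < B
  eq : ∃ i, i₀ ≤ i ∧ i < m ∧ absL p k (c i) * ρ ^ i = B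

variable {m i₀ : ℕ} {a : ℕ → LField p k} {ρ : ℝ≥0}

theorem CycBound.term_le {B : ℝ≥0} {c : ℕ → LField p k}
    (hb : CycBound m ρ B c) (ha : ∀ i < m, absL p k (a i) ≤ ρ ^ (m - i)) {i : ℕ} (hi : i < m) :
    absL p k (sigmaHom p k (c (m - 1)) * a i) * ρ ^ i ≤ ρ * B := by
  rw [absL_mul, absL_sigmaHom]
  calc absL p k (c (m - 1)) * absL p k (a i) * ρ ^ i
      ≤ absL p k (c (m - 1)) * ρ ^ (m - i) * ρ ^ i := by gcongr; exact ha i hi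
    _ = ρ * (absL p k (c (m - 1)) * ρ ^ (m - 1)) := by
      rw [mul_assoc, ← pow_add, Nat.sub_add_cancel hi.le]
      obtain ⟨m, rfl⟩ : ∃ m', m = m' + 1 := ⟨m - 1, by omega⟩
      rw [Nat.add_sub_cancel, pow_succ]
      ring
    _ ≤ ρ * B := by gcongr; exact hb _ (by omega)

theorem CycBound.shift_le {B : ℝ≥0} {c : ℕ → LField p k}
    (hb : CycBound m ρ B c) {i : ℕ} (hi : i < m) :
    absL p k (if i = 0 then 0 else sigmaHom p k (c (i - 1))) * ρ ^ i ≤ ρ * B := by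
  cases i with
  | zero => simp [absL_zero]
  | succ i =>
    rw [if_neg (by omega), absL_sigmaHom, Nat.add_sub_cancel, pow_succ]
    calc _ = ρ * (absL p k (c i) * ρ ^ i) := by ring
      _ ≤ ρ * B := by gcongr; exact hb i (by omega)

theorem CycBound.step {B : ℝ≥0} {c : ℕ → LField p k} (hb : CycBound m ρ B c)
    (ha : ∀ i < m, absL p k (a i) ≤ ρ ^ (m - i)) : CycBound m ρ (ρ * B) (cycStep m a c) := by
  intro i hi
  refine (mul_le_mul_left (absL_add_le _ _) _).trans ?_
  rw [max_mul]
  exact max_le (hb.shift_le hi) (hb.term_le ha hi)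

theorem absL_add_eq_of_lt {x y : LField p k} (h : absL p k y < absL p k x) :
    absL p k (x + y) = absL p k x :=
  isCompleteDiscrete_absL.selfNorm.add_eq_of_lt isCompleteDiscrete_absL h

/-- Dominance at the indices `≥ i₀` is inherited by the image under `Φ` if `i₀` is the first index
at which the Newton polygon of the relation `Φ^m x = ∑ aᵢ Φ^i x` meets its extremal slope. -/
theorem CycDominant.step (hρ : 0 < ρ) {B : ℝ≥0} {c : ℕ → LField p k}
    (hd : CycDominant m i₀ ρ B c) (ha : ∀ i < m, absL p k (a i) ≤ ρ ^ (m - i))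
    (hi₀ : i₀ < m) (ha₀ : absL p k (a i₀) = ρ ^ (m - i₀))
    (hlt : ∀ i < i₀, absL p k (a i) < ρ ^ (m - i)) (hB : 0 < B) :
    CycDominant m i₀ ρ (ρ * B) (cycStep m a c) := by
  have hterm : ∀ i < m, absL p k (sigmaHom p k (c (m - 1)) * a i) * ρ ^ i =
      absL p k (c (m - 1)) * absL p k (a i) * ρ ^ i := fun i _ => by
    rw [absL_mul, absL_sigmaHom]
  have hm1 : ∀ i ≤ m, 0 < m → ρ ^ (m - i) * ρ ^ i = ρ * ρ ^ (m - 1) := by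
    intro i hi hm
    rw [← pow_add, Nat.sub_add_cancel hi, ← pow_succ', Nat.sub_add_cancel hm]
  have hshift : ∀ i < i₀ + 1, i < m →
      absL p k (if i = 0 then 0 else sigmaHom p k (c (i - 1))) * ρ ^ i < ρ * B := by
    intro i hi him
    cases i with
    | zero => simpa [absL_zero] using mul_pos hρ hB
    | succ i =>
      rw [if_neg (by omega), absL_sigmaHom, Nat.add_sub_cancel, pow_succ]
      calc _ = ρ * (absL p k (c i) * ρ ^ i) := by ring
        _ < ρ * B := by gcongr; exact hd.lt i (by omega)
  refine ⟨hd.bound.step ha, ?_, ?_⟩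
  · intro i hi
    refine (mul_le_mul_left (absL_add_le _ _) _).trans_lt ?_
    rw [max_mul]
    refine max_lt (hshift i (by omega) (by omega)) ?_
    rw [hterm i (by omega)]
    rcases eq_or_ne (absL p k (c (m - 1))) 0 with h0 | h0
    · rw [h0, zero_mul, zero_mul]
      exact mul_pos hρ hB
    calc absL p k (c (m - 1)) * absL p k (a i) * ρ ^ i
        < absL p k (c (m - 1)) * ρ ^ (m - i) * ρ ^ i := by
          have := pos_iff_ne_zero.2 h0
          gcongr
          exact hlt i hi
      _ = ρ * (absL p k (c (m - 1)) * ρ ^ (m - 1)) := by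
        rw [mul_assoc, hm1 i (by omega) (by omega)]
        ring
      _ ≤ ρ * B := by gcongr; exact hd.bound _ (by omega)
  · by_cases hlast : absL p k (c (m - 1)) * ρ ^ (m - 1) = B
    · refine ⟨i₀, le_rfl, hi₀, ?_⟩
      have h1 : absL p k (sigmaHom p k (c (m - 1)) * a i₀) * ρ ^ i₀ = ρ * B := by
        rw [hterm i₀ hi₀, ha₀, mul_assoc, hm1 i₀ hi₀.le (by omega), ← hlast]
        ring
      have h2 := hshift i₀ (by omega) hi₀
      rw [← h1] at h2
      rw [cycStep, add_comm, absL_add_eq_of_lt (lt_of_mul_lt_mul_right h2 zero_le), h1]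
    · -- the largest index at which the norm is attained is moved up by one
      obtain ⟨i, hi, himax⟩ : ∃ i, (i₀ ≤ i ∧ i < m ∧ absL p k (c i) * ρ ^ i = B) ∧
          absL p k (c (m - 1)) * ρ ^ (m - 1) < B := by
        obtain ⟨i, hi⟩ := hd.eq
        exact ⟨i, hi, lt_of_le_of_ne (hd.bound _ (by omega)) hlast⟩
      have him : i + 1 < m := by
        rcases Nat.lt_or_ge (i + 1) m with h1 | h1
        · exact h1
        · exfalso
          apply hlast
          obtain rfl : i = m - 1 := by omega
          exact hi.2.2
      refine ⟨i + 1, by omega, him, ?_⟩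
      have h1 : absL p k (sigmaHom p k (c i)) * ρ ^ (i + 1) = ρ * B := by
        rw [absL_sigmaHom, ← hi.2.2, pow_succ]
        ring
      have h2 : absL p k (sigmaHom p k (c (m - 1)) * a (i + 1)) * ρ ^ (i + 1) < ρ * B := by
        rw [hterm _ him]
        calc absL p k (c (m - 1)) * absL p k (a (i + 1)) * ρ ^ (i + 1)
            ≤ absL p k (c (m - 1)) * ρ ^ (m - (i + 1)) * ρ ^ (i + 1) := by
              gcongr; exact ha _ him
          _ = ρ * (absL p k (c (m - 1)) * ρ ^ (m - 1)) := by
            rw [mul_assoc, hm1 _ him.le (by omega)]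
            ring
          _ < ρ * B := by gcongr
      rw [← h1] at h2
      rw [cycStep, if_neg (by omega), Nat.add_sub_cancel,
        absL_add_eq_of_lt (lt_of_mul_lt_mul_right h2 zero_le), h1]

theorem CycBound.zpow_smul {B : ℝ≥0} {c : ℕ → LField p k} (hb : CycBound m ρ B c) (e : ℤ) :
    CycBound m ρ ((p : ℝ≥0) ^ (-e) * B) fun i => (p : LField p k) ^ e * c i := by
  intro i hi
  dsimp only
  rw [absL_mul, absL_p_zpow, mul_assoc]
  gcongr
  exact hb i hi

theorem CycDominant.zpow_smul {B : ℝ≥0} {c : ℕ → LField p k} (hd : CycDominant m i₀ ρ B c) (e : ℤ) :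
    CycDominant m i₀ ρ ((p : ℝ≥0) ^ (-e) * B) fun i => (p : LField p k) ^ e * c i := by
  refine ⟨hd.bound.zpow_smul e, fun i hi => ?_, ?_⟩
  · rw [absL_mul, absL_p_zpow, mul_assoc]
    have : (0 : ℝ≥0) < (p : ℝ≥0) ^ (-e) := zpow_pos (one_pos.trans one_lt_p_nnreal) _
    gcongr
    exact hd.lt i hi
  · obtain ⟨i, h1, h2, h3⟩ := hd.eq
    refine ⟨i, h1, h2, ?_⟩
    rw [absL_mul, absL_p_zpow, mul_assoc, h3]

theorem absL_le_one_of_lt {x : LField p k} (hx : absL p k x < p) : absL p k x ≤ 1 := by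
  rcases eq_or_ne x 0 with rfl | h0
  · simp [absL_zero]
  obtain ⟨n, hn⟩ := isCompleteDiscrete_absL.exists_zpow x h0
  rw [hn] at hx ⊢
  have h1 := one_lt_p_nnreal (p := p)
  rw [← zpow_one (p : ℝ≥0), zpow_one, ← zpow_one (p : ℝ≥0)] at hx
  have : n < 1 := (zpow_lt_zpow_iff_right₀ h1).1 (by simpa using hx)
  exact zpow_le_one_of_nonpos₀ h1.le (by omega)

variable {N : Type*} [AddCommGroup N] [Module (LField p k) N]
  (Φ : N ≃ₛₗ[sigmaHom p k] N)

theorem frob_sum_cycStep (x : N) (hm : 0 < m)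
    (hx : Φ^[m] x = ∑ i ∈ Finset.range m, a i • Φ^[i] x) (c : ℕ → LField p k) :
    Φ (∑ i ∈ Finset.range m, c i • Φ^[i] x) =
      ∑ i ∈ Finset.range m, cycStep m a c i • Φ^[i] x := by
  obtain ⟨m, rfl⟩ : ∃ m', m = m' + 1 := ⟨m - 1, by omega⟩
  have h1 : Φ (∑ i ∈ Finset.range (m + 1), c i • Φ^[i] x) =
      (∑ i ∈ Finset.range m, sigmaHom p k (c i) • Φ^[i + 1] x) +
        sigmaHom p k (c m) • ∑ i ∈ Finset.range (m + 1), a i • Φ^[i] x := by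
    rw [map_sum, Finset.sum_range_succ, LinearEquiv.map_smulₛₗ, ← Function.iterate_succ_apply' Φ, hx]
    congr 1
    exact Finset.sum_congr rfl fun i _ => by
      rw [LinearEquiv.map_smulₛₗ, ← Function.iterate_succ_apply' Φ]
  rw [h1]
  simp only [cycStep, add_smul, Finset.sum_add_distrib, Finset.smul_sum, smul_smul,
    Nat.add_sub_cancel]
  congr 1
  rw [Finset.sum_range_succ']
  simp

end Cyclic

section CyclicClosed
variable {p : ℕ} [hp : Fact p.Prime] {k : Type*} [Field k] [CharP k p] [IsAlgClosed k]
variable {N : Type*} [AddCommGroup N] [Module (LField p k) N] [FiniteDimensional (LField p k) N]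
  (Φ : N ≃ₛₗ[sigmaHom p k] N)

theorem iterate_frob_ne_zero {x : N} (hx : x ≠ 0) (n : ℕ) : Φ^[n] x ≠ 0 := by
  induction n with
  | zero => exact hx
  | succ n ih =>
    rw [Function.iterate_succ_apply']
    exact fun h0 => ih (by simpa using h0)

/-- Every nonzero isocrystal contains a nonzero vector `w` such that `Φ^h w = p^d w` for some `h >
0` and `d`: for a relation `Φ^m x = ∑ aᵢ Φ^i x` of minimal degree and the extremal slope `d / h`
of its Newton polygon, `p^{-d} Φ^h` stabilises a lattice in the span of the `Φ^i x` and is not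
nilpotent modulo `p` on it. -/
theorem exists_frob_eigenvector [Nontrivial N] :
    ∃ w : N, w ≠ 0 ∧ ∃ (h : ℕ) (d : ℤ), 0 < h ∧ Φ^[h] w = (p : LField p k) ^ d • w := by
  classical
  have hL := isCompleteDiscrete_absL (p := p) (k := k)
  have hp1 := one_lt_p_nnreal (p := p)
  have hppos : (0 : ℝ≥0) < p := one_pos.trans hp1
  have hp0 := p_ne_zero_L (p := p) (k := k)
  obtain ⟨x, hx0⟩ := exists_ne (0 : N)
  obtain ⟨m, a, hli, hx⟩ := exists_linearIndependent_relation (K := LField p k) fun i => Φ^[i] x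
  have hane : ∃ j < m, a j ≠ 0 := by
    by_contra! hcon
    exact iterate_frob_ne_zero Φ hx0 m (hx.trans (Finset.sum_eq_zero fun i hi => by
      rw [hcon i (Finset.mem_range.1 hi), zero_smul]))
  obtain ⟨j₀, hj₀, hj₀'⟩ := hane
  have hm : 0 < m := by omega
  -- `ρ` is the largest of the `|aᵢ|^(1/(m-i))`
  let f : ℕ → ℝ≥0 := fun i => absL p k (a i) ^ (1 / ((m - i : ℕ) : ℝ))
  have hf : ∀ i < m, f i ^ (m - i) = absL p k (a i) := by
    intro i hi
    have : ((m - i : ℕ) : ℝ) ≠ 0 := by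
      have : m - i ≠ 0 := by omega
      exact_mod_cast this
    change (absL p k (a i) ^ (1 / ((m - i : ℕ) : ℝ))) ^ (m - i) = _
    rw [← NNReal.rpow_natCast, ← NNReal.rpow_mul, one_div_mul_cancel this, NNReal.rpow_one]
  obtain ⟨j₁, hj₁, hj₁max⟩ := Finset.exists_max_image (Finset.range m) f ⟨j₀, Finset.mem_range.2 hj₀⟩
  rw [Finset.mem_range] at hj₁
  let ρ := f j₁
  have hex : ∃ i, i < m ∧ f i = ρ := ⟨j₁, hj₁, rfl⟩
  let i₀ := Nat.find hex
  have hi₀ : i₀ < m := (Nat.find_spec hex).1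
  have hi₀ρ : f i₀ = ρ := (Nat.find_spec hex).2
  have hle : ∀ i < m, f i ≤ ρ := fun i hi => hj₁max i (Finset.mem_range.2 hi)
  have ha : ∀ i < m, absL p k (a i) ≤ ρ ^ (m - i) := by
    intro i hi
    rw [← hf i hi]
    exact pow_le_pow_left₀ zero_le (hle i hi) _
  have ha₀ : absL p k (a i₀) = ρ ^ (m - i₀) := by rw [← hf i₀ hi₀, hi₀ρ]
  have hlt : ∀ i < i₀, absL p k (a i) < ρ ^ (m - i) := by
    intro i hi
    have him : i < m := hi.trans hi₀
    rw [← hf i him]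
    have hne : f i ≠ ρ := fun he => Nat.find_min hex hi ⟨him, he⟩
    exact pow_lt_pow_left₀ (lt_of_le_of_ne (hle i him) hne) zero_le (by omega)
  have hρ : 0 < ρ := by
    refine lt_of_lt_of_le ?_ (hle j₀ hj₀)
    exact NNReal.rpow_pos (pos_iff_ne_zero.2 (hL.ne_zero hj₀'))
  have ha₀0 : a i₀ ≠ 0 := by
    intro h0
    rw [h0, absL_zero] at ha₀
    exact (pow_pos hρ _).ne ha₀
  obtain ⟨d', hd'⟩ := hL.exists_zpow _ ha₀0
  obtain ⟨d, rfl⟩ : ∃ d : ℤ, d' = -d := ⟨-d', by ring⟩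
  let h := m - i₀
  have hh : 0 < h := by omega
  have hρh : ρ ^ h = (p : ℝ≥0) ^ (-d) := by rw [← hd', ha₀]
  -- the coefficients of the operator `p^{-d} Φ^h`
  let step : (ℕ → LField p k) → (ℕ → LField p k) := fun c i =>
    (p : LField p k) ^ (-d) * (cycStep m a)^[h] c i
  let vec : (ℕ → LField p k) → N := fun c => ∑ i ∈ Finset.range m, c i • Φ^[i] x
  have hvec : ∀ n c, Φ^[n] (vec c) = vec ((cycStep m a)^[n] c) := by
    intro n
    induction n with
    | zero => intro c; rfl
    | succ n ih =>
      intro c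
      rw [Function.iterate_succ_apply, Function.iterate_succ_apply, frob_sum_cycStep Φ x hm hx]
      exact ih _
  have hvecstep : ∀ c, (p : LField p k) ^ (-d) • Φ^[h] (vec c) = vec (step c) := by
    intro c
    rw [hvec]
    simp only [vec, step, Finset.smul_sum, smul_smul]
  have hpd : (p : ℝ≥0) ^ (-(-d)) * ρ ^ h = 1 := by
    rw [hρh, ← zpow_add₀ hppos.ne']
    simp
  have hboundstep : ∀ B c, CycBound m ρ B c → CycBound m ρ B (step c) := by
    intro B c hb
    have h1 : ∀ n, CycBound m ρ (ρ ^ n * B) ((cycStep m a)^[n] c) := by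
      intro n
      induction n with
      | zero => simpa using hb
      | succ n ih =>
        rw [Function.iterate_succ_apply', pow_succ', mul_assoc]
        exact ih.step ha
    have h2 := (h1 h).zpow_smul (-d)
    rwa [← mul_assoc, hpd, one_mul] at h2
  have hdomstep : ∀ B c, 0 < B → CycDominant m i₀ ρ B c → CycDominant m i₀ ρ B (step c) := by
    intro B c hB hb
    have h1 : ∀ n, CycDominant m i₀ ρ (ρ ^ n * B) ((cycStep m a)^[n] c) := by
      intro n
      induction n with
      | zero => simpa using hb
      | succ n ih =>
        rw [Function.iterate_succ_apply', pow_succ', mul_assoc]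
        exact ih.step hρ ha hi₀ ha₀ hlt (mul_pos (pow_pos hρ _) hB)
    have h2 := (h1 h).zpow_smul (-d)
    rwa [← mul_assoc, hpd, one_mul] at h2
  -- a basis `p^(e i) Φ^i x` of the lattice of vectors of norm at most `1`
  have hexp : ∀ i, ∃ e : ℤ, (p : ℝ≥0)⁻¹ < (p : ℝ≥0) ^ (-e) * ρ ^ i ∧ (p : ℝ≥0) ^ (-e) * ρ ^ i ≤ 1 := by
    intro i
    obtain ⟨n, hn1, hn2⟩ := exists_mem_Ioc_zpow (pow_pos hρ i) hp1
    refine ⟨n + 1, ?_, ?_⟩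
    · have h1 : (p : ℝ≥0) ^ (-(n + 1)) = (p : ℝ≥0)⁻¹ * ((p : ℝ≥0) ^ n)⁻¹ := by
        rw [zpow_neg, zpow_add₀ hppos.ne', zpow_one, mul_inv, mul_comm]
      rw [h1, mul_assoc]
      refine lt_mul_of_one_lt_right (inv_pos.2 hppos) ?_
      rwa [lt_inv_mul_iff₀ (zpow_pos hppos _), mul_one]
    · rw [zpow_neg, inv_mul_le_iff₀ (zpow_pos hppos _), mul_one]
      exact hn2
  choose e he1 he2 using hexp
  let g : Fin m → N := fun i => (p : LField p k) ^ e i • Φ^[i.val] x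
  let toN : (Fin m → WittVector p k) → N := fun v =>
    ∑ i, algebraMap (WittVector p k) (LField p k) (v i) • g i
  let coef : (Fin m → WittVector p k) → ℕ → LField p k := fun v i =>
    if hi : i < m then algebraMap _ _ (v ⟨i, hi⟩) * (p : LField p k) ^ e i else 0
  have htoN : ∀ v, toN v = vec (coef v) := by
    intro v
    simp only [toN, vec, g, Finset.sum_range]
    refine Finset.sum_congr rfl fun i _ => ?_
    simp only [coef, i.2, dif_pos, smul_smul]
  have hlift : ∀ c, CycBound m ρ 1 c → ∃ v, vec c = toN v := by
    intro c hc
    have : ∀ i : Fin m, ∃ w : WittVector p k,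
        algebraMap _ (LField p k) w = c i * (p : LField p k) ^ (-e i) := by
      intro i
      rw [← absL_le_one_iff]
      apply absL_le_one_of_lt
      rw [absL_mul, absL_p_zpow]
      have h1 := hc i i.2
      have h2 := he1 i
      have h3 : (0 : ℝ≥0) < ρ ^ i.val := pow_pos hρ _
      have h4 : (0 : ℝ≥0) < (p : ℝ≥0) ^ (e i) := zpow_pos hppos _
      rw [zpow_neg, lt_inv_mul_iff₀ h4, mul_comm, inv_mul_lt_iff₀ hppos] at h2
      rw [neg_neg]
      calc _ ≤ (ρ ^ i.val)⁻¹ * (p : ℝ≥0) ^ e i := by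
            gcongr
            rwa [← le_div_iff₀ h3, one_div] at h1
        _ < p := by
          rw [inv_mul_lt_iff₀ h3, mul_comm]
          exact h2
    choose v hv using this
    refine ⟨v, ?_⟩
    rw [htoN]
    refine Finset.sum_congr rfl fun i hi => ?_
    rw [Finset.mem_range] at hi
    simp only [coef, hi, dif_pos, hv]
    rw [mul_assoc, ← zpow_add₀ hp0]
    simp
  have hcoefbound : ∀ v, CycBound m ρ 1 (coef v) := by
    intro v i hi
    simp only [coef, hi, dif_pos]
    rw [absL_mul, absL_p_zpow, mul_assoc]
    exact mul_le_one' (absL_le_one_iff.2 ⟨_, rfl⟩) (he2 i)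
  choose A' hA' using fun j : Fin m => hlift _ (hboundstep _ _ (hcoefbound (Pi.single j 1)))
  let A : Matrix (Fin m) (Fin m) (WittVector p k) := Matrix.of fun i j => A' j i
  have hsingle : ∀ j, toN (Pi.single j 1) = g j := by
    intro j
    simp only [toN]
    rw [Finset.sum_eq_single j]
    · simp
    · intro i _ hij
      simp [Pi.single_eq_of_ne hij]
    · simp
  have hAg : ∀ j, (p : LField p k) ^ (-d) • Φ^[h] (g j) =
      ∑ i, algebraMap _ (LField p k) (A i j) • g i := by
    intro j
    rw [← hsingle, htoN, hvecstep, hA']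
    rfl
  have hΨ : ∀ v, (p : LField p k) ^ (-d) • Φ^[h] (toN v) = toN (matFrob A h v) := by
    intro v
    have hsum : ∀ (s : Finset (Fin m)) (F : Fin m → N), Φ^[h] (∑ i ∈ s, F i) = ∑ i ∈ s, Φ^[h] (F i) := by
      intro s F
      induction s using Finset.induction_on with
      | empty => simp [iterate_map_zero]
      | insert i s hi ih => rw [Finset.sum_insert hi, Finset.sum_insert hi, iterate_frob_add, ih]
    simp only [toN, hsum, iterate_frob_smul, Finset.smul_sum, iterate_sigma_algebraMap]
    have h1 : ∀ j, (p : LField p k) ^ (-d) •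
        algebraMap _ (LField p k) ((WittVector.frobenius)^[h] (v j)) • Φ^[h] (g j) =
        ∑ i, (algebraMap _ (LField p k) ((WittVector.frobenius)^[h] (v j)) *
          algebraMap _ (LField p k) (A i j)) • g i := by
      intro j
      rw [smul_comm, hAg, Finset.smul_sum]
      simp only [smul_smul]
    simp only [h1]
    rw [Finset.sum_comm]
    refine Finset.sum_congr rfl fun i _ => ?_
    rw [← Finset.sum_smul]
    congr 1
    change _ = algebraMap _ _ (∑ j, A i j * (WittVector.frobenius)^[h] (v j))
    rw [map_sum]
    exact Finset.sum_congr rfl fun j _ => by rw [map_mul, mul_comm]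
  have hvecinj : ∀ c c', vec c = vec c' → ∀ i < m, c i = c' i := by
    intro c c' hcc i hi
    have h1 : ∑ j : Fin m, (c j - c' j) • Φ^[j.val] x = 0 := by
      simp only [sub_smul, Finset.sum_sub_distrib]
      rw [sub_eq_zero]
      simpa only [vec, Finset.sum_range] using hcc
    exact sub_eq_zero.1 (Fintype.linearIndependent_iff.1 hli (fun j => c j - c' j) h1 ⟨i, hi⟩)
  -- `p^{-d} Φ^h` is not nilpotent modulo `p` on the lattice
  let v₀ : Fin m → WittVector p k := Pi.single ⟨i₀, hi₀⟩ 1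
  let B₀ : ℝ≥0 := (p : ℝ≥0) ^ (-e i₀) * ρ ^ i₀
  have hB₀ : (p : ℝ≥0)⁻¹ < B₀ := he1 i₀
  have hB₀pos : 0 < B₀ := lt_trans (inv_pos.2 hppos) hB₀
  have hdom₀ : CycDominant m i₀ ρ B₀ (coef v₀) := by
    have hne : ∀ i, i ≠ i₀ → coef v₀ i = 0 := by
      intro i hi
      simp only [coef, v₀]
      split_ifs with him
      · rw [Pi.single_eq_of_ne (by simpa [Fin.ext_iff] using hi), map_zero, zero_mul]
      · rfl
    have heq : absL p k (coef v₀ i₀) * ρ ^ i₀ = B₀ := by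
      simp only [coef, v₀, hi₀, dif_pos, Pi.single_eq_same, map_one, one_mul, absL_p_zpow, B₀]
    refine ⟨fun i hi => ?_, fun i hi => ?_, ⟨i₀, le_rfl, hi₀, heq⟩⟩
    · by_cases hii : i = i₀
      · rw [hii, heq]
      · rw [hne i hii, absL_zero, zero_mul]
        exact zero_le
    · rw [hne i (by omega), absL_zero, zero_mul]
      exact hB₀pos
  have hres : ∀ j, resVec ((matFrob A h)^[j] v₀) ≠ 0 := by
    intro j h0
    have h1 : toN ((matFrob A h)^[j] v₀) = vec (step^[j] (coef v₀)) := by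
      clear h0
      induction j with
      | zero => exact htoN v₀
      | succ j ih =>
        rw [Function.iterate_succ_apply', Function.iterate_succ_apply', ← hΨ, ih, hvecstep]
    have h2 : CycDominant m i₀ ρ B₀ (step^[j] (coef v₀)) := by
      clear h0 h1
      induction j with
      | zero => exact hdom₀
      | succ j ih =>
        rw [Function.iterate_succ_apply']
        exact hdomstep _ _ hB₀pos ih
    obtain ⟨w, hw⟩ := resVec_eq_zero h0
    obtain ⟨i, -, him, hi⟩ := h2.eq
    rw [htoN, hw] at h1
    rw [← hvecinj _ _ h1 i him] at hi
    simp only [coef, him, dif_pos, Pi.smul_apply, smul_eq_mul, map_mul, map_natCast] at hi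
    rw [absL_mul, absL_mul, absL_p, absL_p_zpow, mul_assoc] at hi
    have h3 : (p : ℝ≥0)⁻¹ * absL p k (algebraMap _ _ (w ⟨i, him⟩)) * ((p : ℝ≥0) ^ (-e i) * ρ ^ i) ≤
        (p : ℝ≥0)⁻¹ := by
      rw [mul_assoc]
      exact mul_le_of_le_one_right zero_le
        (mul_le_one' (absL_le_one_iff.2 ⟨_, rfl⟩) (he2 i))
    rw [hi] at h3
    exact absurd hB₀ (not_lt.2 h3)
  obtain ⟨w, hw0, hw⟩ := matFrob_exists_fixed A hh v₀ hres
  refine ⟨toN w, fun h0 => hw0 ?_, h, d, hh, ?_⟩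
  · have h1 : vec (coef w) = vec 0 := by
      rw [← htoN, h0]
      simp [vec]
    funext i
    have h2 := hvecinj _ _ h1 i i.2
    simp only [coef, i.2, dif_pos, Pi.zero_apply, mul_eq_zero] at h2
    rcases h2 with h2 | h2
    · exact IsFractionRing.injective (WittVector p k) (LField p k) (by simpa using h2)
    · exact absurd h2 (zpow_ne_zero _ hp0)
  · have h1 := hΨ w
    rw [hw] at h1
    have h2 := congrArg (fun y => (p : LField p k) ^ d • y) h1
    simpa only [smul_smul, ← zpow_add₀ hp0, add_neg_cancel, zpow_zero, one_smul] using h2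

end CyclicClosed

/-! ### The slope decomposition -/

section Iterate
variable {p : ℕ} [hp : Fact p.Prime] {k : Type*} [Field k] [CharP k p] [PerfectRing k p]
variable {N : Type*} [AddCommGroup N] [Module (LField p k) N] (Φ : N ≃ₛₗ[sigmaHom p k] N)

theorem iterate_frob_sum {ι : Type*} (n : ℕ) (s : Finset ι) (f : ι → N) :
    Φ^[n] (∑ i ∈ s, f i) = ∑ i ∈ s, Φ^[n] (f i) := by
  classical
  induction s using Finset.induction_on with
  | empty => simp [iterate_map_zero]
  | insert i s hi ih => rw [Finset.sum_insert hi, Finset.sum_insert hi, iterate_frob_add, ih]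

theorem iterate_frob_zpow_smul (n : ℕ) (e : ℤ) (x : N) :
    Φ^[n] ((p : LField p k) ^ e • x) = (p : LField p k) ^ e • Φ^[n] x := by
  rw [iterate_frob_smul, iterate_sigma_p_zpow]

theorem iterate_frob_eigenvector {h : ℕ} {d : ℤ} {x : N}
    (hx : Φ^[h] x = (p : LField p k) ^ d • x) (n : ℕ) :
    Φ^[h * n] x = (p : LField p k) ^ (d * n) • x := by
  induction n with
  | zero => simp
  | succ n ih =>
    rw [mul_add, mul_one, Function.iterate_add_apply, hx, iterate_frob_zpow_smul, ih, smul_smul,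
      ← zpow_add₀ p_ne_zero_L]
    congr 2
    push_cast
    ring

theorem iterate_sigma_injective (n : ℕ) : Function.Injective (sigmaHom p k)^[n] :=
  (sigmaHom p k).injective.iterate n

theorem iterate_frob_injective (n : ℕ) : Function.Injective Φ^[n] := Φ.injective.iterate n

theorem iterate_frob_surjective (n : ℕ) : Function.Surjective Φ^[n] := Φ.surjective.iterate n

/-- The restriction of `Φ` to a stable subspace. -/
noncomputable def restrictFrob (W : Submodule (LField p k) N) (hW : ∀ x, Φ x ∈ W ↔ x ∈ W) :
    W ≃ₛₗ[sigmaHom p k] W where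
  toFun x := ⟨Φ x, (hW x).2 x.2⟩
  invFun x := ⟨Φ.symm x, (hW _).1 (by simp)⟩
  map_add' x y := by ext; simp
  map_smul' a x := Subtype.ext (LinearEquiv.map_smulₛₗ Φ a (x : N))
  left_inv x := by ext; simp
  right_inv x := by ext; simp

theorem coe_restrictFrob_iterate (W : Submodule (LField p k) N) (hW : ∀ x, Φ x ∈ W ↔ x ∈ W)
    (n : ℕ) (x : W) : (((restrictFrob Φ W hW)^[n] x : W) : N) = Φ^[n] x := by
  induction n with
  | zero => rfl
  | succ n ih => rw [Function.iterate_succ_apply', Function.iterate_succ_apply', ← ih]; rfl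

theorem stable_of_le_comap {W : Submodule (LField p k) N}
    (h1 : ∀ x ∈ W, Φ x ∈ W) (h2 : ∀ x ∈ W, Φ.symm x ∈ W) (x : N) : Φ x ∈ W ↔ x ∈ W :=
  ⟨fun h => by simpa using h2 _ h, h1 x⟩

/-- If a vector `x` satisfies `Φ^h x = p^d x` with `r = d / h` in lowest terms, it lies in an
isoclinic sub-isocrystal of slope `r`, namely the span of the `Φ^i x`. -/
theorem mem_slopePart_of_eigenvector {r : ℚ} {x : N}
    (hx : Φ^[r.den] x = (p : LField p k) ^ r.num • x) : x ∈ slopePart Φ r := by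
  have hp0 := p_ne_zero_L (p := p) (k := k)
  let v : Fin r.den → N := fun i => Φ^[i.val] x
  let P : Submodule (LField p k) N := Submodule.span _ (Set.range v)
  let R := (algebraMap (WittVector p k) (LField p k)).range
  let M : Submodule R N := Submodule.span _ (Set.range v)
  have hden : 0 < r.den := r.pos
  have hxP : x ∈ P := Submodule.subset_span ⟨⟨0, hden⟩, rfl⟩
  suffices hP : IsIsoclinic Φ r P from (le_sSup hP : P ≤ slopePart Φ r) hxP
  refine ⟨?_, M, ?_, ?_, ?_⟩
  · refine stable_of_le_comap Φ ?_ ?_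
    · have : P ≤ P.comap (Φ : N →ₛₗ[sigmaHom p k] N) := by
        rw [Submodule.span_le]
        rintro _ ⟨i, rfl⟩
        change Φ (Φ^[i.val] x) ∈ P
        rw [← Function.iterate_succ_apply' Φ]
        by_cases hi : i.val + 1 < r.den
        · exact Submodule.subset_span ⟨⟨i.val + 1, hi⟩, rfl⟩
        · have : i.val.succ = r.den := by have := i.2; omega
          rw [this, hx]
          exact P.smul_mem _ hxP
      exact fun x hx => this hx
    · have : P ≤ P.comap (Φ.symm : N →ₛₗ[sigmaInvHom p k] N) := by
        rw [Submodule.span_le]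
        rintro _ ⟨i, rfl⟩
        change Φ.symm (Φ^[i.val] x) ∈ P
        by_cases hi : i.val = 0
        · have h1 : Φ.symm x = (p : LField p k) ^ (-r.num) • Φ^[r.den - 1] x := by
            rw [LinearEquiv.symm_apply_eq, LinearEquiv.map_smulₛₗ, sigma_zpow,
              ← Function.iterate_succ_apply' Φ, Nat.succ_eq_add_one, Nat.sub_add_cancel hden, hx,
              smul_smul, ← zpow_add₀ hp0]
            simp
          rw [hi, Function.iterate_zero, id, h1]
          exact P.smul_mem _ (Submodule.subset_span ⟨⟨r.den - 1, by omega⟩, rfl⟩)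
        · obtain ⟨j, hj⟩ : ∃ j, i.val = j + 1 := ⟨i.val - 1, by omega⟩
          rw [hj, Function.iterate_succ_apply', LinearEquiv.symm_apply_apply]
          exact Submodule.subset_span ⟨⟨j, by have := i.2; omega⟩, rfl⟩
      exact fun x hx => this hx
  · exact Submodule.fg_span (Set.finite_range _)
  · exact Submodule.span_span_of_tower R (LField p k) (Set.range v)
  -- on the lattice, `p^{-d} Φ^h` acts as `σ^h` on the coordinates
  · have hv : ∀ i, Φ^[r.den] (v i) = (p : LField p k) ^ r.num • v i := by
      intro i
      change Φ^[r.den] (Φ^[i.val] x) = _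
      rw [← Function.iterate_add_apply, add_comm, Function.iterate_add_apply, hx,
        iterate_frob_zpow_smul]
    have key : ∀ w : Fin r.den → WittVector p k, (p : LField p k) ^ (-r.num) •
        Φ^[r.den] (∑ i, algebraMap _ (LField p k) (w i) • v i) =
        ∑ i, algebraMap _ (LField p k) ((WittVector.frobenius)^[r.den] (w i)) • v i := by
      intro w
      rw [iterate_frob_sum, Finset.smul_sum]
      refine Finset.sum_congr rfl fun i _ => ?_
      rw [iterate_frob_smul, hv, iterate_sigma_algebraMap, smul_comm, smul_smul _ _ (v i),
        ← zpow_add₀ hp0, neg_add_cancel, zpow_zero, one_smul]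
    have hmem : ∀ y, y ∈ M ↔ ∃ w : Fin r.den → WittVector p k,
        ∑ i, algebraMap _ (LField p k) (w i) • v i = y := by
      intro y
      rw [Submodule.mem_span_range_iff_exists_fun]
      constructor
      · rintro ⟨c, rfl⟩
        choose w hw using fun i => (c i).2
        exact ⟨w, Finset.sum_congr rfl fun i _ => by rw [hw]; rfl⟩
      · rintro ⟨w, rfl⟩
        exact ⟨fun i => ⟨_, ⟨w i, rfl⟩⟩, rfl⟩
    intro y
    rw [hmem, hmem]
    constructor
    · rintro ⟨w, rfl⟩
      exact ⟨_, (key w).symm⟩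
    · rintro ⟨w, hw⟩
      have hsurj : Function.Surjective (WittVector.frobenius (p := p) (R := k))^[r.den] :=
        (WittVector.frobenius_bijective p k).surjective.iterate _
      choose w' hw' using fun i => hsurj (w i)
      refine ⟨w', ?_⟩
      have h1 := key w'
      simp only [hw', hw] at h1
      exact iterate_frob_injective Φ _ (smul_right_injective N (zpow_ne_zero _ hp0) h1)

theorem mem_slopeFix_iff {r : ℚ} {x : N} :
    x ∈ slopeFix Φ r ↔ Φ^[r.den] x = (p : LField p k) ^ r.num • x :=
  ⟨fun h => h.2, fun h => ⟨mem_slopePart_of_eigenvector Φ h, h⟩⟩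

/-- Families of eigenvectors for various slopes, linearly independent over `K(r)` for each slope
`r`, are jointly linearly independent over `L`: in a shortest relation, normalised to have a
coefficient `1`, all vectors have the same slope `r` and all coefficients lie in `K(r)`. -/
theorem linearIndependent_of_slopeFix {ι : ℚ → Type*} (b : ∀ r, ι r → slopeFix Φ r)
    (hb : ∀ r, LinearIndependent (fixedField p k r) (b r)) :
    LinearIndependent (LField p k) fun x : Σ r, ι r => (b x.1 x.2 : N) := by
  classical
  have hp0 := p_ne_zero_L (p := p) (k := k)
  have hp1 := one_lt_p_nnreal (p := p)
  have hL := isCompleteDiscrete_absL (p := p) (k := k)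
  set e : (Σ r, ι r) → N := fun x => (b x.1 x.2 : N) with he
  have heig : ∀ x, Φ^[x.1.den] (e x) = (p : LField p k) ^ x.1.num • e x := fun x => (b x.1 x.2).2.2
  rw [linearIndependent_iff']
  intro s
  induction s using Finset.induction_on with
  | empty => simp
  | insert x₀ s hx₀ ih =>
    intro g hg
    by_cases hg0 : g x₀ = 0
    · rw [Finset.sum_insert hx₀, hg0, zero_smul, zero_add] at hg
      intro i hi
      rcases Finset.mem_insert.1 hi with rfl | hi
      · exact hg0
      · exact ih g hg i hi
    exfalso
    obtain ⟨f, hf1, hf⟩ : ∃ f : (Σ r, ι r) → LField p k, f x₀ = 1 ∧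
        ∑ i ∈ insert x₀ s, f i • e i = 0 := by
      refine ⟨fun i => (g x₀)⁻¹ * g i, inv_mul_cancel₀ hg0, ?_⟩
      simp only [mul_smul, ← Finset.smul_sum, hg, smul_zero]
    -- comparing the relation with its image under a power of `Φ`
    have key : ∀ (H : ℕ) (D : (Σ r, ι r) → ℤ),
        (∀ i ∈ insert x₀ s, f i ≠ 0 → Φ^[H] (e i) = (p : LField p k) ^ D i • e i) →
        ∀ i ∈ s, (sigmaHom p k)^[H] (f i) * (p : LField p k) ^ (D i - D x₀) = f i := by
      intro H D hHD i hi
      have h1 : ∑ i ∈ insert x₀ s, ((sigmaHom p k)^[H] (f i) * (p : LField p k) ^ (D i - D x₀)) • e i =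
          0 := by
        have h2 := congrArg (fun y => (p : LField p k) ^ (-D x₀) • Φ^[H] y) hf
        rw [iterate_map_zero, smul_zero, iterate_frob_sum, Finset.smul_sum] at h2
        rw [← h2]
        refine Finset.sum_congr rfl fun i hi => ?_
        by_cases hfi : f i = 0
        · rw [hfi, iterate_map_zero, zero_mul, zero_smul, iterate_map_zero Φ, smul_zero]
        rw [iterate_frob_smul, hHD i hi hfi, smul_smul, smul_smul, sub_eq_add_neg, zpow_add₀ hp0]
        congr 1
        ring
      rw [Finset.sum_insert hx₀, hf1, iterate_map_one, sub_self, zpow_zero, one_mul] at h1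
      rw [Finset.sum_insert hx₀, hf1] at hf
      have h3 : ∑ i ∈ s, ((sigmaHom p k)^[H] (f i) * (p : LField p k) ^ (D i - D x₀) - f i) • e i = 0 := by
        simp only [sub_smul, Finset.sum_sub_distrib]
        rw [sub_eq_zero]
        exact add_left_cancel (h1.trans hf.symm)
      exact sub_eq_zero.1 (ih _ h3 i hi)
    -- first, only vectors of the slope of `e x₀` occur
    let H := ∏ i ∈ insert x₀ s, i.1.den
    have hdvd : ∀ i ∈ insert x₀ s, i.1.den ∣ H := fun i hi => Finset.dvd_prod_of_mem _ hi
    have hHpos : 0 < H := Finset.prod_pos fun i _ => i.1.pos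
    have hslope : ∀ i ∈ s, f i ≠ 0 → i.1 = x₀.1 := by
      intro i hi hfi
      have h1 := key H (fun i => i.1.num * (H / i.1.den : ℕ)) (fun i hi _ => by
        have := iterate_frob_eigenvector Φ (heig i) (H / i.1.den)
        rwa [Nat.mul_div_cancel' (hdvd i hi)] at this) i hi
      have h2 := congrArg (absL p k) h1
      rw [absL_mul, absL_iterate_sigma, absL_p_zpow] at h2
      have h3 : (p : ℝ≥0) ^ (-(i.1.num * ((H / i.1.den : ℕ) : ℤ) -
          x₀.1.num * ((H / x₀.1.den : ℕ) : ℤ))) = (p : ℝ≥0) ^ (0 : ℤ) := by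
        rw [zpow_zero]
        exact mul_left_cancel₀ (hL.ne_zero hfi) (h2.trans (mul_one _).symm)
      have h4 := zpow_right_injective₀ (one_pos.trans hp1) hp1.ne' h3
      have hval : ∀ j ∈ insert x₀ s, ((j.1.num * ((H / j.1.den : ℕ) : ℤ) : ℤ) : ℚ) = j.1 * H := by
        intro j hj
        obtain ⟨m, hm⟩ := hdvd j hj
        rw [hm, Nat.mul_div_cancel_left _ j.1.pos]
        push_cast
        rw [← mul_assoc, Rat.mul_den_eq_num]
      have h5 : ((i.1.num * ((H / i.1.den : ℕ) : ℤ) : ℤ) : ℚ) =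
          ((x₀.1.num * ((H / x₀.1.den : ℕ) : ℤ) : ℤ) : ℚ) := by
        congr 1
        omega
      rw [hval i (Finset.mem_insert_of_mem hi), hval x₀ (Finset.mem_insert_self _ _)] at h5
      exact mul_right_cancel₀ (by exact_mod_cast hHpos.ne') h5
    -- then the coefficients lie in `K(r)`
    have hfix : ∀ i ∈ insert x₀ s, f i ∈ fixedField p k x₀.1 := by
      intro i hi
      rw [mem_fixedField]
      rcases Finset.mem_insert.1 hi with rfl | hi
      · rw [hf1, iterate_map_one]
      have := key x₀.1.den (fun _ => x₀.1.num) (fun j hj hfj => by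
        have hj' : j.1 = x₀.1 := by
          rcases Finset.mem_insert.1 hj with rfl | hj
          · rfl
          · exact hslope j hj hfj
        rw [← hj']
        exact heig j) i hi
      rwa [sub_self, zpow_zero, mul_one] at this
    obtain ⟨r, j₀⟩ := x₀
    let t := (insert ⟨r, j₀⟩ s).preimage (Sigma.mk r) sigma_mk_injective.injOn
    let c : ι r → fixedField p k r := fun j =>
      if hj : (⟨r, j⟩ : Σ r, ι r) ∈ insert ⟨r, j₀⟩ s then ⟨f ⟨r, j⟩, hfix _ hj⟩ else 0
    have hsum : ∑ j ∈ t, c j • b r j = 0 := by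
      apply Subtype.ext
      have h1 : ((∑ j ∈ t, c j • b r j : slopeFix Φ r) : N) = ∑ j ∈ t, f ⟨r, j⟩ • e ⟨r, j⟩ := by
        rw [Submodule.coe_sum]
        refine Finset.sum_congr rfl fun j hj => ?_
        rw [Finset.mem_preimage] at hj
        simp only [c, dif_pos hj]
        rfl
      rw [h1, Finset.sum_preimage (Sigma.mk r) _ _ fun x => f x • e x]
      · exact hf
      · intro x hx hxr
        rcases Finset.mem_insert.1 hx with rfl | hx
        · exact absurd ⟨j₀, rfl⟩ hxr
        by_contra hne
        have hfx : f x ≠ 0 := fun h0 => hne (by rw [h0, zero_smul])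
        have := hslope x hx hfx
        obtain ⟨r', j⟩ := x
        simp only at this
        subst this
        exact hxr ⟨j, rfl⟩
    have := linearIndependent_iff'.1 (hb r) t c hsum j₀
      (Finset.mem_preimage.2 (Finset.mem_insert_self _ _))
    simp only [c, Finset.mem_insert_self, dif_pos] at this
    have h1 := congrArg Subtype.val this
    simp only [hf1] at h1
    exact one_ne_zero h1

end Iterate

section Pull
variable {p : ℕ} [hp : Fact p.Prime] {k : Type*} [Field k] [CharP k p] [PerfectRing k p]
variable {N : Type*} [AddCommGroup N] [Module (LField p k) N] (Φ : N ≃ₛₗ[sigmaHom p k] N)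

/-- The norm `x ↦ α (Φ x)`. -/
noncomputable def frobPull (α : VNorm (LField p k) (absL p k) N) : VNorm (LField p k) (absL p k) N :=
  VNorm.push (τ := sigmaInvHom p k) (τ' := sigmaHom p k) (fun a => by
    rw [← absL_sigmaHom, RingHomInvPair.comp_apply_eq₂]) Φ.symm α

theorem frobPull_apply (α : VNorm (LField p k) (absL p k) N) (x : N) : frobPull Φ α x = α (Φ x) :=
  rfl

theorem frobAct_apply (α : VNorm (LField p k) (absL p k) N) (x : N) :
    frobAct Φ α x = α (Φ.symm x) := rfl

theorem frobPull_iterate_apply (α : VNorm (LField p k) (absL p k) N) (n : ℕ) (x : N) :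
    (frobPull Φ)^[n] α x = α (Φ^[n] x) := by
  induction n generalizing x with
  | zero => rfl
  | succ n ih => rw [Function.iterate_succ_apply', frobPull_apply, ih, Function.iterate_succ_apply]

theorem frobAct_iterate_apply (α : VNorm (LField p k) (absL p k) N) (n : ℕ) (x : N) :
    (frobAct Φ)^[n] α (Φ^[n] x) = α x := by
  induction n with
  | zero => rfl
  | succ n ih =>
    rw [Function.iterate_succ_apply', frobAct_apply, Function.iterate_succ_apply' Φ,
      LinearEquiv.symm_apply_apply, ih]

/-- The subspace of vectors on which a family of norms, rescaled by the constants `c i`, is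
bounded. -/
def boundedSubspace {I : Type*} (γ : I → VNorm (LField p k) (absL p k) N) (c : I → ℝ≥0) :
    Submodule (LField p k) N where
  carrier := {x | ∃ C, ∀ i, c i * γ i x ≤ C}
  add_mem' := by
    rintro x y ⟨C, hC⟩ ⟨D, hD⟩
    refine ⟨max C D, fun i => ?_⟩
    calc c i * γ i (x + y) ≤ c i * max (γ i x) (γ i y) := by gcongr; exact (γ i).add_le _ _
      _ = max (c i * γ i x) (c i * γ i y) := mul_max _ _ _
      _ ≤ _ := max_le_max (hC i) (hD i)
  zero_mem' := ⟨0, fun i => by rw [(γ i).map_zero, mul_zero]⟩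
  smul_mem' := by
    rintro a x ⟨C, hC⟩
    refine ⟨absL p k a * C, fun i => ?_⟩
    rw [(γ i).map_smul, mul_left_comm]
    gcongr
    exact hC i

theorem nonpos_of_zpow_bounded {e : ℤ} {C : ℝ≥0} (h : ∀ n : ℕ, (p : ℝ≥0) ^ (e * n) ≤ C) : e ≤ 0 := by
  by_contra! he
  obtain ⟨n, hn⟩ := pow_unbounded_of_one_lt C (one_lt_p_nnreal (p := p))
  refine absurd ((hn.trans_le ?_).trans_le (h n)) (lt_irrefl _)
  rw [← zpow_natCast]
  refine zpow_le_zpow_right₀ one_lt_p_nnreal.le ?_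
  nlinarith

theorem exists_vnorm [FiniteDimensional (LField p k) N] :
    Nonempty (VNorm (LField p k) (absL p k) N) :=
  ⟨VNorm.ofBasis isCompleteDiscrete_absL (Module.finBasis (LField p k) N) (fun _ => 1)
    fun _ => one_ne_zero⟩

/-- A nonzero eigenvector in an isoclinic sub-isocrystal of slope `r` has slope `r`: any norm is
bounded on the lattice `M`, so the growth of the norm along the forward and the backward orbits of
`Φ` is that prescribed by `r`. -/
theorem eq_of_isIsoclinic [FiniteDimensional (LField p k) N] {r : ℚ} {P : Submodule (LField p k) N}
    (hP : IsIsoclinic Φ r P) {y : N} (hy : y ∈ P) (hy0 : y ≠ 0) {h : ℕ} {d : ℤ}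
    (hyd : Φ^[h] y = (p : LField p k) ^ d • y) : (d : ℚ) = r * h := by
  have hp0 := p_ne_zero_L (p := p) (k := k)
  have hL := isCompleteDiscrete_absL (p := p) (k := k)
  have hpp : (p : ℝ≥0) ≠ 0 := (one_pos.trans one_lt_p_nnreal).ne'
  obtain ⟨-, M, ⟨g, hg⟩, hMP, hMΦ⟩ := hP
  obtain ⟨α⟩ := exists_vnorm (p := p) (k := k) (N := N)
  -- the norm is bounded on the lattice `M`
  obtain ⟨C, hC⟩ : ∃ C, ∀ x ∈ M, α x ≤ C := by
    refine ⟨g.sup α, fun x hx => ?_⟩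
    rw [← hg] at hx
    induction hx using Submodule.span_induction with
    | mem x hx => exact Finset.le_sup (f := α) hx
    | zero => rw [α.map_zero]; exact zero_le
    | add x y _ _ hx hy => exact (α.add_le x y).trans (max_le hx hy)
    | smul a x _ hx =>
      obtain ⟨_, w, rfl⟩ := a
      change α (algebraMap (WittVector p k) (LField p k) w • x) ≤ _
      rw [α.map_smul]
      refine (mul_le_mul' (absL_le_one_iff.2 ⟨w, rfl⟩) hx).trans (one_mul _).le
  have hM1 : ∀ (n : ℕ) (x : N), x ∈ M ↔ (p : LField p k) ^ (-r.num * n) • Φ^[r.den * n] x ∈ M := by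
    intro n
    induction n with
    | zero => intro x; simp
    | succ n ih =>
      intro x
      rw [hMΦ, ih, iterate_frob_zpow_smul, smul_smul, ← zpow_add₀ hp0,
        ← Function.iterate_add_apply Φ, mul_add, mul_one]
      congr! 3
      push_cast
      ring
  have hb1 : y ∈ boundedSubspace (fun n : ℕ => (frobPull Φ)^[r.den * n] α)
      fun n => (p : ℝ≥0) ^ (r.num * n) := by
    suffices h1 : P ≤ boundedSubspace (fun n : ℕ => (frobPull Φ)^[r.den * n] α)
      fun n => (p : ℝ≥0) ^ (r.num * n) from h1 hy
    rw [← hMP, Submodule.span_le]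
    refine fun x hx => ⟨C, fun n => ?_⟩
    have h1 := hC _ ((hM1 n x).1 hx)
    rwa [α.map_smul, absL_p_zpow, neg_mul, neg_neg, ← frobPull_iterate_apply] at h1
  have hb2 : y ∈ boundedSubspace (fun n : ℕ => (frobAct Φ)^[r.den * n] α)
      fun n => (p : ℝ≥0) ^ (-r.num * n) := by
    suffices h1 : P ≤ boundedSubspace (fun n : ℕ => (frobAct Φ)^[r.den * n] α)
      fun n => (p : ℝ≥0) ^ (-r.num * n) from h1 hy
    rw [← hMP, Submodule.span_le]
    refine fun x hx => ⟨C, fun n => ?_⟩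
    obtain ⟨z, rfl⟩ := iterate_frob_surjective Φ (r.den * n) x
    have h0 : (p : LField p k) ^ (r.num * n) • z ∈ M := by
      rw [hM1 n, iterate_frob_zpow_smul, smul_smul, ← zpow_add₀ hp0]
      simpa using hx
    have h1 := hC _ h0
    rwa [α.map_smul, absL_p_zpow, ← neg_mul, ← frobAct_iterate_apply Φ α (r.den * n)] at h1
  obtain ⟨C1, hC1⟩ := hb1
  obtain ⟨C2, hC2⟩ := hb2
  have hyn : ∀ n : ℕ, Φ^[r.den * (h * n)] y = (p : LField p k) ^ (d * (r.den * n)) • y := by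
    intro n
    rw [mul_left_comm, iterate_frob_eigenvector Φ hyd]
    push_cast
    rfl
  have hαy := α.pos hy0
  have e1 : r.num * h - d * r.den ≤ 0 := by
    refine nonpos_of_zpow_bounded (p := p) (C := C1 / α y) fun n => ?_
    rw [le_div_iff₀ hαy]
    have := hC1 (h * n)
    rw [frobPull_iterate_apply, hyn, α.map_smul, absL_p_zpow, ← mul_assoc, ← zpow_add₀ hpp] at this
    convert this using 3
    push_cast
    ring
  have e2 : d * r.den - r.num * h ≤ 0 := by
    refine nonpos_of_zpow_bounded (p := p) (C := C2 / α y) fun n => ?_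
    rw [le_div_iff₀ hαy]
    have := hC2 (h * n)
    have h3 : α y = (p : ℝ≥0) ^ (-(d * (r.den * n))) * (frobAct Φ)^[r.den * (h * n)] α y := by
      rw [← absL_p_zpow (p := p) (k := k), ← VNorm.map_smul, ← hyn, frobAct_iterate_apply]
    have h4 : (frobAct Φ)^[r.den * (h * n)] α y = (p : ℝ≥0) ^ (d * (r.den * n)) * α y := by
      conv_rhs => rw [h3, ← mul_assoc, ← zpow_add₀ hpp, add_neg_cancel, zpow_zero, one_mul]
    rw [h4, ← mul_assoc, ← zpow_add₀ hpp] at this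
    convert this using 3
    push_cast
    ring
  have e3 : d * r.den = r.num * h := by omega
  have e4 : (d : ℚ) * r.den = r.num * h := by exact_mod_cast e3
  rw [← Rat.mul_den_eq_num r] at e4
  have : (r.den : ℚ) ≠ 0 := by exact_mod_cast r.den_nz
  refine mul_right_cancel₀ this (e4.trans (by ring))

end Pull

section DieudonneManin
variable {p : ℕ} [hp : Fact p.Prime] {k : Type*} [Field k] [CharP k p] [IsAlgClosed k]
variable {N : Type*} [AddCommGroup N] [Module (LField p k) N]
  (Φ : N ≃ₛₗ[sigmaHom p k] N)

/-- The vectors `x` with `Φ^h x = p^d x` for some `h > 0` and `d`. -/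
def frobEigenvectors : Set N :=
  {x | ∃ (h : ℕ) (d : ℤ), 0 < h ∧ Φ^[h] x = (p : LField p k) ^ d • x}

theorem frob_mem_frobEigenvectors {x : N} (hx : x ∈ frobEigenvectors Φ) (n : ℕ) :
    Φ^[n] x ∈ frobEigenvectors Φ := by
  obtain ⟨h, d, hh, hx⟩ := hx
  refine ⟨h, d, hh, ?_⟩
  rw [← Function.iterate_add_apply, add_comm, Function.iterate_add_apply, hx, iterate_frob_zpow_smul]

theorem span_frobEigenvectors_stable (x : N) :
    Φ x ∈ Submodule.span (LField p k) (frobEigenvectors Φ) ↔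
      x ∈ Submodule.span (LField p k) (frobEigenvectors Φ) := by
  refine stable_of_le_comap Φ ?_ ?_ x
  · suffices h : Submodule.span (LField p k) (frobEigenvectors Φ) ≤
      (Submodule.span (LField p k) (frobEigenvectors Φ)).comap (Φ : N →ₛₗ[sigmaHom p k] N) from
      fun x hx => h hx
    rw [Submodule.span_le]
    exact fun x hx => Submodule.subset_span (frob_mem_frobEigenvectors Φ hx 1)
  · suffices h : Submodule.span (LField p k) (frobEigenvectors Φ) ≤
      (Submodule.span (LField p k) (frobEigenvectors Φ)).comap (Φ.symm : N →ₛₗ[sigmaInvHom p k] N) from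
      fun x hx => h hx
    rw [Submodule.span_le]
    rintro x ⟨h, d, hh, hx⟩
    refine Submodule.subset_span ⟨h, d, hh, Φ.injective ?_⟩
    change Φ (Φ^[h] (Φ.symm x)) = Φ (_ • Φ.symm x)
    rw [← Function.iterate_succ_apply' Φ, Function.iterate_succ_apply, LinearEquiv.map_smulₛₗ,
      LinearEquiv.apply_symm_apply, sigma_zpow, hx]

/-- `Φ^h - p^d` is surjective on the span of the eigenvectors. For an eigenvector `x` with `Φ^h₀ x
= p^d₀ x`, the vector `Φ^(h h₀) (c x) - p^(d h₀) c x` is divisible by `Φ^h - p^d`, and it is a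
multiple of `x` that can be prescribed by the choice of `c`. -/
theorem exists_frob_sub_eq {h : ℕ} (hh : 0 < h) (d : ℤ) {u : N}
    (hu : u ∈ Submodule.span (LField p k) (frobEigenvectors Φ)) :
    ∃ z ∈ Submodule.span (LField p k) (frobEigenvectors Φ),
      Φ^[h] z - (p : LField p k) ^ d • z = u := by
  have hp0 := p_ne_zero_L (p := p) (k := k)
  suffices H : ∀ b : LField p k, ∃ z ∈ Submodule.span (LField p k) (frobEigenvectors Φ),
      Φ^[h] z - (p : LField p k) ^ d • z = b • u by
    obtain ⟨z, hz, hzu⟩ := H 1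
    exact ⟨z, hz, by rwa [one_smul] at hzu⟩
  induction hu using Submodule.span_induction with
  | zero => exact fun b => ⟨0, zero_mem _, by rw [iterate_map_zero, smul_zero, smul_zero, sub_zero]⟩
  | add x y _ _ hx hy =>
    intro b
    obtain ⟨z, hz, hzu⟩ := hx b
    obtain ⟨z', hz', hzu'⟩ := hy b
    exact ⟨z + z', add_mem hz hz', by rw [iterate_frob_add, smul_add, smul_add, ← hzu, ← hzu']; abel⟩
  | smul a x _ hx =>
    intro b
    rw [smul_smul]
    exact hx _
  | mem x hx =>
    intro b
    obtain ⟨h₀, d₀, hh₀, hx₀⟩ := id hx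
    obtain ⟨c, hc⟩ := exists_zpow_mul_sigma_sub_eq (p := p) (k := k) (Nat.mul_pos hh₀ hh)
      (d₀ * h - d * h₀) ((p : LField p k) ^ (-d) * b)
    -- the sum of the `f i` is `(Φ^(h h₀) - p^(d h₀)) / (Φ^h - p^d)`, up to a power of `p`, applied
    -- to `c x`
    let f : ℕ → N := fun i => (p : LField p k) ^ (-(d * i)) • Φ^[h * i] (c • x)
    refine ⟨∑ i ∈ Finset.range h₀, f i, sum_mem fun i _ => Submodule.smul_mem _ _ ?_, ?_⟩
    · rw [iterate_frob_smul]
      exact Submodule.smul_mem _ _ (Submodule.subset_span (frob_mem_frobEigenvectors Φ hx _))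
    · have h1 : ∀ i, Φ^[h] (f i) = (p : LField p k) ^ d • f (i + 1) := by
        intro i
        simp only [f]
        rw [iterate_frob_zpow_smul, ← Function.iterate_add_apply, smul_smul, ← zpow_add₀ hp0,
          mul_add, mul_one, add_comm h]
        congr 2
        push_cast
        ring
      rw [iterate_frob_sum, Finset.sum_congr rfl fun i _ => h1 i, ← Finset.smul_sum, ← smul_sub,
        ← Finset.sum_sub_distrib, Finset.sum_range_sub]
      simp only [f]
      have h2 : Φ^[h * h₀] (c • x) =
          ((sigmaHom p k)^[h₀ * h] c * (p : LField p k) ^ (d₀ * h)) • x := by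
        rw [iterate_frob_smul, mul_comm h, iterate_frob_eigenvector Φ hx₀, smul_smul]
      rw [h2]
      simp only [Nat.cast_zero, mul_zero, neg_zero, zpow_zero, one_smul, Function.iterate_zero, id]
      rw [smul_smul, ← sub_smul, smul_smul]
      congr 1
      have h3 : (p : LField p k) ^ d * ((p : LField p k) ^ (-d) * b) = b := by
        rw [← mul_assoc, ← zpow_add₀ hp0, add_neg_cancel, zpow_zero, one_mul]
      rw [← h3, ← hc, sub_eq_add_neg (d₀ * (h : ℤ)), zpow_add₀ hp0]
      ring

variable [FiniteDimensional (LField p k) N]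

/-- The eigenvectors of powers of `Φ` span `N`: otherwise an eigenvector of the quotient by their
span lifts to `N`, and the lift can be corrected to an eigenvector by `exists_frob_sub_eq`. -/
theorem span_frobEigenvectors : Submodule.span (LField p k) (frobEigenvectors Φ) = ⊤ := by
  by_contra hne
  set S := Submodule.span (LField p k) (frobEigenvectors Φ) with hS
  have hst : ∀ x, Φ x ∈ S ↔ x ∈ S := span_frobEigenvectors_stable Φ
  have : Nontrivial (N ⧸ S) := Submodule.Quotient.nontrivial_iff.2 hne
  let T : (N ⧸ S) →ₛₗ[sigmaHom p k] (N ⧸ S) := S.mapQ S (Φ : N →ₛₗ[sigmaHom p k] N)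
    fun x hx => (hst x).2 hx
  have hT : ∀ x, T (S.mkQ x) = S.mkQ (Φ x) := fun x => rfl
  have hTb : Function.Bijective T := by
    constructor
    · rw [injective_iff_map_eq_zero]
      intro y hy
      obtain ⟨x, rfl⟩ := S.mkQ_surjective y
      rw [hT, Submodule.mkQ_apply, Submodule.Quotient.mk_eq_zero, hst] at hy
      rwa [Submodule.mkQ_apply, Submodule.Quotient.mk_eq_zero]
    · intro y
      obtain ⟨x, rfl⟩ := S.mkQ_surjective y
      exact ⟨S.mkQ (Φ.symm x), by rw [hT, LinearEquiv.apply_symm_apply]⟩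
  let Ψ : (N ⧸ S) ≃ₛₗ[sigmaHom p k] (N ⧸ S) := LinearEquiv.ofBijective T hTb
  have hΨ : ∀ n x, Ψ^[n] (S.mkQ x) = S.mkQ (Φ^[n] x) := by
    intro n x
    induction n with
    | zero => rfl
    | succ n ih => rw [Function.iterate_succ_apply', ih, Function.iterate_succ_apply']; rfl
  obtain ⟨w, hw0, h, d, hh, hw⟩ := exists_frob_eigenvector Ψ
  obtain ⟨y, rfl⟩ := S.mkQ_surjective w
  rw [hΨ, ← map_smul, ← sub_eq_zero, ← map_sub, Submodule.mkQ_apply,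
    Submodule.Quotient.mk_eq_zero] at hw
  obtain ⟨z, hz, hzu⟩ := exists_frob_sub_eq Φ hh d hw
  apply hw0
  rw [Submodule.mkQ_apply, Submodule.Quotient.mk_eq_zero]
  have : y - z ∈ S := by
    refine Submodule.subset_span ⟨h, d, hh, ?_⟩
    rw [sub_eq_add_neg, iterate_frob_add, iterate_map_neg, smul_add, smul_neg]
    rw [sub_eq_iff_eq_add] at hzu
    rw [hzu]
    abel
  simpa using add_mem this hz

/-- Vectors satisfying `Φ^h x = p^d x`, with `d / h` not necessarily in lowest terms, are linear
combinations of vectors satisfying the equation in lowest terms. -/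
theorem mem_span_slopeFix {w : N} {h : ℕ} {d : ℤ} {r : ℚ} (hh : 0 < h)
    (hw : Φ^[h] w = (p : LField p k) ^ d • w) (hr : (d : ℚ) = r * h) :
    w ∈ Submodule.span (LField p k) (slopeFix Φ r : Set N) := by
  have hp0 := p_ne_zero_L (p := p) (k := k)
  have e1 : d * r.den = r.num * h := by
    have : (d : ℚ) * r.den = r.num * h := by rw [hr, ← Rat.mul_den_eq_num r]; ring
    exact_mod_cast this
  obtain ⟨m, hm⟩ : r.den ∣ h := by
    have h1 : (r.den : ℤ) ∣ r.num * h := ⟨d, by rw [← e1]; ring⟩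
    have h2 : IsCoprime (r.den : ℤ) r.num := by
      rw [Int.isCoprime_iff_gcd_eq_one, Int.gcd_comm]
      exact r.reduced
    exact_mod_cast h2.dvd_of_dvd_mul_left h1
  have hd : d = r.num * m := by
    have : (r.den : ℤ) ≠ 0 := by exact_mod_cast r.den_nz
    refine mul_right_cancel₀ this ?_
    rw [e1, hm]; push_cast; ring
  have hm0 : 0 < m := Nat.pos_of_mul_pos_left (hm ▸ hh)
  by_contra hnot
  obtain ⟨f, hfw, hf⟩ := Submodule.exists_le_ker_of_notMem hnot
  -- averages of `w` by elements of the field fixed by `σ^h`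
  let ψ : ℕ → N := fun i => (p : LField p k) ^ (-(r.num * i)) • Φ^[r.den * i] w
  have hψm : ψ m = w := by
    simp only [ψ]
    rw [← hm, hw, hd, smul_smul, ← zpow_add₀ hp0, neg_add_cancel, zpow_zero, one_smul]
  have hψ0 : ψ 0 = w := by simp [ψ]
  have hψs : ∀ i, Φ^[r.den] (ψ i) = (p : LField p k) ^ r.num • ψ (i + 1) := by
    intro i
    simp only [ψ]
    rw [iterate_frob_zpow_smul, ← Function.iterate_add_apply, smul_smul, ← zpow_add₀ hp0,
      mul_add, mul_one, add_comm r.den]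
    congr 2
    push_cast
    ring
  let F : Subfield (LField p k) := RingHom.eqLocusField ((sigmaHom p k) ^ h) (RingHom.id _)
  have hF : ∀ c : F, (sigmaHom p k)^[h] c = c := fun c => by
    rw [← RingHom.coe_pow]; exact c.2
  have havg : ∀ c : F, ∑ i ∈ Finset.range m, (sigmaHom p k)^[r.den * i] (c : LField p k) • ψ i ∈
      slopeFix Φ r := by
    intro c
    rw [mem_slopeFix_iff, iterate_frob_sum, Finset.smul_sum]
    have h1 : ∀ i, Φ^[r.den] ((sigmaHom p k)^[r.den * i] (c : LField p k) • ψ i) =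
        (p : LField p k) ^ r.num • ((sigmaHom p k)^[r.den * (i + 1)] (c : LField p k) • ψ (i + 1)) := by
      intro i
      rw [iterate_frob_smul, hψs, ← Function.iterate_add_apply, mul_add, mul_one, add_comm r.den,
        smul_comm]
    rw [Finset.sum_congr rfl fun i _ => h1 i, ← Finset.smul_sum, ← Finset.smul_sum]
    congr 1
    have h2 := Finset.sum_range_succ (fun i => (sigmaHom p k)^[r.den * i] (c : LField p k) • ψ i) m
    rw [Finset.sum_range_succ'] at h2
    simp only [← hm, hψm, hF, mul_zero, hψ0, Function.iterate_zero, id] at h2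
    exact add_right_cancel h2
  -- a linear form `f` vanishing on the averages gives a relation between the powers of `σ` on `F`,
  -- which are independent characters
  let χ : Fin m → (F →* LField p k) := fun i =>
    (((sigmaHom p k) ^ (r.den * i.val)).comp F.subtype).toMonoidHom
  have hχ : ∀ i c, χ i c = (sigmaHom p k)^[r.den * i.val] (c : LField p k) := fun i c => by
    rw [← RingHom.coe_pow]; rfl
  have hχinj : Function.Injective χ := by
    obtain ⟨c, hc1, hc2⟩ := exists_sigma_order (p := p) (k := k) hh
    have hcF : c ∈ F := by
      change ((sigmaHom p k) ^ h) c = c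
      rw [RingHom.coe_pow]; exact hc1
    have key : ∀ i j : Fin m, i < j → χ i ≠ χ j := by
      intro i j hij hχij
      have h1 := DFunLike.congr_fun hχij ⟨c, hcF⟩
      rw [hχ, hχ] at h1
      have hij' : i.val < j.val := hij
      obtain ⟨t, ht⟩ : ∃ t, j.val = i.val + t := ⟨j.val - i.val, by omega⟩
      rw [ht, mul_add, Function.iterate_add_apply] at h1
      refine hc2 (r.den * t) (Nat.mul_pos r.pos (by omega)) ?_ (iterate_sigma_injective _ h1).symm
      rw [hm]
      exact Nat.mul_lt_mul_of_pos_left (by have := j.2; omega) r.pos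
    intro i j hij
    rcases lt_trichotomy i j with h1 | h1 | h1
    · exact absurd hij (key i j h1)
    · exact h1
    · exact absurd hij.symm (key j i h1)
  have hlin := (linearIndependent_monoidHom F (LField p k)).comp χ hχinj
  rw [Fintype.linearIndependent_iff] at hlin
  have h0 := hlin (fun i => f (ψ i)) (by
    funext c
    have h1 := hf (Submodule.subset_span (havg c))
    rw [LinearMap.mem_ker, map_sum] at h1
    rw [Finset.sum_apply, ← Fin.sum_univ_eq_sum_range
      (fun i => f ((sigmaHom p k)^[r.den * i] (c : LField p k) • ψ i))] at *
    rw [Pi.zero_apply, ← h1]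
    refine Finset.sum_congr rfl fun i _ => ?_
    rw [map_smul f _ (ψ i.val), smul_eq_mul, Pi.smul_apply, smul_eq_mul, mul_comm, ← hχ]
    rfl) ⟨0, hm0⟩
  exact hfw (by simpa [hψ0] using h0)

/-- The slope decomposition: the vectors `x` satisfying `Φ^h x = p^d x` in lowest terms span. -/
theorem iSup_span_slopeFix :
    ⨆ r : ℚ, Submodule.span (LField p k) (slopeFix Φ r : Set N) = ⊤ := by
  rw [eq_top_iff, ← span_frobEigenvectors Φ, Submodule.span_le]
  rintro x ⟨h, d, hh, hx⟩
  refine Submodule.mem_iSup_of_mem ((d : ℚ) / h) (mem_span_slopeFix Φ hh hx ?_)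
  field_simp

/-- The space `N_r⁰` spans `N_r`. For `⊇`, each isoclinic sub-isocrystal is spanned by
eigenvectors, whose slope is `r` by `eq_of_isIsoclinic`. -/
theorem span_slopeFix (r : ℚ) :
    Submodule.span (LField p k) (slopeFix Φ r : Set N) = slopePart Φ r := by
  refine le_antisymm (Submodule.span_le.2 fun x hx => hx.1) (sSup_le fun P hP => ?_)
  intro x hx
  have h1 : (⟨x, hx⟩ : P) ∈ Submodule.span (LField p k) (frobEigenvectors (restrictFrob Φ P hP.1)) := by
    rw [span_frobEigenvectors]; trivial
  have h2 : Submodule.span (LField p k) (frobEigenvectors (restrictFrob Φ P hP.1)) ≤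
      (Submodule.span (LField p k) (slopeFix Φ r : Set N)).comap P.subtype := by
    rw [Submodule.span_le]
    rintro y ⟨h, d, hh, hy⟩
    have hy' := congrArg Subtype.val hy
    rw [coe_restrictFrob_iterate] at hy'
    by_cases hy0 : (y : N) = 0
    · change (y : N) ∈ Submodule.span (LField p k) (slopeFix Φ r : Set N)
      rw [hy0]
      exact zero_mem _
    · exact mem_span_slopeFix Φ hh hy' (eq_of_isIsoclinic Φ hP y.2 hy0 hy')
  exact h2 h1

end DieudonneManin

section SlopeBases
variable {p : ℕ} [hp : Fact p.Prime] {k : Type*} [Field k] [CharP k p] [IsAlgClosed k]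
variable {N : Type*} [AddCommGroup N] [Module (LField p k) N]
  (Φ : N ≃ₛₗ[sigmaHom p k] N)

theorem linearIndependent_coe_slopeFix {r : ℚ} {ι : Type*} {b : ι → slopeFix Φ r}
    (hb : LinearIndependent (fixedField p k r) b) :
    LinearIndependent (LField p k) fun i => (b i : N) := by
  -- the family `b` in slope `r`, and empty families in the other slopes
  have h1 := linearIndependent_of_slopeFix Φ (ι := fun r' => {_i : ι // r = r'})
    (fun r' i => ⟨(b i.1 : N), i.2 ▸ (b i.1).2⟩) (fun r' => by
      by_cases h : r = r'
      · subst h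
        exact hb.comp (fun i : {_i : ι // r = r} => i.1) Subtype.val_injective
      · have : IsEmpty {_i : ι // r = r'} := ⟨fun i => h i.2⟩
        exact linearIndependent_empty_type)
  refine h1.comp (fun i => ⟨r, i, rfl⟩) fun i j hij => ?_
  simpa using hij

variable [FiniteDimensional (LField p k) N]

/-- The slope decomposition of Dieudonné and Manin. -/
theorem isInternal_slopePart : DirectSum.IsInternal fun r : ℚ => slopePart Φ r := by
  rw [DirectSum.isInternal_submodule_iff_iSupIndep_and_iSup_eq_top]
  have htop := iSup_span_slopeFix Φ
  simp only [span_slopeFix] at htop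
  refine ⟨?_, htop⟩
  let b := fun r => Module.Basis.ofVectorSpace (fixedField p k r) (slopeFix Φ r)
  have hb := linearIndependent_of_slopeFix Φ (fun r => b r) fun r => (b r).linearIndependent
  have hspan : ∀ r, slopePart Φ r = Submodule.span (LField p k)
      ((fun x : Σ r, Module.Basis.ofVectorSpaceIndex (fixedField p k r) (slopeFix Φ r) =>
        (b x.1 x.2 : N)) '' {x | x.1 = r}) := by
    intro r
    rw [← span_slopeFix]
    apply le_antisymm
    · rw [Submodule.span_le]
      intro x hx
      have h1 := (b r).linearCombination_repr ⟨x, hx⟩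
      rw [← show ((⟨x, hx⟩ : slopeFix Φ r) : N) = x from rfl, ← h1, Finsupp.linearCombination_apply,
        Finsupp.sum, Submodule.coe_sum]
      refine sum_mem fun i _ => ?_
      exact Submodule.smul_mem _ (((b r).repr ⟨x, hx⟩ i : fixedField p k r) : LField p k)
        (Submodule.subset_span ⟨⟨r, i⟩, rfl, rfl⟩)
    · rw [Submodule.span_le]
      rintro _ ⟨⟨r', i⟩, hr, rfl⟩
      change r' = r at hr
      subst hr
      exact Submodule.subset_span (b _ i).2
  intro r
  refine (hb.disjoint_span_image (s := {x | x.1 = r}) (t := {x | x.1 ≠ r}) ?_).mono (hspan r).le ?_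
  · rw [Set.disjoint_left]
    exact fun x h1 h2 => h2 h1
  · refine iSup₂_le fun r' hr' => ?_
    refine (hspan r').le.trans (Submodule.span_mono (Set.image_mono ?_))
    rintro x rfl
    exact hr'

/-- A `K(r)`-basis of `N_r⁰` is an `L`-basis of `N_r`. -/
noncomputable def slopePartBasis {r : ℚ} {ι : Type*}
    (b : Module.Basis ι (fixedField p k r) (slopeFix Φ r)) :
    Module.Basis ι (LField p k) (slopePart Φ r) :=
  Module.Basis.mk (v := fun i => (⟨b i, (b i).2.1⟩ : slopePart Φ r))
    (LinearIndependent.of_comp (slopePart Φ r).subtype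
      (linearIndependent_coe_slopeFix Φ b.linearIndependent)) (by
    rintro ⟨x, hx⟩ -
    have h1 : x ∈ (Submodule.span (LField p k)
        (Set.range fun i => (⟨b i, (b i).2.1⟩ : slopePart Φ r))).map (slopePart Φ r).subtype := by
      rw [← span_slopeFix] at hx
      refine Submodule.span_le.2 ?_ hx
      intro y hy
      have h1 := b.linearCombination_repr ⟨y, hy⟩
      rw [← show ((⟨y, hy⟩ : slopeFix Φ r) : N) = y from rfl, ← h1, Finsupp.linearCombination_apply,
        Finsupp.sum, Submodule.coe_sum]
      refine sum_mem fun i _ => ?_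
      exact Submodule.smul_mem _ ((b.repr ⟨y, hy⟩ i : fixedField p k r) : LField p k)
        (Submodule.mem_map_of_mem (f := (slopePart Φ r).subtype)
          (Submodule.subset_span (Set.mem_range_self i)))
    obtain ⟨y, hy, rfl⟩ := h1
    exact hy)

theorem coe_slopePartBasis {r : ℚ} {ι : Type*}
    (b : Module.Basis ι (fixedField p k r) (slopeFix Φ r)) (i : ι) :
    (slopePartBasis Φ b i : N) = b i := by
  rw [slopePartBasis, Module.Basis.mk_apply]

end SlopeBases

/-! ### The division algebra `D(r)` -/

/-- If one term of a sum has larger norm than the others, its norm is the norm of the sum. -/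
theorem VNorm.sum_eq_of_lt {E : Type*} [Field E] {q : ℝ≥0} {abs : E → ℝ≥0} {X : Type*}
    [AddCommGroup X] [Module E X] (h : IsCompleteDiscrete q abs) (α : VNorm E abs X)
    {ι : Type*} {s : Finset ι} {f : ι → X} {i₀ : ι} (hi₀ : i₀ ∈ s)
    (hlt : ∀ i ∈ s, i ≠ i₀ → α (f i) < α (f i₀)) : α (∑ i ∈ s, f i) = α (f i₀) := by
  classical
  rw [← Finset.add_sum_erase s f hi₀]
  rcases (s.erase i₀).eq_empty_or_nonempty with he | hne
  · rw [he, Finset.sum_empty, add_zero]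
  refine α.add_eq_of_lt h ?_
  obtain ⟨i₁, hi₁, hmax⟩ := Finset.exists_max_image _ (fun i => α (f i)) hne
  refine (α.sum_le _ _ hmax).trans_lt ?_
  exact hlt _ (Finset.mem_of_mem_erase hi₁) (Finset.ne_of_mem_erase hi₁)

section Algebra
variable {p : ℕ} [hp : Fact p.Prime] {k : Type*} [Field k] [CharP k p] [PerfectRing k p]

variable (p) in
/-- The absolute value `p^{-r}` of `π_r`. -/
noncomputable def piAbs (r : ℚ) : ℝ≥0 := (p : ℝ≥0) ^ (-(r : ℝ))

theorem piAbs_pos (r : ℚ) : 0 < piAbs p r := NNReal.rpow_pos (one_pos.trans one_lt_p_nnreal)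

theorem piAbs_zpow (r : ℚ) (n : ℤ) : piAbs p r ^ n = (p : ℝ≥0) ^ (-(r : ℝ) * n) := by
  rw [piAbs, NNReal.rpow_mul, NNReal.rpow_intCast]

theorem piAbs_pow_den (r : ℚ) : piAbs p r ^ r.den = (p : ℝ≥0) ^ (-r.num) := by
  rw [← zpow_natCast, piAbs_zpow, ← NNReal.rpow_intCast]
  congr 1
  have : (r : ℝ) * r.den = r.num := by exact_mod_cast Rat.mul_den_eq_num r
  push_cast
  rw [← this]
  ring

/-- The powers of `|π_r|` with exponents incongruent modulo the denominator of `r` lie in different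
cosets of the value group of `L`. -/
theorem eq_of_piAbs_pow_eq {r : ℚ} {i j : Fin r.den} {a b : ℤ}
    (h : (p : ℝ≥0) ^ a * piAbs p r ^ i.val = (p : ℝ≥0) ^ b * piAbs p r ^ j.val) : i = j := by
  have hp1 := one_lt_p_nnreal (p := p)
  have hp0 := (one_pos.trans hp1)
  rw [← zpow_natCast, ← zpow_natCast, piAbs_zpow, piAbs_zpow, ← NNReal.rpow_intCast,
    ← NNReal.rpow_intCast, ← NNReal.rpow_add hp0.ne', ← NNReal.rpow_add hp0.ne'] at h
  have h1 := (NNReal.rpow_right_inj hp0.ne' hp1.ne').1 h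
  push_cast at h1
  have h2 : (a : ℚ) - b = r * (i.val - j.val) := by
    have : ((a : ℝ) - b) = r * (i.val - j.val) := by linarith
    exact_mod_cast this
  have h3 : (a - b) * r.den = r.num * (i.val - j.val : ℤ) := by
    have : ((a : ℚ) - b) * r.den = r.num * (i.val - j.val) := by
      rw [h2, ← Rat.mul_den_eq_num r]; ring
    exact_mod_cast this
  have h4 : (r.den : ℤ) ∣ (i.val - j.val : ℤ) := by
    have h5 : IsCoprime (r.den : ℤ) r.num := by
      rw [Int.isCoprime_iff_gcd_eq_one, Int.gcd_comm]
      exact r.reduced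
    exact h5.dvd_of_dvd_mul_left ⟨a - b, by rw [← h3]; ring⟩
  have h6 := Int.eq_zero_of_abs_lt_dvd h4 (by
    rw [abs_lt]
    have := i.2
    have := j.2
    constructor <;> omega)
  exact Fin.ext (by omega)

/-- The commutation rule of `D(r)`, read off the rows of a matrix. -/
theorem row_succ_of_comm {r : ℚ} {y : Matrix (Fin r.den) (Fin r.den) (LField p k)}
    (hy : piMat p k r * y = (sigmaHom p k).mapMatrix y * piMat p k r)
    (i : ℕ) (hi : i + 1 < r.den) (j : Fin r.den) :
    y ⟨i + 1, hi⟩ j = ∑ l, sigmaHom p k (y ⟨i, by omega⟩ l) * piMat p k r l j := by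
  rw [← piMat_mul_apply_succ r y ⟨i, by omega⟩ j ⟨i + 1, hi⟩ rfl, hy, Matrix.mul_apply]
  rfl

/-- Matrices satisfying the commutation rule of `D(r)` are determined by their first row. -/
theorem eq_of_row_zero {r : ℚ} {y z : Matrix (Fin r.den) (Fin r.den) (LField p k)}
    (hy : piMat p k r * y = (sigmaHom p k).mapMatrix y * piMat p k r)
    (hz : piMat p k r * z = (sigmaHom p k).mapMatrix z * piMat p k r)
    (h0 : y 0 = z 0) : y = z := by
  have key : ∀ (n : ℕ) (hn : n < r.den), y ⟨n, hn⟩ = z ⟨n, hn⟩ := by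
    intro n
    induction n with
    | zero => exact fun _ => h0
    | succ n ih =>
      intro hn
      funext j
      rw [row_succ_of_comm hy, row_succ_of_comm hz, ih]
  ext i j
  exact congrFun (key i.val i.2) j

theorem slopePi_pow_row (r : ℚ) (n : ℕ) (hn : n < r.den) (j : Fin r.den) :
    (piMat p k r ^ n) 0 j = if n = j.val then 1 else 0 := by
  induction n generalizing j with
  | zero =>
    rw [pow_zero, Matrix.one_apply]
    simp [Fin.ext_iff]
  | succ n ih =>
    rw [pow_succ, Matrix.mul_apply, Finset.sum_eq_single ⟨n, by omega⟩]
    · rw [ih (by omega), if_pos rfl, one_mul]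
      have : n + 1 ≠ r.den := hn.ne
      simp [piMat, this]
    · intro l _ hl
      rw [ih (by omega), if_neg, zero_mul]
      exact fun h => hl (Fin.ext h.symm)
    · simp

/-- The element `∑ cⱼ π_r^j` of `D(r)`. -/
noncomputable def rowElem (r : ℚ) (c : Fin r.den → fixedField p k r) : slopeAlg p k r :=
  ∑ j, slopeIncl p k r (c j) * slopePi p k r ^ j.val

theorem rowElem_row {r : ℚ} (c : Fin r.den → fixedField p k r) (l : Fin r.den) :
    (rowElem r c).1 0 l = c l := by
  have h1 : (rowElem r c).1 = ∑ j, inclMat p k r (c j) * piMat p k r ^ j.val := by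
    rw [rowElem, AddSubmonoidClass.coe_finsetSum]
    rfl
  rw [h1, Matrix.sum_apply, Finset.sum_eq_single l]
  · rw [inclMat, Matrix.diagonal_mul, slopePi_pow_row r _ l.2, if_pos rfl, mul_one]
    rfl
  · intro j _ hj
    rw [inclMat, Matrix.diagonal_mul, slopePi_pow_row r _ j.2, if_neg, mul_zero]
    exact fun h => hj (Fin.ext h)
  · simp

/-- `D(r)` consists of the matrices with entries in `K(r)` that satisfy the commutation rule. -/
theorem mem_slopeAlg_iff {r : ℚ} {y : Matrix (Fin r.den) (Fin r.den) (LField p k)} :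
    y ∈ slopeAlg p k r ↔ (∀ i j, y i j ∈ fixedField p k r) ∧
      piMat p k r * y = (sigmaHom p k).mapMatrix y * piMat p k r := by
  refine ⟨slopeAlg_spec r, fun hy => ?_⟩
  have hz : y = (rowElem r fun j => ⟨y 0 j, hy.1 0 j⟩).1 :=
    eq_of_row_zero hy.2 (slopeAlg_spec r (Subtype.prop _)).2
      (funext fun l => (rowElem_row (fun j => ⟨y 0 j, hy.1 0 j⟩) l).symm)
  rw [hz]
  exact Subtype.prop _

theorem exists_eq_rowElem {r : ℚ} (y : slopeAlg p k r) : ∃ c, y = rowElem r c :=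
  ⟨fun j => ⟨y.1 0 j, (slopeAlg_spec r y.2).1 0 j⟩, Subtype.ext
    (eq_of_row_zero (slopeAlg_spec r y.2).2 (slopeAlg_spec r (Subtype.prop _)).2
      (funext fun l => (rowElem_row (fun j => ⟨y.1 0 j, (slopeAlg_spec r y.2).1 0 j⟩) l).symm))⟩

theorem rowElem_smul {N : Type*} [AddCommGroup N] [Module (LField p k) N]
    {Φ : N ≃ₛₗ[sigmaHom p k] N} {r : ℚ} (c : Fin r.den → fixedField p k r) (x : slopeFix Φ r) :
    rowElem r c • x = ∑ j, c j • (slopePi p k r ^ j.val • x) := by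
  rw [rowElem, Finset.sum_smul]
  exact Finset.sum_congr rfl fun j _ => by rw [mul_smul, slopeIncl_smul]

/-- The rescaled absolute values of the entries of an element of `D(r)` are constant along the
cyclic diagonals. -/
theorem absL_entry_mul {r : ℚ} {y : Matrix (Fin r.den) (Fin r.den) (LField p k)}
    (hy : piMat p k r * y = (sigmaHom p k).mapMatrix y * piMat p k r) (i j : Fin r.den) :
    absL p k (y i j) * piAbs p r ^ j.val =
      piAbs p r ^ i.val * (absL p k (y 0 (j - i)) * piAbs p r ^ (j - i).val) := by
  have hρ := piAbs_pos (p := p) r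
  have key : ∀ (n : ℕ) (hn : n < r.den) (j : Fin r.den),
      absL p k (y ⟨n, hn⟩ j) * piAbs p r ^ j.val =
      piAbs p r ^ n * (absL p k (y 0 (j - ⟨n, hn⟩)) * piAbs p r ^ (j - ⟨n, hn⟩).val) := by
    intro n
    induction n with
    | zero =>
      intro hn j
      have : (⟨0, hn⟩ : Fin r.den) = 0 := rfl
      rw [this, sub_zero, pow_zero, one_mul]
    | succ n ih =>
      intro hn j
      have hj1 : (1 : Fin r.den).val = 1 := by
        rw [Fin.val_one']; exact Nat.mod_eq_of_lt (by omega)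
      have e1 : j - ⟨n + 1, hn⟩ = (j - 1) - ⟨n, by omega⟩ := by
        have : (⟨n + 1, hn⟩ : Fin r.den) = 1 + ⟨n, by omega⟩ := by
          apply Fin.ext
          rw [Fin.val_add, hj1]
          change n + 1 = (1 + n) % r.den
          rw [Nat.mod_eq_of_lt (by omega), add_comm]
        rw [this, sub_sub]
      have e2 : absL p k (y ⟨n + 1, hn⟩ j) * piAbs p r ^ j.val =
          piAbs p r * (absL p k (y ⟨n, by omega⟩ (j - 1)) * piAbs p r ^ (j - 1).val) := by
        rw [row_succ_of_comm hy, Finset.sum_eq_single (j - 1)]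
        · by_cases hj : j.val = 0
          · have hj0 : j = 0 := Fin.ext hj
            have hv : (j - 1).val + 1 = r.den := by
              subst hj0
              rw [Fin.sub_def]
              simp only [hj1, Fin.val_zero]
              rw [Nat.mod_eq_of_lt (by omega)]
              omega
            have h1 : (j - 1).val + 1 ≠ j.val := by omega
            have h2 : piMat p k r (j - 1) j = (p : LField p k) ^ r.num := by
              rw [piMat, Matrix.of_apply, if_neg h1, if_pos ⟨hv, hj⟩]
            rw [h2, absL_mul, absL_sigmaHom, absL_p_zpow, ← piAbs_pow_den, hj, pow_zero, mul_one,
              show piAbs p r ^ r.den = piAbs p r ^ ((j - 1).val + 1) by rw [hv], pow_succ]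
            ring
          · have hv : (j - 1).val + 1 = j.val := by
              rw [Fin.sub_def]
              simp only [hj1]
              rw [show r.den - 1 + j.val = (j.val - 1) + r.den by omega, Nat.add_mod_right,
                Nat.mod_eq_of_lt (by have := j.2; omega)]
              omega
            have h2 : piMat p k r (j - 1) j = 1 := by
              rw [piMat, Matrix.of_apply, if_pos hv]
            rw [h2, mul_one, absL_sigmaHom, ← hv, pow_succ]
            ring
        · intro l _ hl
          have h2 : piMat p k r l j = 0 := by
            rw [piMat, Matrix.of_apply, if_neg, if_neg]
            · rintro ⟨h3, h4⟩
              apply hl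
              rw [eq_sub_iff_add_eq]
              apply Fin.ext
              rw [Fin.val_add, hj1, h3, Nat.mod_self, h4]
            · intro h3
              apply hl
              rw [eq_sub_iff_add_eq]
              apply Fin.ext
              rw [Fin.val_add, hj1, h3, Nat.mod_eq_of_lt j.2]
          rw [h2, mul_zero]
        · simp
      rw [e2, ih, e1, pow_succ]
      ring
  exact key i.val i.2 j

/-- The norm `max |aⱼ| |π_r|^j` of the element `∑ aⱼ π_r^j`. -/
noncomputable def rowNorm (r : ℚ) (y : Matrix (Fin r.den) (Fin r.den) (LField p k)) : ℝ≥0 :=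
  Finset.univ.sup fun j => absL p k (y 0 j) * piAbs p r ^ j.val

theorem entry_inj {r : ℚ} {a b : LField p k} {i j : Fin r.den} (ha : a ≠ 0) (hb : b ≠ 0)
    (h : absL p k a * piAbs p r ^ i.val = absL p k b * piAbs p r ^ j.val) : i = j := by
  obtain ⟨m, hm⟩ := isCompleteDiscrete_absL.exists_zpow a ha
  obtain ⟨n, hn⟩ := isCompleteDiscrete_absL.exists_zpow b hb
  rw [hm, hn] at h
  exact eq_of_piAbs_pow_eq h

/-- The maximum defining `rowNorm` is attained at a single place. -/
theorem exists_rowNorm_eq {r : ℚ} {y : Matrix (Fin r.den) (Fin r.den) (LField p k)} (hy : y 0 ≠ 0) :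
    ∃ j₀, 0 < rowNorm r y ∧ rowNorm r y = absL p k (y 0 j₀) * piAbs p r ^ j₀.val ∧
      ∀ j, j ≠ j₀ → absL p k (y 0 j) * piAbs p r ^ j.val < rowNorm r y := by
  have hL := isCompleteDiscrete_absL (p := p) (k := k)
  have hρ := piAbs_pos (p := p) r
  obtain ⟨j₀, -, hj₀⟩ := Finset.exists_mem_eq_sup Finset.univ Finset.univ_nonempty
    fun j : Fin r.den => absL p k (y 0 j) * piAbs p r ^ j.val
  have hle : ∀ j, absL p k (y 0 j) * piAbs p r ^ j.val ≤ rowNorm r y := fun j =>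
    Finset.le_sup (f := fun j : Fin r.den => absL p k (y 0 j) * piAbs p r ^ j.val) (Finset.mem_univ j)
  have hpos : 0 < rowNorm r y := by
    obtain ⟨j, hj⟩ := Function.ne_iff.1 hy
    exact (mul_pos (pos_iff_ne_zero.2 (hL.ne_zero hj)) (pow_pos hρ _)).trans_le (hle j)
  have hne : ∀ j, absL p k (y 0 j) * piAbs p r ^ j.val = rowNorm r y → y 0 j ≠ 0 := by
    intro j hj h0
    rw [h0, absL_zero, zero_mul] at hj
    exact hpos.ne hj
  refine ⟨j₀, hpos, hj₀, fun j hj => lt_of_le_of_ne (hle j) fun h => hj ?_⟩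
  exact entry_inj (hne j h) (hne j₀ hj₀.symm) (h.trans hj₀)

/-- The determinant of an element of `D(r)` is dominated by the term belonging to the cyclic
permutation that shifts by the place at which `rowNorm` is attained. -/
theorem absL_det {r : ℚ} {y : Matrix (Fin r.den) (Fin r.den) (LField p k)}
    (hy : piMat p k r * y = (sigmaHom p k).mapMatrix y * piMat p k r) (hy0 : y 0 ≠ 0) :
    absL p k y.det = rowNorm r y ^ r.den := by
  have hL := isCompleteDiscrete_absL (p := p) (k := k)
  have hρ := piAbs_pos (p := p) r
  obtain ⟨j₀, hpos, hj₀, hlt⟩ := exists_rowNorm_eq hy0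
  let v : Fin r.den → ℝ≥0 := fun j => absL p k (y 0 j) * piAbs p r ^ j.val
  have hv : ∀ j, v j ≤ rowNorm r y := fun j =>
    Finset.le_sup (f := fun j : Fin r.den => absL p k (y 0 j) * piAbs p r ^ j.val) (Finset.mem_univ j)
  have hterm : ∀ s : Equiv.Perm (Fin r.den),
      hL.selfNorm (Equiv.Perm.sign s • ∏ i, y (s i) i) = ∏ i, v (i - s i) := by
    intro s
    have h1 : hL.selfNorm (Equiv.Perm.sign s • ∏ i, y (s i) i) = ∏ i, absL p k (y (s i) i) := by
      rw [← hL.prod]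
      rcases Int.units_eq_one_or (Equiv.Perm.sign s) with hs | hs
      · rw [hs, one_smul]; rfl
      · rw [hs, Units.neg_smul, one_smul]; exact hL.neg _
    rw [h1]
    have h2 : ∏ i, (absL p k (y (s i) i) * piAbs p r ^ i.val) =
        ∏ i, (piAbs p r ^ (s i).val * v (i - s i)) :=
      Finset.prod_congr rfl fun i _ => absL_entry_mul hy _ _
    rw [Finset.prod_mul_distrib, Finset.prod_mul_distrib,
      Equiv.prod_comp s fun i => piAbs p r ^ i.val, mul_comm] at h2
    exact mul_left_cancel₀ (Finset.prod_pos fun i _ => pow_pos hρ _).ne' h2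
  have hs₀ : hL.selfNorm (Equiv.Perm.sign (Equiv.subRight j₀) • ∏ i, y (Equiv.subRight j₀ i) i) =
      rowNorm r y ^ r.den := by
    rw [hterm]
    simp only [Equiv.subRight_apply, sub_sub_cancel]
    rw [Finset.prod_const, Finset.card_univ, Fintype.card_fin, hj₀]
  rw [Matrix.det_apply]
  refine (hL.selfNorm.sum_eq_of_lt hL (Finset.mem_univ (Equiv.subRight j₀)) ?_).trans hs₀
  intro s _ hs
  rw [hs₀, hterm]
  obtain ⟨i, hi⟩ : ∃ i, i - s i ≠ j₀ := by
    by_contra! h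
    refine hs (Equiv.ext fun i => ?_)
    rw [Equiv.subRight_apply, ← h i, sub_sub_cancel]
  have h1 : rowNorm r y ^ r.den = ∏ _i : Fin r.den, rowNorm r y := by simp
  rw [h1]
  by_cases hz : ∃ l, v (l - s l) = 0
  · obtain ⟨l, hl⟩ := hz
    rw [Finset.prod_eq_zero (Finset.mem_univ l) hl]
    exact Finset.prod_pos fun _ _ => hpos
  · push Not at hz
    exact Finset.prod_lt_prod (fun l _ => pos_iff_ne_zero.2 (hz l)) (fun l _ => hv _)
      ⟨i, Finset.mem_univ _, hlt _ hi⟩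

theorem row_zero_ne_zero {r : ℚ} {x : slopeAlg p k r} (hx : x ≠ 0) : x.1 0 ≠ 0 := by
  intro h
  exact hx (Subtype.ext (eq_of_row_zero (slopeAlg_spec r x.2).2 (slopeAlg_spec r (zero_mem _)).2 h))

theorem det_ne_zero {r : ℚ} {x : slopeAlg p k r} (hx : x ≠ 0) : x.1.det ≠ 0 := by
  intro h
  have h0 := row_zero_ne_zero hx
  obtain ⟨-, hpos, -⟩ := exists_rowNorm_eq h0
  have := absL_det (slopeAlg_spec r x.2).2 h0
  rw [h, absL_zero] at this
  exact (pow_pos hpos _).ne this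

theorem absD_eq_rowNorm {r : ℚ} (x : slopeAlg p k r) : absD p k r x = rowNorm r x.1 := by
  have hden : (r.den : ℝ) ≠ 0 := by exact_mod_cast r.den_nz
  rcases eq_or_ne x 0 with rfl | hx
  · have h1 : rowNorm r ((0 : slopeAlg p k r) : Matrix (Fin r.den) (Fin r.den) (LField p k)) = 0 := by
      refine le_antisymm (Finset.sup_le fun j _ => ?_) zero_le
      rw [ZeroMemClass.coe_zero, Matrix.zero_apply, absL_zero, zero_mul]
    rw [h1, absD, ZeroMemClass.coe_zero, Matrix.det_zero, absL_zero, NNReal.zero_rpow]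
    exact (one_div_ne_zero hden)
  · rw [absD, absL_det (slopeAlg_spec r x.2).2 (row_zero_ne_zero hx), ← NNReal.rpow_natCast,
      ← NNReal.rpow_mul, mul_one_div_cancel hden, NNReal.rpow_one]

/-- `D(r)` is a division algebra: the determinant of a nonzero element is not zero, and the
conditions describing `D(r)` pass to the inverse matrix. -/
theorem isUnit_of_ne_zero {r : ℚ} {x : slopeAlg p k r} (hx : x ≠ 0) : IsUnit x := by
  have hdet : IsUnit x.1.det := isUnit_iff_ne_zero.2 (det_ne_zero hx)
  obtain ⟨h1, h2⟩ := slopeAlg_spec r x.2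
  have hmem : x.1⁻¹ ∈ slopeAlg p k r := by
    rw [mem_slopeAlg_iff]
    constructor
    · have h3 : ((sigmaHom p k) ^ r.den).mapMatrix x.1 = x.1 := by
        ext i j
        exact h1 i j
      have h4 : ((sigmaHom p k) ^ r.den).mapMatrix x.1⁻¹ = x.1⁻¹ := by
        refine (Matrix.inv_eq_left_inv ?_).symm
        conv_lhs =>
          congr
          · skip
          · rw [← h3]
        rw [← map_mul, Matrix.nonsing_inv_mul _ hdet, map_one]
      intro i j
      exact congrFun (congrFun h4 i) j
    · have h3 : (sigmaHom p k).mapMatrix x.1⁻¹ * (sigmaHom p k).mapMatrix x.1 = 1 := by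
        rw [← map_mul, Matrix.nonsing_inv_mul _ hdet, map_one]
      calc piMat p k r * x.1⁻¹ = (sigmaHom p k).mapMatrix x.1⁻¹ *
            ((sigmaHom p k).mapMatrix x.1 * piMat p k r) * x.1⁻¹ := by
            rw [← mul_assoc, h3, one_mul]
        _ = (sigmaHom p k).mapMatrix x.1⁻¹ * piMat p k r * (x.1 * x.1⁻¹) := by
            rw [← h2]; simp only [mul_assoc]
        _ = _ := by rw [Matrix.mul_nonsing_inv _ hdet, mul_one]
  exact ⟨⟨x, ⟨x.1⁻¹, hmem⟩, Subtype.ext (Matrix.mul_nonsing_inv _ hdet),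
    Subtype.ext (Matrix.nonsing_inv_mul _ hdet)⟩, rfl⟩

theorem slopePi_ne_zero (r : ℚ) : slopePi p k r ≠ 0 := by
  intro h
  have h1 := slopePi_pow (p := p) (k := k) r
  rw [h, ZeroMemClass.coe_zero, zero_pow r.den_nz] at h1
  have h2 := congrFun (congrFun h1 0) 0
  rw [Matrix.zero_apply, Matrix.scalar_apply, Matrix.diagonal_apply_eq] at h2
  exact zpow_ne_zero _ p_ne_zero_L h2.symm

theorem absD_slopePi (r : ℚ) : absD p k r (slopePi p k r) = piAbs p r := by
  have hL := isCompleteDiscrete_absL (p := p) (k := k)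
  have hden : (r.den : ℝ) ≠ 0 := by exact_mod_cast r.den_nz
  have h1 := congrArg (fun m => absL p k (Matrix.det m)) (slopePi_pow (p := p) (k := k) r)
  simp only [Matrix.det_pow, hL.pow] at h1
  rw [Matrix.scalar_apply, Matrix.det_diagonal, Finset.prod_const, Finset.card_univ,
    Fintype.card_fin, hL.pow, absL_p_zpow, ← piAbs_pow_den] at h1
  have h2 := (pow_left_inj₀ zero_le zero_le r.den_nz).1 h1
  rw [absD, h2, ← NNReal.rpow_natCast, ← NNReal.rpow_mul, mul_one_div_cancel hden, NNReal.rpow_one]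

end Algebra

section Center
variable {p : ℕ} [hp : Fact p.Prime] {k : Type*} [Field k] [CharP k p] [IsAlgClosed k]

/-- The centre of `D(r)` is `ℚ_p`. -/
theorem mem_center_slopeAlg_iff {r : ℚ} (x : slopeAlg p k r) :
    x ∈ Subring.center (slopeAlg p k r) ↔
      ∃ a : ℚ_[p], x.1 = Matrix.scalar _ (algebraMap ℚ_[p] (LField p k) a) := by
  rw [Subring.mem_center_iff]
  constructor
  · intro hx
    have hspec := slopeAlg_spec r x.2
    -- commutation with `K(r)` kills all entries of the first row but one
    obtain ⟨c, hc1, hc2⟩ := exists_sigma_order (p := p) (k := k) r.pos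
    have h0 : ∀ j, j ≠ 0 → x.1 0 j = 0 := by
      intro j hj
      have h1 := congrFun (congrFun (congrArg Subtype.val
        (hx (slopeIncl p k r ⟨c, (mem_fixedField r c).2 hc1⟩))) 0) j
      change (inclMat p k r c * x.1) 0 j = (x.1 * inclMat p k r c) 0 j at h1
      rw [inclMat, Matrix.diagonal_mul, Matrix.mul_diagonal, mul_comm] at h1
      by_contra hne
      have h2 := mul_left_cancel₀ hne h1
      exact hc2 j.val (Nat.pos_of_ne_zero fun h => hj (Fin.ext h)) j.2 h2.symm
    -- commutation with `π_r` makes the remaining entry `σ`-invariant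
    have h1 := congrArg Subtype.val (hx (slopePi p k r))
    change piMat p k r * x.1 = x.1 * piMat p k r at h1
    rw [hspec.2] at h1
    have hdet : IsUnit (piMat p k r) := by
      rw [Matrix.isUnit_iff_isUnit_det]
      exact isUnit_iff_ne_zero.2 (det_ne_zero (slopePi_ne_zero r))
    have h2 := hdet.mul_right_cancel h1
    obtain ⟨a, ha⟩ := exists_qp_of_sigma_eq (p := p) (k := k) (congrFun (congrFun h2 0) 0)
    refine ⟨a, eq_of_row_zero hspec.2 ?_ ?_⟩
    · have h3 : (sigmaHom p k).mapMatrix (Matrix.scalar (Fin r.den)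
          (algebraMap ℚ_[p] (LField p k) a)) = Matrix.scalar _ (algebraMap ℚ_[p] (LField p k) a) := by
        rw [Matrix.scalar_apply, RingHom.mapMatrix_apply, Matrix.diagonal_map (map_zero _)]
        congr 1
        funext i
        exact sigma_qp p k a
      rw [h3]
      exact (Matrix.scalar_commute _ (fun _ => Commute.all _ _) _).symm
    · funext j
      rw [Matrix.scalar_apply, Matrix.diagonal_apply, ha]
      split_ifs with hj
      · rw [← hj]
      · exact h0 j (Ne.symm hj)
  · rintro ⟨a, ha⟩ y
    apply Subtype.ext
    change y.1 * x.1 = x.1 * y.1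
    rw [ha]
    exact (Matrix.scalar_commute _ (fun _ => Commute.all _ _) _).symm

end Center

/-! ### Norms of the isoclinic parts -/

namespace VNorm
variable {A : Type*} [Ring A] {abs : A → ℝ≥0} {X : Type*} [AddCommGroup X] [Module A X]

/-- The multiple of a norm by a positive constant. -/
def scale (C : ℝ≥0) (hC : C ≠ 0) (α : VNorm A abs X) : VNorm A abs X where
  toFun x := C * α x
  eq_zero_iff' x := by rw [mul_eq_zero, α.eq_zero_iff, or_iff_right hC]
  add_le_max' x y := by rw [← mul_max]; gcongr; exact α.add_le x y
  smul' a x := by rw [α.map_smul]; ring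

/-- The supremum of a nonempty finite family of norms. -/
def supNorm {ι : Type*} [Fintype ι] [Nonempty ι] (α : ι → VNorm A abs X) : VNorm A abs X where
  toFun x := Finset.univ.sup fun i => α i x
  eq_zero_iff' x := by
    constructor
    · intro h
      obtain ⟨i⟩ := ‹Nonempty ι›
      have := Finset.le_sup (f := fun i => α i x) (Finset.mem_univ i)
      rw [h, nonpos_iff_eq_zero] at this
      exact (α i).eq_zero_iff.1 this
    · rintro rfl
      exact le_antisymm (Finset.sup_le fun i _ => ((α i).map_zero).le) zero_le
  add_le_max' x y := by
    refine Finset.sup_le fun i _ => ((α i).add_le x y).trans (max_le_max ?_ ?_)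
    · exact Finset.le_sup (f := fun i => α i x) (Finset.mem_univ i)
    · exact Finset.le_sup (f := fun i => α i y) (Finset.mem_univ i)
  smul' a x := by
    rw [NNReal.mul_finset_sup]
    exact Finset.sup_congr rfl fun i _ => (α i).map_smul a x

theorem eq_of_isSplitBy {E : Type*} [Field E] {abs : E → ℝ≥0} {X : Type*} [AddCommGroup X]
    [Module E X] {ι : Type*} {e : Module.Basis ι E X} {α β : VNorm E abs X} (hα : α.IsSplitBy e)
    (hβ : β.IsSplitBy e) (h : ∀ i, α (e i) = β (e i)) : α = β := by
  ext1 x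
  rw [hα x, hβ x]
  exact Finset.sup_congr rfl fun i _ => by rw [h]

end VNorm

section FixedNorms
variable {p : ℕ} [hp : Fact p.Prime] {k : Type*} [Field k] [CharP k p] [PerfectRing k p]
variable {N : Type*} [AddCommGroup N] [Module (LField p k) N]
  {Φ : N ≃ₛₗ[sigmaHom p k] N} {r : ℚ}

theorem coe_slopeFrob_iterate (n : ℕ) (x : slopePart Φ r) :
    (((slopeFrob Φ r)^[n] x : slopePart Φ r) : N) = Φ^[n] x := by
  induction n with
  | zero => rfl
  | succ n ih => rw [Function.iterate_succ_apply', Function.iterate_succ_apply', ← ih]; rfl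

theorem mem_minSlopePow_iff {α : VNorm (LField p k) (absL p k) (slopePart Φ r)} :
    α ∈ minSlopePow Φ r ↔ ∀ x, α ((slopeFrob Φ r)^[r.den] x) = (p : ℝ≥0) ^ (-r.num) * α x := by
  have hpp : (p : ℝ≥0) ≠ 0 := (one_pos.trans one_lt_p_nnreal).ne'
  constructor
  · intro h x
    have h1 := h ((slopeFrob Φ r)^[r.den] x)
    rw [frobAct_iterate_apply] at h1
    rw [h1, ← mul_assoc, ← zpow_add₀ hpp, neg_add_cancel, zpow_zero, one_mul]
  · intro h x
    obtain ⟨y, rfl⟩ := iterate_frob_surjective (slopeFrob Φ r) r.den x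
    rw [frobAct_iterate_apply, h, ← mul_assoc, ← zpow_add₀ hpp, add_neg_cancel, zpow_zero, one_mul]

theorem mem_minSlope_iff {α : VNorm (LField p k) (absL p k) (slopePart Φ r)} :
    α ∈ minSlope Φ r ↔ ∀ x, α (slopeFrob Φ r x) = piAbs p r * α x := by
  have hρ := piAbs_pos (p := p) r
  have h1 : (p : ℝ≥0) ^ (r : ℝ) = (piAbs p r)⁻¹ := by rw [piAbs, NNReal.rpow_neg, inv_inv]
  constructor
  · intro h x
    have h2 := h (slopeFrob Φ r x)
    rw [frobAct_apply, LinearEquiv.symm_apply_apply, h1] at h2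
    rw [h2, mul_inv_cancel_left₀ hρ.ne']
  · intro h x
    have h2 := h ((slopeFrob Φ r).symm x)
    rw [LinearEquiv.apply_symm_apply] at h2
    rw [frobAct_apply, h1, h2, inv_mul_cancel_left₀ hρ.ne']

theorem minSlope_subset_minSlopePow : minSlope Φ r ⊆ minSlopePow Φ r := by
  intro α hα
  rw [mem_minSlope_iff] at hα
  rw [mem_minSlopePow_iff]
  intro x
  have key : ∀ n : ℕ, α ((slopeFrob Φ r)^[n] x) = piAbs p r ^ n * α x := by
    intro n
    induction n with
    | zero => rw [pow_zero, one_mul]; rfl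
    | succ n ih => rw [Function.iterate_succ_apply', hα, ih, pow_succ]; ring
  rw [key, piAbs_pow_den]

/-- Restriction of an `L`-norm of `N_r` to `N_r⁰`. -/
noncomputable def restrictFix (α : VNorm (LField p k) (absL p k) (slopePart Φ r)) :
    VNorm (fixedField p k r) (absK p k r) (slopeFix Φ r) where
  toFun x := α ⟨x, x.2.1⟩
  eq_zero_iff' x := by
    rw [α.eq_zero_iff, Subtype.ext_iff, Subtype.ext_iff]
    rfl
  add_le_max' x y := α.add_le ⟨x, x.2.1⟩ ⟨y, y.2.1⟩
  smul' a x := α.map_smul (a : LField p k) ⟨x, x.2.1⟩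

theorem restrictFix_apply (α : VNorm (LField p k) (absL p k) (slopePart Φ r)) (x : slopeFix Φ r) :
    restrictFix α x = α ⟨x, x.2.1⟩ := rfl

/-- A `K(r)`-norm `β` of `N_r⁰` with `β(π_r x) = |π_r| β(x)` is a `D(r)`-norm: the terms of
`(∑ aⱼ π_r^j) x` have pairwise different norms. -/
theorem map_slopeAlg_smul {β : VNorm (fixedField p k r) (absK p k r) (slopeFix Φ r)}
    (hβ : ∀ x, β (slopePi p k r • x) = absD p k r (slopePi p k r) * β x)
    (y : slopeAlg p k r) (x : slopeFix Φ r) : β (y • x) = absD p k r y * β x := by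
  have hK := isCompleteDiscrete_absK (p := p) (k := k) r
  rcases eq_or_ne y 0 with rfl | hy
  · rw [zero_smul, β.map_zero, absD, ZeroMemClass.coe_zero, Matrix.det_zero, absL_zero,
      NNReal.zero_rpow (one_div_ne_zero (by exact_mod_cast r.den_nz)), zero_mul]
  rcases eq_or_ne x 0 with rfl | hx
  · rw [smul_zero, β.map_zero, mul_zero]
  have hβx := β.pos hx
  have hpow : ∀ n : ℕ, β (slopePi p k r ^ n • x) = piAbs p r ^ n * β x := by
    intro n
    induction n with
    | zero => rw [pow_zero, pow_zero, one_smul, one_mul]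
    | succ n ih => rw [pow_succ', mul_smul, hβ, ih, absD_slopePi, pow_succ]; ring
  obtain ⟨c, rfl⟩ := exists_eq_rowElem y
  have hf : ∀ j, β (c j • (slopePi p k r ^ j.val • x)) =
      absL p k ((rowElem r c).1 0 j) * piAbs p r ^ j.val * β x := by
    intro j
    rw [β.map_smul, hpow, mul_assoc, rowElem_row]
    rfl
  obtain ⟨j₀, -, hj₀, hlt⟩ := exists_rowNorm_eq (row_zero_ne_zero hy)
  rw [rowElem_smul, β.sum_eq_of_lt hK (Finset.mem_univ j₀), hf, ← hj₀, absD_eq_rowNorm]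
  intro j _ hj
  rw [hf, hf, ← hj₀]
  exact mul_lt_mul_of_pos_right (hlt j hj) hβx

theorem exists_slopeAlg_norm_iff (β : VNorm (fixedField p k r) (absK p k r) (slopeFix Φ r)) :
    (∀ x, β (slopePi p k r • x) = absD p k r (slopePi p k r) * β x) ↔
      ∃ γ : VNorm (slopeAlg p k r) (absD p k r) (slopeFix Φ r), ∀ x, γ x = β x := by
  constructor
  · intro h
    exact ⟨⟨β, β.eq_zero_iff', β.add_le_max', map_slopeAlg_smul h⟩, fun _ => rfl⟩
  · rintro ⟨γ, hγ⟩ x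
    rw [← hγ, ← hγ, γ.map_smul]

end FixedNorms

section Bijection
variable {p : ℕ} [hp : Fact p.Prime] {k : Type*} [Field k] [CharP k p] [IsAlgClosed k]
variable {N : Type*} [AddCommGroup N] [Module (LField p k) N] [FiniteDimensional (LField p k) N]
  {Φ : N ≃ₛₗ[sigmaHom p k] N} {r : ℚ}

/-- A shortcut to the `K(r)`-module structure of `N_r⁰`. -/
@[reducible] noncomputable def moduleSlopeFix : Module (fixedField p k r) (slopeFix Φ r) :=
  (slopeFix Φ r).module

attribute [local instance] moduleSlopeFix

theorem finite_index {ι : Type*} (b : Module.Basis ι (fixedField p k r) (slopeFix Φ r)) : Finite ι :=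
  Module.Finite.finite_basis (slopePartBasis Φ b)

instance finiteDimensional_slopeFix : FiniteDimensional (fixedField p k r) (slopeFix Φ r) := by
  have := finite_index (Module.Basis.ofVectorSpace (fixedField p k r) (slopeFix Φ r))
  exact Module.Finite.of_basis (Module.Basis.ofVectorSpace (fixedField p k r) (slopeFix Φ r))

theorem slopeFrob_iterate_sum {ι : Type*} [Fintype ι]
    (e : Module.Basis ι (fixedField p k r) (slopeFix Φ r)) (c : ι → LField p k) :
    (slopeFrob Φ r)^[r.den] (∑ i, c i • slopePartBasis Φ e i) =
      (p : LField p k) ^ r.num • ∑ i, (sigmaHom p k)^[r.den] (c i) • slopePartBasis Φ e i := by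
  rw [iterate_frob_sum, Finset.smul_sum]
  refine Finset.sum_congr rfl fun i _ => ?_
  have h1 : (slopeFrob Φ r)^[r.den] (slopePartBasis Φ e i) =
      (p : LField p k) ^ r.num • slopePartBasis Φ e i := by
    apply Subtype.ext
    rw [coe_slopeFrob_iterate, Submodule.coe_smul, coe_slopePartBasis]
    exact (e i).2.2
  rw [iterate_frob_smul, h1, smul_comm]

/-- If the restriction to `N_r⁰` of a norm in `Min(Φ_r^h)` is split by a `K(r)`-basis, then the norm
itself is split by this basis over `L`. The proof is by induction on the number of nonzero
coordinates of a vector `x`, comparing `x` with `p^{-d} Φ^h x` and with a vector of `N_r⁰` whose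
coordinates approximate those of `x`. -/
theorem orth_slopePartBasis {ι : Type*} [Fintype ι]
    {α : VNorm (LField p k) (absL p k) (slopePart Φ r)} (hα : α ∈ minSlopePow Φ r)
    (e : Module.Basis ι (fixedField p k r) (slopeFix Φ r)) (he : (restrictFix α).Orth e) :
    α.Orth (slopePartBasis Φ e) := by
  classical
  have hp0 := p_ne_zero_L (p := p) (k := k)
  have hpp : (p : ℝ≥0) ≠ 0 := (one_pos.trans one_lt_p_nnreal).ne'
  have hL := isCompleteDiscrete_absL (p := p) (k := k)
  rw [mem_minSlopePow_iff] at hα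
  set E := slopePartBasis Φ e with hE
  have hinv : ∀ c : ι → LField p k, α (∑ i, (sigmaHom p k)^[r.den] (c i) • E i) =
      α (∑ i, c i • E i) := by
    intro c
    have h1 := hα (∑ i, c i • E i)
    rw [slopeFrob_iterate_sum, α.map_smul, absL_p_zpow] at h1
    exact mul_left_cancel₀ (zpow_ne_zero _ hpp) h1
  have hEe : ∀ i, α (E i) = restrictFix α (e i) := by
    intro i
    rw [restrictFix_apply]
    congr 1
    exact Subtype.ext (coe_slopePartBasis Φ e i)
  have hfix : ∀ (c : ι → LField p k) (_ : ∀ i, (sigmaHom p k)^[r.den] (c i) = c i) (i : ι),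
      absL p k (c i) * α (E i) ≤ α (∑ j, c j • E j) := by
    intro c hc i
    have h1 := he (fun j => ⟨c j, (mem_fixedField r _).2 (hc j)⟩) i
    rw [restrictFix_apply] at h1
    rw [hEe]
    refine h1.trans_eq (congrArg α ?_)
    apply Subtype.ext
    simp only [Submodule.coe_sum]
    refine Finset.sum_congr rfl fun j _ => ?_
    change c j • (e j : N) = c j • ((slopePartBasis Φ e j : slopePart Φ r) : N)
    rw [coe_slopePartBasis]
  suffices H : ∀ (n : ℕ) (c : ι → LField p k), (Finset.univ.filter fun j => c j ≠ 0).card = n →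
      ∀ i, absL p k (c i) * α (E i) ≤ α (∑ j, c j • E j) from fun c => H _ c rfl
  intro n
  induction n using Nat.strong_induction_on with
  | _ n ih =>
    intro c hcn i
    by_cases hci : c i = 0
    · rw [hci, absL_zero, zero_mul]; exact zero_le
    -- rescale such that the coordinate `i` is `1`
    let a : ι → LField p k := fun j => (c i)⁻¹ * c j
    have hai : a i = 1 := inv_mul_cancel₀ hci
    suffices h1 : α (E i) ≤ α (∑ j, a j • E j) by
      have h2 : ∑ j, c j • E j = c i • ∑ j, a j • E j := by
        rw [Finset.smul_sum]
        exact Finset.sum_congr rfl fun j _ => by rw [smul_smul, mul_inv_cancel_left₀ hci]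
      rw [h2, α.map_smul]
      gcongr
    have h2 : ∀ j, absL p k ((sigmaHom p k)^[r.den] (a j) - a j) * α (E j) ≤ α (∑ j, a j • E j) := by
      intro j
      refine (ih _ ?_ (fun j => (sigmaHom p k)^[r.den] (a j) - a j) rfl j).trans ?_
      · rw [← hcn]
        refine Finset.card_lt_card (Finset.ssubset_iff_of_subset ?_ |>.2 ⟨i, ?_, ?_⟩)
        · intro l hl
          rw [Finset.mem_filter] at hl ⊢
          refine ⟨Finset.mem_univ _, fun h0 => hl.2 ?_⟩
          simp only [a, h0, mul_zero, iterate_map_zero, sub_self]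
        · simpa using hci
        · simp [hai, iterate_map_one]
      · simp only [sub_smul, Finset.sum_sub_distrib]
        refine (α.sub_le hL _ _).trans (max_le (hinv a).le le_rfl)
    choose c' hc' hcc' using fun j => exists_fixed_approx (p := p) (k := k) r.pos (a j)
    have hc'i : c' i = 1 := by
      have h3 := hcc' i
      rw [hai, iterate_map_one, sub_self, absL_zero, nonpos_iff_eq_zero, hL.eq_zero] at h3
      exact (sub_eq_zero.1 h3).symm
    have h3 := hfix c' hc' i
    rw [hc'i, absL_one, one_mul] at h3
    refine h3.trans ?_
    have h4 : ∑ j, c' j • E j = ∑ j, a j • E j - ∑ j, (a j - c' j) • E j := by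
      rw [← Finset.sum_sub_distrib]
      exact Finset.sum_congr rfl fun j _ => by rw [← sub_smul, sub_sub_cancel]
    rw [h4]
    refine (α.sub_le hL _ _).trans (max_le le_rfl (VNorm.sum_smul_le _ _ _ _ fun j _ => ?_))
    exact (mul_le_mul_left (hcc' j) _).trans (h2 j)

theorem restrictFix_injOn {α α' : VNorm (LField p k) (absL p k) (slopePart Φ r)}
    (hα : α ∈ minSlopePow Φ r) (hα' : α' ∈ minSlopePow Φ r)
    (h : restrictFix α = restrictFix α') : α = α' := by
  have hL := isCompleteDiscrete_absL (p := p) (k := k)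
  have hK := isCompleteDiscrete_absK (p := p) (k := k) r
  obtain ⟨e, he⟩ := VNorm.exists_isSplitBy hK (restrictFix α)
  rw [VNorm.isSplitBy_iff_orth hK] at he
  have h1 := orth_slopePartBasis hα e he
  have h2 := orth_slopePartBasis hα' e (h ▸ he)
  rw [← VNorm.isSplitBy_iff_orth hL] at h1 h2
  refine VNorm.eq_of_isSplitBy h1 h2 fun i => ?_
  have h3 : slopePartBasis Φ e i = ⟨e i, (e i).2.1⟩ := Subtype.ext (coe_slopePartBasis Φ e i)
  rw [h3, ← restrictFix_apply, ← restrictFix_apply, h]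

theorem exists_restrictFix_eq (β : VNorm (fixedField p k r) (absK p k r) (slopeFix Φ r)) :
    ∃ α ∈ minSlopePow Φ r, restrictFix α = β := by
  have hL := isCompleteDiscrete_absL (p := p) (k := k)
  have hK := isCompleteDiscrete_absK (p := p) (k := k) r
  obtain ⟨e, he⟩ := VNorm.exists_isSplitBy hK β
  have he' := (VNorm.isSplitBy_iff_orth hK).1 he
  let E := slopePartBasis Φ e
  let α := VNorm.ofBasis hL E (fun i => β (e i)) fun i => (β.pos (e.ne_zero i)).ne'
  have hα : α.Orth E := VNorm.orth_ofBasis hL E _ _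
  have hαE : ∀ i, α (E i) = β (e i) := VNorm.ofBasis_basis hL E _ _
  have hsum : ∀ c : Fin _ → LField p k, α (∑ i, c i • E i) =
      Finset.univ.sup fun i => absL p k (c i) * β (e i) := by
    intro c
    refine le_antisymm (VNorm.sum_smul_le _ _ _ _ fun i hi => ?_) (Finset.sup_le fun i _ => ?_)
    · rw [hαE]
      exact Finset.le_sup (f := fun i => absL p k (c i) * β (e i)) hi
    · rw [← hαE]
      exact hα c i
  refine ⟨α, ?_, ?_⟩
  · rw [mem_minSlopePow_iff]
    intro x
    rw [← E.sum_repr x, slopeFrob_iterate_sum, α.map_smul, absL_p_zpow, hsum, hsum]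
    simp only [absL_iterate_sigma]
  · ext1 x
    rw [restrictFix_apply, ← e.sum_repr x]
    have h1 : (⟨(∑ i, e.repr x i • e i : slopeFix Φ r), (∑ i, e.repr x i • e i : slopeFix Φ r).2.1⟩ :
        slopePart Φ r) = ∑ i, (e.repr x i : LField p k) • E i := by
      apply Subtype.ext
      simp only [Submodule.coe_sum]
      refine Finset.sum_congr rfl fun i _ => ?_
      change (e.repr x i : LField p k) • (e i : N) =
        (e.repr x i : LField p k) • ((slopePartBasis Φ e i : slopePart Φ r) : N)
      rw [coe_slopePartBasis]
    rw [h1, hsum]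
    refine le_antisymm (Finset.sup_le fun i _ => he' (fun i => e.repr x i) i)
      (VNorm.sum_smul_le _ _ _ _ fun i hi => ?_)
    exact Finset.le_sup (f := fun i => absL p k (e.repr x i : LField p k) * β (e i)) hi

variable (Φ r) in
/-- Restriction to `N_r⁰` as a bijection from `Min(Φ_r^h)` to the set of `K(r)`-norms of `N_r⁰`. -/
noncomputable def minSlopePowEquiv : minSlopePow Φ r ≃
    VNorm (fixedField p k r) (absK p k r) (slopeFix Φ r) :=
  Equiv.ofBijective (fun α => restrictFix α.1)
    ⟨fun α α' h => Subtype.ext (restrictFix_injOn α.2 α'.2 h), fun β => by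
      obtain ⟨α, hα, h⟩ := exists_restrictFix_eq β
      exact ⟨⟨α, hα⟩, h⟩⟩

theorem minSlopePowEquiv_apply (α : minSlopePow Φ r) (x : slopeFix Φ r) :
    minSlopePowEquiv Φ r α x = α.1 ⟨x, x.2.1⟩ := rfl

theorem mem_minSlope_iff_restrictFix {α : VNorm (LField p k) (absL p k) (slopePart Φ r)}
    (hα : α ∈ minSlopePow Φ r) : α ∈ minSlope Φ r ↔
      ∀ x, restrictFix α (slopePi p k r • x) = absD p k r (slopePi p k r) * restrictFix α x := by
  have hρ := piAbs_pos (p := p) r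
  have hfrob : ∀ x : slopeFix Φ r, restrictFix α (slopePi p k r • x) =
      α (slopeFrob Φ r ⟨x, x.2.1⟩) := by
    intro x
    rw [restrictFix_apply]
    congr 1
    exact Subtype.ext (slopePi_smul Φ r x)
  simp only [hfrob, absD_slopePi]
  rw [mem_minSlope_iff]
  refine ⟨fun h x => h _, fun h => ?_⟩
  -- the norm `x ↦ |π_r|⁻¹ α(Φ x)` has the same restriction to `N_r⁰` as `α`
  let α' := (frobPull (slopeFrob Φ r) α).scale (piAbs p r)⁻¹ (inv_ne_zero hρ.ne')
  have hα'x : ∀ x, α' x = (piAbs p r)⁻¹ * α (slopeFrob Φ r x) := fun x => rfl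
  have hα' : α' ∈ minSlopePow Φ r := by
    rw [mem_minSlopePow_iff] at hα ⊢
    intro x
    rw [hα'x, hα'x, ← Function.iterate_succ_apply' (slopeFrob Φ r),
      Function.iterate_succ_apply (slopeFrob Φ r), hα]
    ring
  have h1 : α' = α := by
    refine restrictFix_injOn hα' hα (VNorm.ext fun x => ?_)
    rw [restrictFix_apply, restrictFix_apply, hα'x, h, inv_mul_cancel_left₀ hρ.ne',
      restrictFix_apply]
  intro x
  conv_rhs => rw [← h1, hα'x, mul_inv_cancel_left₀ hρ.ne']

variable (Φ r) in
/-- `Min(Φ_r)` is not empty: `max_{j < h} |π_r|^{-j} α(Φ^j x)` is a point of it for any `α` in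
`Min(Φ_r^h)`. -/
theorem minSlope_nonempty : (minSlope Φ r).Nonempty := by
  have hK := isCompleteDiscrete_absK (p := p) (k := k) r
  have hρ := piAbs_pos (p := p) r
  obtain ⟨α₁, hα₁, -⟩ := exists_restrictFix_eq (Φ := Φ) (r := r)
    (VNorm.ofBasis hK (Module.finBasis (fixedField p k r) (slopeFix Φ r)) (fun _ => 1)
      fun _ => one_ne_zero)
  rw [mem_minSlopePow_iff] at hα₁
  let γ : Fin r.den → VNorm (LField p k) (absL p k) (slopePart Φ r) := fun j =>
    ((frobPull (slopeFrob Φ r))^[j.val] α₁).scale (piAbs p r ^ j.val)⁻¹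
      (inv_ne_zero (pow_ne_zero _ hρ.ne'))
  have hγ : ∀ j x, γ j x = (piAbs p r ^ j.val)⁻¹ * α₁ ((slopeFrob Φ r)^[j.val] x) := by
    intro j x
    rw [← frobPull_iterate_apply]
    rfl
  refine ⟨VNorm.supNorm γ, mem_minSlope_iff.2 fun x => ?_⟩
  have hsup : ∀ x, VNorm.supNorm γ x = Finset.univ.sup fun j => γ j x := fun x => rfl
  have hle : ∀ x j, γ j x ≤ VNorm.supNorm γ x := fun x j =>
    Finset.le_sup (f := fun j => γ j x) (Finset.mem_univ j)
  apply le_antisymm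
  · rw [hsup]
    refine Finset.sup_le fun j _ => ?_
    have h1 : γ j (slopeFrob Φ r x) =
        piAbs p r * ((piAbs p r ^ (j.val + 1))⁻¹ * α₁ ((slopeFrob Φ r)^[j.val + 1] x)) := by
      rw [hγ, Function.iterate_succ_apply, pow_succ]
      field_simp
    rw [h1]
    gcongr
    by_cases hj : j.val + 1 = r.den
    · rw [hj, hα₁, ← piAbs_pow_den, inv_mul_cancel_left₀ (pow_ne_zero _ hρ.ne')]
      have := hle x 0
      rw [hγ, Fin.val_zero, pow_zero, inv_one, one_mul] at this
      exact this
    · have := hle x ⟨j.val + 1, by have := j.2; omega⟩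
      rw [hγ] at this
      exact this
  · rw [hsup x, NNReal.mul_finset_sup]
    refine Finset.sup_le fun j _ => ?_
    by_cases hj : j.val = 0
    · have h1 := hle (slopeFrob Φ r x) ⟨r.den - 1, by have := r.pos; omega⟩
      refine le_trans (le_of_eq ?_) h1
      rw [hγ, hγ, hj]
      simp only [pow_zero, inv_one, one_mul, Function.iterate_zero, id]
      rw [← Function.iterate_succ_apply, Nat.succ_eq_add_one, Nat.sub_add_cancel r.pos, hα₁,
        ← piAbs_pow_den, ← mul_assoc]
      congr 1
      have h2 : piAbs p r ^ r.den = piAbs p r ^ (r.den - 1) * piAbs p r := by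
        rw [← pow_succ, Nat.sub_add_cancel r.pos]
      rw [h2, inv_mul_cancel_left₀ (pow_ne_zero _ hρ.ne')]
    · have h1 := hle (slopeFrob Φ r x) ⟨j.val - 1, by have := j.2; omega⟩
      refine le_trans (le_of_eq ?_) h1
      rw [hγ, hγ]
      simp only
      rw [← Function.iterate_succ_apply, Nat.succ_eq_add_one, Nat.sub_add_cancel (by omega),
        ← mul_assoc]
      congr 1
      have h2 : piAbs p r ^ j.val = piAbs p r ^ (j.val - 1) * piAbs p r := by
        rw [← pow_succ, Nat.sub_add_cancel (by omega)]
      rw [h2]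
      field_simp

end Bijection

/-! ### Norms that decompose along a direct sum -/

namespace VNorm
variable {E : Type*} [Field E] {q : ℝ≥0} {abs : E → ℝ≥0} {X : Type*} [AddCommGroup X] [Module E X]
  {I : Type*} [DecidableEq I] {A : I → Submodule E X}

theorem exists_eq_sum_of_isInternal (hA : DirectSum.IsInternal A) (x : X) :
    ∃ (s : Finset I) (y : I → X), (∀ i, y i ∈ A i) ∧ ∑ i ∈ s, y i = x := by
  have hx : x ∈ iSup A := hA.submodule_iSup_eq_top ▸ Submodule.mem_top
  obtain ⟨f, hf, rfl⟩ := (Submodule.mem_iSup_iff_exists_finsupp A x).1 hx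
  exact ⟨f.support, f, hf, rfl⟩

theorem collectedBasis_repr_sum (hA : DirectSum.IsInternal A) {κ : I → Type*}
    (v : ∀ i, Module.Basis (κ i) E (A i)) (s : Finset I) (y : I → X) (hy : ∀ i, y i ∈ A i)
    (i : I) (a : κ i) :
    (hA.collectedBasis v).repr (∑ j ∈ s, y j) ⟨i, a⟩ =
      if i ∈ s then (v i).repr ⟨y i, hy i⟩ a else 0 := by
  rw [map_sum, Finsupp.finsetSum_apply]
  split_ifs with hi
  · rw [Finset.sum_eq_single i, hA.collectedBasis_repr_of_mem v (hy i)]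
    · exact fun j _ hj => hA.collectedBasis_repr_of_mem_ne v hj (hy j)
    · exact fun h => absurd hi h
  · exact Finset.sum_eq_zero fun j hj =>
      hA.collectedBasis_repr_of_mem_ne v (fun h : j = i => hi (h ▸ hj)) (hy j)

theorem DecomposesAlong.le {α : VNorm E abs X} (hα : α.DecomposesAlong A) {s : Finset I} {y : I → X}
    (hy : ∀ i, y i ∈ A i) {i : I} (hi : i ∈ s) : α (y i) ≤ α (∑ j ∈ s, y j) := by
  rw [hα s y fun i _ => hy i]
  exact Finset.le_sup (f := fun i => α (y i)) hi

/-- A norm is split by the union of bases of the members of a direct sum decomposition if and only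
if it decomposes, with restrictions split by these bases. -/
theorem isSplitBy_collectedBasis_iff (h : IsCompleteDiscrete q abs) (hA : DirectSum.IsInternal A)
    {κ : I → Type*} (v : ∀ i, Module.Basis (κ i) E (A i)) {α : VNorm E abs X} :
    α.IsSplitBy (hA.collectedBasis v) ↔
      α.DecomposesAlong A ∧ ∀ i, (α.restrict (A i)).IsSplitBy (v i) := by
  constructor
  · intro H
    have H' := (isSplitBy_iff h).1 H
    refine ⟨fun s y hy => ?_, fun i => ?_⟩
    · refine le_antisymm (α.sum_le _ _ fun i hi => Finset.le_sup (f := fun i => α (y i)) hi)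
        (Finset.sup_le fun i hi => ?_)
      let y' : I → X := fun i => if i ∈ s then y i else 0
      have hy' : ∀ i, y' i ∈ A i := fun i => by
        simp only [y']
        split_ifs with hi
        · exact hy i hi
        · exact zero_mem _
      have hyy : ∀ i ∈ s, y' i = y i := fun i hi => if_pos hi
      rw [← Finset.sum_congr rfl hyy, ← hyy i hi, H (y' i)]
      refine Finset.sup_le ?_
      rintro ⟨j, a⟩ hja
      rw [Finsupp.mem_support_iff] at hja
      have hji : j = i := by
        by_contra hne
        exact hja (hA.collectedBasis_repr_of_mem_ne v (Ne.symm hne) (hy' i))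
      subst hji
      have h1 := H' (∑ j ∈ s, y' j) ⟨j, a⟩
      rw [collectedBasis_repr_sum hA v s y' hy', if_pos hi] at h1
      rwa [hA.collectedBasis_repr_of_mem v (hy' j)]
    · rw [isSplitBy_iff h]
      intro x a
      have h1 := H' x ⟨i, a⟩
      rwa [hA.collectedBasis_repr_of_mem v x.2, hA.collectedBasis_coe] at h1
  · rintro ⟨hα, hv⟩
    rw [isSplitBy_iff h]
    rintro x ⟨i, a⟩
    obtain ⟨s, y, hy, rfl⟩ := exists_eq_sum_of_isInternal hA x
    rw [collectedBasis_repr_sum hA v s y hy]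
    split_ifs with hi
    · refine le_trans ?_ (hα.le hy hi)
      rw [hA.collectedBasis_coe]
      exact (isSplitBy_iff h).1 (hv i) ⟨y i, hy i⟩ a
    · rw [h.zero, zero_mul]
      exact zero_le

theorem DecomposesAlong.ext (hA : DirectSum.IsInternal A) {α β : VNorm E abs X}
    (hα : α.DecomposesAlong A) (hβ : β.DecomposesAlong A)
    (hαβ : ∀ i, α.restrict (A i) = β.restrict (A i)) : α = β := by
  ext1 x
  obtain ⟨s, y, hy, rfl⟩ := exists_eq_sum_of_isInternal hA x
  rw [hα s y fun i _ => hy i, hβ s y fun i _ => hy i]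
  refine Finset.sup_congr rfl fun i _ => ?_
  exact congrArg (fun γ : VNorm E abs (A i) => γ ⟨y i, hy i⟩) (hαβ i)

variable [FiniteDimensional E X]

/-- Every family of norms on the members of a direct sum decomposition is the family of
restrictions of a norm that decomposes. -/
theorem exists_decomposesAlong (h : IsCompleteDiscrete q abs) (hA : DirectSum.IsInternal A)
    (γ : ∀ i, VNorm E abs (A i)) :
    ∃ α : VNorm E abs X, α.DecomposesAlong A ∧ ∀ i, α.restrict (A i) = γ i := by
  choose v hv using fun i => exists_isSplitBy h (γ i)
  let c := hA.collectedBasis v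
  have := Module.Finite.finite_basis c
  have := Fintype.ofFinite (Σ i, Fin (Module.finrank E (A i)))
  let α := ofBasis h c (fun x => γ x.1 (v x.1 x.2)) fun x => ((γ x.1).pos ((v x.1).ne_zero x.2)).ne'
  have hα : α.IsSplitBy c := (isSplitBy_iff_orth h).2 (orth_ofBasis h c _ _)
  obtain ⟨h1, h2⟩ := (isSplitBy_collectedBasis_iff h hA v).1 hα
  refine ⟨α, h1, fun i => eq_of_isSplitBy (h2 i) (hv i) fun a => ?_⟩
  have h3 : α (c ⟨i, a⟩) = γ i (v i a) := ofBasis_basis h c _ _ _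
  simp only [c] at h3
  rwa [hA.collectedBasis_coe] at h3

theorem bijective_restrict (h : IsCompleteDiscrete q abs) (hA : DirectSum.IsInternal A) :
    Function.Bijective fun (α : {α : VNorm E abs X // α.DecomposesAlong A}) (i : I) =>
      α.1.restrict (A i) := by
  refine ⟨fun α β hαβ => Subtype.ext (α.2.ext hA β.2 fun i => congrFun hαβ i), fun γ => ?_⟩
  obtain ⟨α, hα, hγ⟩ := exists_decomposesAlong h hA γ
  exact ⟨⟨α, hα⟩, funext hγ⟩

end VNorm

/-! ### Invariant quadratic forms -/

section Quadratic

/-- Summation by parts: a sum `∑ wᵢ mᵢ` is nonnegative if the partial sums of the `wᵢ` over the sets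
`{i | rᵢ ≥ r}` are, where `m` is a nonnegative increasing function of `r`. -/
theorem sum_mul_nonneg {ι : Type*} (s : Finset ι) (r : ι → ℚ) (m w : ι → ℝ)
    (hmono : ∀ i ∈ s, ∀ j ∈ s, r i ≤ r j → m i ≤ m j)
    (hw : ∀ i ∈ s, 0 ≤ ∑ j ∈ s with r i ≤ r j, w j) (hm : ∀ i ∈ s, 0 ≤ m i) :
    0 ≤ ∑ i ∈ s, w i * m i := by
  classical
  induction s using Finset.strongInduction generalizing m with
  | H s ih =>
    rcases s.eq_empty_or_nonempty with rfl | hs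
    · simp
    obtain ⟨i₀, hi₀, hmin⟩ := Finset.exists_min_image s r hs
    have h1 : 0 ≤ ∑ j ∈ s, w j := by
      have := hw i₀ hi₀
      rwa [Finset.filter_true_of_mem hmin] at this
    let s' := s.filter fun i => r i₀ < r i
    have hss : s' ⊂ s := Finset.filter_ssubset.2 ⟨i₀, hi₀, lt_irrefl _⟩
    have h2 := ih s' hss (fun i => m i - m i₀)
      (fun i hi j hj hij => sub_le_sub_right (hmono i (hss.1 hi) j (hss.1 hj) hij) _)
      (fun i hi => by
        have h3 := hw i (hss.1 hi)
        rw [Finset.filter_filter]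
        convert h3 using 3
        rename_i j
        have := (Finset.mem_filter.1 hi).2
        exact ⟨fun h => h.2, fun h => ⟨this.trans_le h, h⟩⟩)
      (fun i hi => sub_nonneg.2 (hmono i₀ hi₀ i (hss.1 hi) (Finset.mem_filter.1 hi).2.le))
    have h3 : ∑ i ∈ s', w i * (m i - m i₀) = ∑ i ∈ s, w i * (m i - m i₀) := by
      refine Finset.sum_subset hss.1 fun i hi hi' => ?_
      have h4 : r i ≤ r i₀ := not_lt.1 fun h => hi' (Finset.mem_filter.2 ⟨hi, h⟩)
      rw [le_antisymm (hmono i hi i₀ hi₀ h4) (hmono i₀ hi₀ i hi (hmin i hi)), sub_self, mul_zero]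
    have h4 : ∑ i ∈ s, w i * m i = (∑ i ∈ s, w i) * m i₀ + ∑ i ∈ s, w i * (m i - m i₀) := by
      rw [Finset.sum_mul, ← Finset.sum_add_distrib]
      exact Finset.sum_congr rfl fun i _ => by ring
    rw [h4, ← h3]
    exact add_nonneg (mul_nonneg h1 (hm i₀ hi₀)) h2

variable {n : ℕ} {Q : QuadraticForm ℝ (Fin n → ℝ)}

theorem polar_perm (hQ : ∀ (s : Equiv.Perm (Fin n)) v, Q (v ∘ s) = Q v) (s : Equiv.Perm (Fin n))
    (v w : Fin n → ℝ) : QuadraticMap.polar Q (v ∘ s) (w ∘ s) = QuadraticMap.polar Q v w := by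
  rw [QuadraticMap.polar, QuadraticMap.polar, hQ, hQ, ← hQ s (v + w)]
  rfl

/-- For a form invariant under permutations, the reflection exchanging two coordinates computes
the pairing with the difference of the corresponding basis vectors. -/
theorem polar_single_sub (hQ : ∀ (s : Equiv.Perm (Fin n)) v, Q (v ∘ s) = Q v) (i j : Fin n)
    (v : Fin n → ℝ) :
    QuadraticMap.polar Q (Pi.single j 1 - Pi.single i 1) v =
      (v j - v i) * Q (Pi.single j 1 - Pi.single i 1) := by
  set e : Fin n → ℝ := Pi.single j 1 - Pi.single i 1 with he
  rcases eq_or_ne i j with rfl | hij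
  · rw [he, sub_self, QuadraticMap.polar_zero_left, QuadraticMap.map_zero, mul_zero]
  have h1 : e ∘ Equiv.swap i j = -e := by
    funext l
    simp only [he, Function.comp, Pi.sub_apply, Pi.neg_apply, Pi.single_apply, Equiv.swap_apply_def]
    split_ifs <;> simp_all
  have h2 : v - v ∘ Equiv.swap i j = (v j - v i) • e := by
    funext l
    simp only [he, Function.comp, Pi.sub_apply, Pi.smul_apply, Pi.single_apply, smul_eq_mul,
      Equiv.swap_apply_def]
    split_ifs <;> simp_all
  have h3 := polar_perm hQ (Equiv.swap i j) e v
  rw [h1, QuadraticMap.polar_neg_left] at h3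
  have h4 : QuadraticMap.polar Q e (v - v ∘ Equiv.swap i j) = (v j - v i) * (2 * Q e) := by
    rw [h2, QuadraticMap.polar_smul_right, QuadraticMap.polar_self, smul_eq_mul, nsmul_eq_mul]
    norm_num
  rw [QuadraticMap.polar_sub_right] at h4
  linarith

/-- An invariant quadratic form does not increase if a vector `u` is replaced by a vector `v` whose
coordinates have smaller partial sums, in the order given by `v`, and the same total sum. -/
theorem quadratic_le_of_partial_sums (hpos : Q.PosDef)
    (hQ : ∀ (s : Equiv.Perm (Fin n)) v, Q (v ∘ s) = Q v)
    {u v : Fin n → ℝ} {r : Fin n → ℚ} (hv : ∀ i j, r i ≤ r j → v i ≤ v j)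
    (hsum : ∑ i, u i = ∑ i, v i)
    (hpart : ∀ i, ∑ j with r i ≤ r j, v j ≤ ∑ j with r i ≤ r j, u j) :
    Q v + Q (u - v) ≤ Q u := by
  classical
  let m : Fin n → ℝ := fun i => QuadraticMap.polar Q (Pi.single i 1) v
  have hm : ∀ i j, m j - m i = (v j - v i) * Q (Pi.single j 1 - Pi.single i 1) := by
    intro i j
    rw [← polar_single_sub hQ, QuadraticMap.polar_sub_left]
  have hmono : ∀ i j, r i ≤ r j → m i ≤ m j := by
    intro i j hij
    have h1 := hm i j
    have h2 := mul_nonneg (sub_nonneg.2 (hv i j hij)) (hpos.nonneg (Pi.single j 1 - Pi.single i 1))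
    linarith
  have hpolar : QuadraticMap.polar Q (u - v) v = ∑ i, (u i - v i) * m i := by
    have h1 : u - v = ∑ i, (u i - v i) • (Pi.single i 1 : Fin n → ℝ) := by
      funext j
      simp [Finset.sum_apply, Pi.single_apply]
    conv_lhs => rw [h1]
    rw [← QuadraticMap.polarBilin_apply_apply, map_sum, LinearMap.sum_apply]
    refine Finset.sum_congr rfl fun i _ => ?_
    rw [map_smul, LinearMap.smul_apply, smul_eq_mul, QuadraticMap.polarBilin_apply_apply]
  have hnonneg : 0 ≤ QuadraticMap.polar Q (u - v) v := by
    rw [hpolar]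
    obtain ⟨C, hC⟩ := (Finset.univ.image m).bddBelow
    have h1 := sum_mul_nonneg Finset.univ r (fun i => m i - C) (fun i => u i - v i)
      (fun i _ j _ hij => sub_le_sub_right (hmono i j hij) _)
      (fun i _ => by
        rw [Finset.sum_sub_distrib]
        exact sub_nonneg.2 (hpart i))
      (fun i _ => sub_nonneg.2 (hC (by simp)))
    have h2 : ∑ i, (u i - v i) * (m i - C) = ∑ i, (u i - v i) * m i := by
      simp only [mul_sub, Finset.sum_sub_distrib, ← Finset.sum_mul]
      rw [hsum]
      ring
    rwa [h2] at h1
  have h3 : Q u = Q (u - v) + Q v + QuadraticMap.polar Q (u - v) v := by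
    rw [QuadraticMap.polar, sub_add_cancel]
    ring
  rw [h3]
  linarith

end Quadratic

/-! ### Relative position of a norm and its image under Frobenius -/

theorem sum_eq_of_isLowerSet {n : ℕ} {S : Finset (Fin n)} (hS : ∀ i ∈ S, ∀ j ≤ i, j ∈ S)
    (f : Fin n → ℝ) (hn : S.card ≤ n) : ∑ i ∈ S, f i = ∑ j : Fin S.card, f (Fin.castLE hn j) := by
  have h1 : Finset.univ.map (Fin.castLEEmb hn) = S := by
    refine Finset.eq_of_subset_of_card_le ?_ (by simp)
    intro i hi
    obtain ⟨j, -, rfl⟩ := Finset.mem_map.1 hi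
    by_contra hj
    have h2 : S ⊆ Finset.Iio (Fin.castLEEmb hn j) := by
      intro l hl
      rw [Finset.mem_Iio]
      exact not_le.1 fun h => hj (hS l hl _ h)
    have h3 := Finset.card_le_card h2
    rw [Fin.card_Iio] at h3
    have := j.2
    simp only [Fin.castLEEmb_apply, Fin.val_castLE] at h3
    omega
  conv_lhs => rw [← h1]
  rw [Finset.sum_map]
  rfl

/-- A final segment of `Fin n` contains its `j`-th element counted from its beginning. -/
theorem mem_of_isUpperSet {n : ℕ} {S : Finset (Fin n)} (hS : ∀ i ∈ S, ∀ j, i ≤ j → j ∈ S)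
    (j : Fin S.card) (hj : n - S.card + j.val < n) : (⟨n - S.card + j.val, hj⟩ : Fin n) ∈ S := by
  by_contra hjS
  have h2 : S ⊆ Finset.Ioi (⟨n - S.card + j.val, hj⟩ : Fin n) := by
    intro l hl
    rw [Finset.mem_Ioi]
    exact not_le.1 fun h => hjS (hS l hl _ h)
  have h3 := Finset.card_le_card h2
  rw [Fin.card_Ioi] at h3
  have hcard : S.card ≤ n := by simpa using S.card_le_univ
  have := j.2
  simp only at h3
  omega

theorem sum_eq_of_isUpperSet {n : ℕ} {S : Finset (Fin n)} (hS : ∀ i ∈ S, ∀ j, i ≤ j → j ∈ S)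
    (f : Fin n → ℝ) (hn : ∀ j : Fin S.card, n - S.card + j.val < n) :
    ∑ i ∈ S, f i = ∑ j : Fin S.card, f ⟨n - S.card + j.val, hn j⟩ := by
  let φ : Fin S.card ↪ Fin n := ⟨fun j => ⟨n - S.card + j.val, hn j⟩, fun i j h => by
    simp only [Fin.mk.injEq] at h
    exact Fin.ext (by omega)⟩
  have h1 : Finset.univ.map φ = S := by
    refine Finset.eq_of_subset_of_card_le ?_ (by simp)
    intro i hi
    obtain ⟨j, -, rfl⟩ := Finset.mem_map.1 hi
    exact mem_of_isUpperSet hS j (hn j)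
  conv_lhs => rw [← h1]
  rw [Finset.sum_map]
  rfl

section RelPos
variable {p : ℕ} [hp : Fact p.Prime] {k : Type*} [Field k] [CharP k p] [PerfectRing k p]
variable {N : Type*} [AddCommGroup N] [Module (LField p k) N] (Φ : N ≃ₛₗ[sigmaHom p k] N)

/-- The logarithm of the ratio of the norms `Φ · α` and `α` at a vector. -/
noncomputable def logRatio (α : VNorm (LField p k) (absL p k) N) (x : N) : ℝ :=
  Real.log (frobAct Φ α x) - Real.log (α x)

variable {Φ}

theorem logRatio_eq_log {α : VNorm (LField p k) (absL p k) N} {x : N} (hx : x ≠ 0) :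
    logRatio Φ α x = Real.log ((frobAct Φ α x / α x : ℝ≥0) : ℝ) := by
  rw [NNReal.coe_div, Real.log_div]
  · rfl
  · exact_mod_cast ((frobAct Φ α).pos hx).ne'
  · exact_mod_cast (α.pos hx).ne'

theorem logRatio_le_iff {α β : VNorm (LField p k) (absL p k) N} {x y : N} (hx : x ≠ 0) (hy : y ≠ 0) :
    logRatio Φ α x ≤ logRatio Φ β y ↔ frobAct Φ α x / α x ≤ frobAct Φ β y / β y := by
  rw [logRatio_eq_log hx, logRatio_eq_log hy, Real.log_le_log_iff, NNReal.coe_le_coe]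
  · exact_mod_cast div_pos ((frobAct Φ α).pos hx) (α.pos hx)
  · exact_mod_cast div_pos ((frobAct Φ β).pos hy) (β.pos hy)

theorem logRatio_le_mul_log_iff {α : VNorm (LField p k) (absL p k) N} {x : N} (hx : x ≠ 0) (s : ℝ) :
    logRatio Φ α x ≤ s * Real.log p ↔ frobAct Φ α x ≤ (p : ℝ≥0) ^ s * α x := by
  have hpp : (0 : ℝ) < p := by exact_mod_cast hp.out.pos
  rw [logRatio_eq_log hx, ← Real.log_rpow hpp, Real.log_le_log_iff, ← div_le_iff₀ (α.pos hx),
    ← NNReal.coe_le_coe]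
  · simp
  · exact_mod_cast div_pos ((frobAct Φ α).pos hx) (α.pos hx)
  · exact Real.rpow_pos_of_pos hpp _

theorem logRatio_eq_mul_log_iff {α : VNorm (LField p k) (absL p k) N} {x : N} (hx : x ≠ 0) (s : ℝ) :
    logRatio Φ α x = s * Real.log p ↔ frobAct Φ α x = (p : ℝ≥0) ^ s * α x := by
  have hpp : (0 : ℝ) < p := by exact_mod_cast hp.out.pos
  rw [logRatio_eq_log hx, ← Real.log_rpow hpp, ← div_eq_iff (α.pos hx).ne', ← NNReal.coe_inj]
  refine ⟨fun h => ?_, fun h => by rw [h]; simp⟩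
  have h1 := Real.log_injOn_pos (Set.mem_Ioi.2 (by
    exact_mod_cast div_pos ((frobAct Φ α).pos hx) (α.pos hx)))
    (Set.mem_Ioi.2 (Real.rpow_pos_of_pos hpp s)) h
  rw [h1]
  simp

theorem orth_restrict_iff {α : VNorm (LField p k) (absL p k) N} {W : Submodule (LField p k) N}
    {ι : Type*} [Fintype ι] {v : ι → W} :
    (α.restrict W).Orth v ↔ α.Orth fun i => (v i : N) := by
  have h1 : ∀ c : ι → LField p k, α.restrict W (∑ j, c j • v j) = α (∑ j, c j • (v j : N)) := by
    intro c
    change α ((∑ j, c j • v j : W) : N) = _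
    rw [Submodule.coe_sum]
    rfl
  exact forall₂_congr fun c i => by rw [h1]; rfl

theorem orth_frobAct {α : VNorm (LField p k) (absL p k) N} {ι : Type*} [Fintype ι] {v : ι → N}
    (hv : α.Orth v) : (frobAct Φ α).Orth fun i => Φ (v i) := by
  intro c i
  obtain ⟨c', hc'⟩ : ∃ c' : ι → LField p k, ∀ i, sigmaHom p k (c' i) = c i :=
    ⟨fun i => (sigma p k).symm (c i), fun i => (sigma p k).apply_symm_apply (c i)⟩
  have h1 : ∑ j, c j • Φ (v j) = Φ (∑ j, c' j • v j) := by
    rw [map_sum]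
    exact Finset.sum_congr rfl fun j _ => by rw [LinearEquiv.map_smulₛₗ, hc']
  rw [h1, frobAct_apply, frobAct_apply, LinearEquiv.symm_apply_apply, LinearEquiv.symm_apply_apply,
    ← hc', absL_sigmaHom]
  exact hv c' i

theorem frobAct_restrict (α : VNorm (LField p k) (absL p k) N) {W : Submodule (LField p k) N}
    (hW : ∀ x, Φ x ∈ W ↔ x ∈ W) :
    frobAct (restrictFrob Φ W hW) (α.restrict W) = (frobAct Φ α).restrict W := rfl

/-- The change of volume by Frobenius on a stable subspace, computed with two norms: the sum of the
logarithms of the ratios of `Φ · β` and `β` is independent of the norm `β`. -/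
theorem exists_sorted_orth_stable {ι : Type*} [Fintype ι] (g : Module.Basis ι (LField p k) N)
    {α : VNorm (LField p k) (absL p k) N} (hg : α.Orth g) (hg' : (frobAct Φ α).Orth g)
    (S : Finset ι) (hS : ∀ x, Φ x ∈ Submodule.span (LField p k) (Set.range fun i : S => g i) ↔
      x ∈ Submodule.span (LField p k) (Set.range fun i : S => g i))
    (β : VNorm (LField p k) (absL p k) N) :
    ∃ w : Fin S.card → N, Submodule.span (LField p k) (Set.range w) =
        Submodule.span (LField p k) (Set.range fun i : S => g i) ∧ (∀ j, w j ≠ 0) ∧ β.Orth w ∧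
      (frobAct Φ β).Orth w ∧ (Antitone fun j => frobAct Φ β (w j) / β (w j)) ∧
      ∑ j, logRatio Φ β (w j) = ∑ i ∈ S, logRatio Φ α (g i) := by
  classical
  have hL := isCompleteDiscrete_absL (p := p) (k := k)
  set W := Submodule.span (LField p k) (Set.range fun i : S => g i) with hWdef
  have hli : LinearIndependent (LField p k) fun i : S => g i :=
    g.linearIndependent.comp (fun i : S => i.1) Subtype.val_injective
  let gW : Module.Basis (Fin S.card) (LField p k) W := (Module.Basis.span hli).reindex S.equivFin
  have hgW : ∀ j, (gW j : N) = g (S.equivFin.symm j) := by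
    intro j
    simp only [gW]
    rw [Module.Basis.reindex_apply, Module.Basis.span_apply]
  have hfin : FiniteDimensional (LField p k) W := Module.Finite.of_basis gW
  have hcard : Module.finrank (LField p k) W = S.card := by
    rw [Module.finrank_eq_card_basis gW, Fintype.card_fin]
  let Ψ := restrictFrob Φ W hS
  have horth : ∀ γ : VNorm (LField p k) (absL p k) N, γ.Orth g → (γ.restrict W).Orth gW := by
    intro γ hγ
    rw [orth_restrict_iff]
    simp only [hgW]
    exact hγ.comp (fun j => (S.equivFin.symm j).1)
      (Subtype.val_injective.comp S.equivFin.symm.injective)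
  obtain ⟨w, hw, hw', hanti⟩ := VNorm.exists_sorted_orth hL hcard (β.restrict W)
    (frobAct Ψ (β.restrict W))
  obtain ⟨z, hz, hz', -⟩ := VNorm.exists_sorted_orth hL hcard (β.restrict W) (α.restrict W)
  -- the image of the basis `z` under Frobenius
  have hΨz : ∀ γ : VNorm (LField p k) (absL p k) W, γ.Orth z → (frobAct Ψ γ).Orth fun i => Ψ (z i) :=
    fun γ hγ => orth_frobAct hγ
  have hz0 : ∀ i, Ψ (z i) ≠ 0 := fun i h => z.ne_zero i (Ψ.injective (h.trans (map_zero Ψ).symm))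
  let z' : Module.Basis (Fin S.card) (LField p k) W :=
    basisOfLinearIndependentOfCardEqFinrank' (fun i => Ψ (z i))
      ((hΨz _ hz).linearIndependent hL hz0) (by rw [Fintype.card_fin, hcard])
  have hz'v : ∀ i, z' i = Ψ (z i) := fun i => by simp [z']
  have hz'c : (z' : Fin S.card → W) = fun i => Ψ (z i) := funext hz'v
  have hprod := VNorm.Orth.prod_mul_prod_eq hL (w := w) (g := gW) (z := z) (z' := z') hw hw'
    (horth _ hg) (horth _ hg') hz hz' (hz'c ▸ hΨz _ hz) (hz'c ▸ hΨz _ hz')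
    (fun i => by rw [hz'v, frobAct_apply, LinearEquiv.symm_apply_apply])
    (fun i => by
      rw [hz'v]
      change α.restrict W (Ψ.symm (Ψ (z i))) = _
      rw [LinearEquiv.symm_apply_apply])
  have hw0 : ∀ j, ((w j : W) : N) ≠ 0 := fun j h => w.ne_zero j (Subtype.ext h)
  have hspan : Submodule.span (LField p k) (Set.range fun j => ((w j : W) : N)) = W := by
    have h1 := congrArg (Submodule.map W.subtype) w.span_eq
    rw [Submodule.map_span, Submodule.map_top, Submodule.range_subtype, ← Set.range_comp] at h1
    exact h1
  refine ⟨fun j => (w j : N), hspan, hw0, orth_restrict_iff.1 hw,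
    orth_restrict_iff.1 (frobAct_restrict β hS ▸ hw'), hanti, ?_⟩
  have hlog : ∀ (γ : VNorm (LField p k) (absL p k) N) (v : Fin S.card → N), (∀ j, v j ≠ 0) →
      Real.log ((∏ j, γ (v j) : ℝ≥0) : ℝ) = ∑ j, Real.log (γ (v j)) := by
    intro γ v hv
    rw [NNReal.coe_prod, Real.log_prod]
    exact fun j _ => by exact_mod_cast (γ.pos (hv j)).ne'
  have hprod0 : ∀ (γ : VNorm (LField p k) (absL p k) N) (v : Fin S.card → N), (∀ j, v j ≠ 0) →
      ((∏ j, γ (v j) : ℝ≥0) : ℝ) ≠ 0 := by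
    intro γ v hv
    exact_mod_cast Finset.prod_ne_zero_iff.2 fun j _ => (γ.pos (hv j)).ne'
  have hgW0 : ∀ j, (gW j : N) ≠ 0 := fun j h => gW.ne_zero j (Subtype.ext h)
  have h1 := congrArg (fun t : ℝ≥0 => Real.log (t : ℝ)) hprod
  simp only [NNReal.coe_mul] at h1
  change Real.log (((∏ j, frobAct Φ β (w j) : ℝ≥0) : ℝ) * ((∏ j, α (gW j) : ℝ≥0) : ℝ)) =
    Real.log (((∏ j, frobAct Φ α (gW j) : ℝ≥0) : ℝ) * ((∏ j, β (w j) : ℝ≥0) : ℝ)) at h1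
  rw [Real.log_mul (hprod0 _ _ hw0) (hprod0 _ _ hgW0),
    Real.log_mul (hprod0 _ _ hgW0) (hprod0 _ _ hw0), hlog _ _ hw0, hlog _ _ hgW0, hlog _ _ hgW0,
    hlog _ _ hw0] at h1
  have h2 : ∑ i ∈ S, logRatio Φ α (g i) = ∑ j, logRatio Φ α (gW j) := by
    simp only [hgW]
    rw [Equiv.sum_comp S.equivFin.symm (fun i : S => logRatio Φ α (g i)), Finset.sum_coe_sort S
      (fun i => logRatio Φ α (g i))]
  rw [h2]
  simp only [logRatio, Finset.sum_sub_distrib]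
  linarith

section Compare
variable [FiniteDimensional (LField p k) N] {n : ℕ} {g w : Module.Basis (Fin n) (LField p k) N}
  {α β : VNorm (LField p k) (absL p k) N}

/-- Partial sums of the ratios over an initial segment are bounded below by those of any other norm,
if the segment spans a stable subspace. -/
theorem sum_logRatio_le_of_isLowerSet (hg : α.Orth g) (hg' : (frobAct Φ α).Orth g)
    (hw : β.Orth w) (hanti : Antitone fun i => frobAct Φ β (w i) / β (w i))
    {S : Finset (Fin n)} (hlow : ∀ i ∈ S, ∀ j ≤ i, j ∈ S)
    (hS : ∀ x, Φ x ∈ Submodule.span (LField p k) (Set.range fun i : S => g i) ↔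
      x ∈ Submodule.span (LField p k) (Set.range fun i : S => g i)) :
    ∑ i ∈ S, logRatio Φ α (g i) ≤ ∑ i ∈ S, logRatio Φ β (w i) := by
  have hL := isCompleteDiscrete_absL (p := p) (k := k)
  obtain ⟨v, -, hv0, hv, hv', hvanti, hsum⟩ := exists_sorted_orth_stable g hg hg' S hS β
  have hn : S.card ≤ n := by simpa using S.card_le_univ
  rw [← hsum, sum_eq_of_isLowerSet hlow _ hn]
  refine Finset.sum_le_sum fun j _ => ?_
  rw [logRatio_le_iff (hv0 j) (w.ne_zero _)]
  exact VNorm.Orth.ratio_subspace_le hL hw hanti hv' hv0 hvanti j _ rfl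

/-- The ratios on a stable subspace spanned by a final segment of the basis `g` are bounded below
by the ratios on the whole space, and have the same sum as those of `α`. -/
theorem exists_logRatio_le_of_isUpperSet (hg : α.Orth g) (hg' : (frobAct Φ α).Orth g)
    (hw' : (frobAct Φ β).Orth w) (hanti : Antitone fun i => frobAct Φ β (w i) / β (w i))
    {S : Finset (Fin n)}
    (hS : ∀ x, Φ x ∈ Submodule.span (LField p k) (Set.range fun i : S => g i) ↔
      x ∈ Submodule.span (LField p k) (Set.range fun i : S => g i))
    (hn : ∀ j : Fin S.card, n - S.card + j.val < n) :
    ∃ v : Fin S.card → N, Submodule.span (LField p k) (Set.range v) =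
        Submodule.span (LField p k) (Set.range fun i : S => g i) ∧ (∀ j, v j ≠ 0) ∧ β.Orth v ∧
      (∀ j, logRatio Φ β (w ⟨n - S.card + j.val, hn j⟩) ≤ logRatio Φ β (v j)) ∧
      ∑ j, logRatio Φ β (v j) = ∑ i ∈ S, logRatio Φ α (g i) := by
  have hL := isCompleteDiscrete_absL (p := p) (k := k)
  obtain ⟨v, hspan, hv0, hv, hv', hvanti, hsum⟩ := exists_sorted_orth_stable g hg hg' S hS β
  have hcard : S.card ≤ n := by simpa using S.card_le_univ
  refine ⟨v, hspan, hv0, hv, fun j => ?_, hsum⟩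
  rw [logRatio_le_iff (w.ne_zero _) (hv0 j)]
  refine VNorm.Orth.le_ratio_subspace hL hw' hanti hv hv0 hvanti j _ ?_
  simp only
  omega

/-- The sum of the ratios, the logarithm of the absolute value of the determinant of Frobenius, does
not depend on the norm. -/
theorem sum_logRatio_eq (hg : α.Orth g) (hg' : (frobAct Φ α).Orth g)
    (hganti : Antitone fun i => frobAct Φ α (g i) / α (g i))
    (hw : β.Orth w) (hw' : (frobAct Φ β).Orth w)
    (hwanti : Antitone fun i => frobAct Φ β (w i) / β (w i)) :
    ∑ i, logRatio Φ α (g i) = ∑ i, logRatio Φ β (w i) := by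
  have htop : ∀ b : Module.Basis (Fin n) (LField p k) N,
      Submodule.span (LField p k) (Set.range fun i : (Finset.univ : Finset (Fin n)) => b i) = ⊤ := by
    intro b
    rw [← b.span_eq]
    congr 1
    ext x
    simp
  refine le_antisymm ?_ ?_
  · refine sum_logRatio_le_of_isLowerSet hg hg' hw hwanti (fun _ _ j _ => Finset.mem_univ j) fun x => ?_
    rw [htop]
    exact iff_of_true trivial trivial
  · refine sum_logRatio_le_of_isLowerSet hw hw' hg hganti (fun _ _ j _ => Finset.mem_univ j) fun x => ?_
    rw [htop]
    exact iff_of_true trivial trivial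

end Compare
end RelPos

/-! ### The set of minimal displacement -/

section SlopeBasis
variable {p : ℕ} [hp : Fact p.Prime] {k : Type*} [Field k] [CharP k p] [PerfectRing k p]
variable {N : Type*} [AddCommGroup N] [Module (LField p k) N] (Φ : N ≃ₛₗ[sigmaHom p k] N)

/-- The norms that decompose along the slope decomposition, with components in the `Min(Φ_r)`. -/
def minNorms : Set (VNorm (LField p k) (absL p k) N) :=
  {α | α.DecomposesAlong (slopePart Φ) ∧ ∀ r : ℚ, α.restrict (slopePart Φ r) ∈ minSlope Φ r}

/-- A basis adapted to the slope decomposition: `g i` lies in the isoclinic part of slope `r i`, and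
the isoclinic parts are spanned by members of the basis. -/
structure IsSlopeBasis {ι : Type*} (g : Module.Basis ι (LField p k) N) (r : ι → ℚ) : Prop where
  mem : ∀ i, g i ∈ slopePart Φ (r i)
  repr_eq_zero : ∀ s, ∀ x ∈ slopePart Φ s, ∀ i, r i ≠ s → g.repr x i = 0

variable {Φ}

theorem mem_span_subfamily_iff {ι : Type*} (g : Module.Basis ι (LField p k) N) (S : Finset ι) {x : N} :
    x ∈ Submodule.span (LField p k) (Set.range fun i : S => g i) ↔ ∀ i ∉ S, g.repr x i = 0 := by
  have h1 : (Set.range fun i : S => g i) = g '' S := by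
    ext y
    simp
  rw [h1, Module.Basis.mem_span_image]
  constructor
  · intro h i hi
    by_contra h0
    exact hi (h (Finsupp.mem_support_iff.2 h0))
  · intro h i hi
    by_contra h0
    exact Finsupp.mem_support_iff.1 hi (h i h0)

theorem frobAct_of_mem_minNorms {α : VNorm (LField p k) (absL p k) N} (hα : α ∈ minNorms Φ) {r : ℚ}
    {x : N} (hx : x ∈ slopePart Φ r) : frobAct Φ α x = (p : ℝ≥0) ^ (r : ℝ) * α x :=
  hα.2 r ⟨x, hx⟩

namespace IsSlopeBasis
variable {ι : Type*} [Fintype ι] {g : Module.Basis ι (LField p k) N} {r : ι → ℚ}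
  (hg : IsSlopeBasis Φ g r)
include hg

theorem mem_span_of_mem_slopePart {s : ℚ} {x : N} (hx : x ∈ slopePart Φ s) {S : Finset ι}
    (hS : ∀ i, r i = s → i ∈ S) : x ∈ Submodule.span (LField p k) (Set.range fun i : S => g i) :=
  (mem_span_subfamily_iff g S).2 fun i hi => hg.repr_eq_zero s x hx i fun h => hi (hS i h)

/-- The sum of the isoclinic parts whose slopes satisfy `P` is stable under Frobenius. -/
theorem stable (P : ℚ → Prop) [DecidablePred P] (x : N) :
    Φ x ∈ Submodule.span (LField p k) (Set.range fun i : Finset.univ.filter fun i => P (r i) => g i) ↔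
      x ∈ Submodule.span (LField p k)
        (Set.range fun i : Finset.univ.filter fun i => P (r i) => g i) := by
  set W := Submodule.span (LField p k)
    (Set.range fun i : Finset.univ.filter fun i => P (r i) => g i) with hW
  have key : ∀ i : Finset.univ.filter fun i => P (r i), ∀ y ∈ slopePart Φ (r i), y ∈ W := by
    intro i y hy
    refine hg.mem_span_of_mem_slopePart hy fun j hj => ?_
    have hi := (Finset.mem_filter.1 i.2).2
    exact Finset.mem_filter.2 ⟨Finset.mem_univ _, hj ▸ hi⟩
  refine stable_of_le_comap Φ ?_ ?_ x
  · suffices h : W ≤ W.comap (Φ : N →ₛₗ[sigmaHom p k] N) from fun x hx => h hx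
    rw [hW, Submodule.span_le]
    rintro _ ⟨i, rfl⟩
    exact key i _ (frob_mem_slopePart Φ _ (hg.mem i))
  · suffices h : W ≤ W.comap (Φ.symm : N →ₛₗ[sigmaInvHom p k] N) from fun x hx => h hx
    rw [hW, Submodule.span_le]
    rintro _ ⟨i, rfl⟩
    exact key i _ (frob_symm_mem_slopePart Φ _ (hg.mem i))

theorem logRatio_eq {α : VNorm (LField p k) (absL p k) N} (hα : α ∈ minNorms Φ) (i : ι) :
    logRatio Φ α (g i) = r i * Real.log p :=
  (logRatio_eq_mul_log_iff (g.ne_zero i) _).2 (frobAct_of_mem_minNorms hα (hg.mem i))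

end IsSlopeBasis

section Equality
variable [FiniteDimensional (LField p k) N] {n : ℕ} {g w : Module.Basis (Fin n) (LField p k) N}
  {α β : VNorm (LField p k) (absL p k) N} {r : Fin n → ℚ}

/-- In the equality case, Frobenius dilates the norm by at most `p^s` on the part of slopes at
most `s`. -/
theorem frobAct_le_of_logRatio_eq (hslope : IsSlopeBasis Φ g r) (hr : Antitone r)
    (hα : α ∈ minNorms Φ) (hg : α.Orth g) (hg' : (frobAct Φ α).Orth g)
    (hw' : (frobAct Φ β).Orth w) (hanti : Antitone fun i => frobAct Φ β (w i) / β (w i))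
    (heq : ∀ i, logRatio Φ β (w i) = r i * Real.log p) {s : ℚ} {x : N}
    (hx : x ∈ Submodule.span (LField p k)
      (Set.range fun i : Finset.univ.filter fun i => r i ≤ s => g i)) :
    frobAct Φ β x ≤ (p : ℝ≥0) ^ (s : ℝ) * β x := by
  set S := Finset.univ.filter fun i => r i ≤ s with hS
  have hup : ∀ i ∈ S, ∀ j, i ≤ j → j ∈ S := fun i hi j hij =>
    Finset.mem_filter.2 ⟨Finset.mem_univ _, (hr hij).trans (Finset.mem_filter.1 hi).2⟩
  have hcard : S.card ≤ n := by simpa using S.card_le_univ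
  have hn : ∀ j : Fin S.card, n - S.card + j.val < n := fun j => by have := j.2; omega
  obtain ⟨v, hspan, hv0, hv, hle, hsum⟩ := exists_logRatio_le_of_isUpperSet hg hg' hw' hanti
    (hslope.stable fun t => t ≤ s) hn
  have hsum' : ∑ j, logRatio Φ β (w ⟨n - S.card + j.val, hn j⟩) = ∑ j, logRatio Φ β (v j) := by
    rw [hsum, ← sum_eq_of_isUpperSet hup (fun i => logRatio Φ β (w i)) hn]
    exact Finset.sum_congr rfl fun i _ => by rw [heq, hslope.logRatio_eq hα]
  rw [Finset.sum_eq_sum_iff_of_le fun j _ => hle j] at hsum'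
  rw [← hspan] at hx
  refine hv.le_mul_of_mem_span (fun j => ?_) hx
  rw [← logRatio_le_mul_log_iff (hv0 j), ← hsum' j (Finset.mem_univ j), heq]
  refine mul_le_mul_of_nonneg_right ?_ (Real.log_natCast_nonneg p)
  exact_mod_cast (Finset.mem_filter.1 (mem_of_isUpperSet hup j (hn j))).2

/-- In the equality case, Frobenius dilates the norm by exactly `p^s` on the isoclinic part of
slope `s`: the upper bounds for the ratios add up to the change of volume. -/
theorem frobAct_eq_of_logRatio_eq (hslope : IsSlopeBasis Φ g r) (hr : Antitone r)
    (hα : α ∈ minNorms Φ) (hg : α.Orth g) (hg' : (frobAct Φ α).Orth g)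
    (hw' : (frobAct Φ β).Orth w) (hanti : Antitone fun i => frobAct Φ β (w i) / β (w i))
    (heq : ∀ i, logRatio Φ β (w i) = r i * Real.log p) {s : ℚ} {x : N} (hx : x ∈ slopePart Φ s) :
    frobAct Φ β x = (p : ℝ≥0) ^ (s : ℝ) * β x := by
  have hpp : (0 : ℝ≥0) < p := one_pos.trans one_lt_p_nnreal
  set S := Finset.univ.filter fun i => r i = s with hS
  obtain ⟨v, hspan, hv0, hv, hv', -, hsum⟩ := exists_sorted_orth_stable g hg hg' S
    (hslope.stable fun t => t = s) β
  have hle : ∀ j, logRatio Φ β (v j) ≤ s * Real.log p := by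
    intro j
    rw [logRatio_le_mul_log_iff (hv0 j)]
    refine frobAct_le_of_logRatio_eq hslope hr hα hg hg' hw' hanti heq ?_
    have h1 : v j ∈ Submodule.span (LField p k) (Set.range v) := Submodule.subset_span ⟨j, rfl⟩
    rw [hspan, mem_span_subfamily_iff] at h1
    rw [mem_span_subfamily_iff]
    refine fun i hi => h1 i fun h => hi ?_
    exact Finset.mem_filter.2 ⟨Finset.mem_univ _, (Finset.mem_filter.1 h).2.le⟩
  have hsum' : ∑ j, logRatio Φ β (v j) = ∑ _j : Fin S.card, (s * Real.log p : ℝ) := by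
    rw [hsum, Finset.sum_const, Finset.card_univ, Fintype.card_fin, ← Finset.sum_const]
    refine Finset.sum_congr rfl fun i hi => ?_
    rw [hslope.logRatio_eq hα, (Finset.mem_filter.1 hi).2]
  rw [Finset.sum_eq_sum_iff_of_le fun j _ => hle j] at hsum'
  have hvj : ∀ j, frobAct Φ β (v j) = (p : ℝ≥0) ^ (s : ℝ) * β (v j) := fun j =>
    (logRatio_eq_mul_log_iff (hv0 j) _).1 (hsum' j (Finset.mem_univ j))
  have hx' := hslope.mem_span_of_mem_slopePart hx (S := S) fun i hi =>
    Finset.mem_filter.2 ⟨Finset.mem_univ _, hi⟩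
  rw [← hspan] at hx'
  refine le_antisymm (hv.le_mul_of_mem_span (fun j => (hvj j).le) hx') ?_
  have h1 := hv'.le_mul_of_mem_span (α := β) (C := ((p : ℝ≥0) ^ (s : ℝ))⁻¹) (fun j => by
    rw [hvj, inv_mul_cancel_left₀ (NNReal.rpow_pos hpp).ne']) hx'
  rwa [le_inv_mul_iff₀ (NNReal.rpow_pos hpp)] at h1

/-- In the equality case the norm decomposes: for `x` of slope `a` and `y` of smaller slopes,
`Φ · β` dilates `x` more than `y`, and `x + y` by at most as much as `x`. -/
theorem mem_minNorms_of_logRatio_eq (hslope : IsSlopeBasis Φ g r) (hr : Antitone r)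
    (hα : α ∈ minNorms Φ) (hg : α.Orth g) (hg' : (frobAct Φ α).Orth g)
    (hw' : (frobAct Φ β).Orth w) (hanti : Antitone fun i => frobAct Φ β (w i) / β (w i))
    (heq : ∀ i, logRatio Φ β (w i) = r i * Real.log p) : β ∈ minNorms Φ := by
  have hL := isCompleteDiscrete_absL (p := p) (k := k)
  have hp1 := one_lt_p_nnreal (p := p)
  have hpp : (0 : ℝ≥0) < p := one_pos.trans hp1
  have hle : ∀ (s : ℚ) (x : N), x ∈ Submodule.span (LField p k)
      (Set.range fun i : Finset.univ.filter fun i => r i ≤ s => g i) →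
      frobAct Φ β x ≤ (p : ℝ≥0) ^ (s : ℝ) * β x := fun s x hx =>
    frobAct_le_of_logRatio_eq hslope hr hα hg hg' hw' hanti heq hx
  have heqs : ∀ (s : ℚ) (x : N), x ∈ slopePart Φ s →
      frobAct Φ β x = (p : ℝ≥0) ^ (s : ℝ) * β x := fun s x hx =>
    frobAct_eq_of_logRatio_eq hslope hr hα hg hg' hw' hanti heq hx
  refine ⟨fun T x hx => ?_, fun s x => heqs s x x.2⟩
  induction T using Finset.induction_on_max with
  | empty => rw [Finset.sum_empty, β.map_zero, Finset.sup_empty]; rfl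
  | insert a T ha ih =>
    have haT : a ∉ T := fun h => lt_irrefl _ (ha a h)
    rw [Finset.sum_insert haT, Finset.sup_insert, ← ih fun i hi => hx i (Finset.mem_insert_of_mem hi)]
    rcases T.eq_empty_or_nonempty with rfl | hT
    · rw [Finset.sum_empty, add_zero, β.map_zero]
      exact (max_eq_left zero_le).symm
    have hxa := hx a (Finset.mem_insert_self _ _)
    set y := ∑ i ∈ T, x i with hy
    have hyW : ∀ s, (∀ i ∈ T, i ≤ s) → y ∈ Submodule.span (LField p k)
        (Set.range fun i : Finset.univ.filter fun i => r i ≤ s => g i) := fun s hs =>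
      sum_mem fun i hi => hslope.mem_span_of_mem_slopePart (hx i (Finset.mem_insert_of_mem hi))
        fun j hj => Finset.mem_filter.2 ⟨Finset.mem_univ _, hj ▸ hs i hi⟩
    change β (x a + y) = max (β (x a)) (β y)
    rcases lt_trichotomy (β (x a)) (β y) with h1 | h1 | h1
    · rw [add_comm, β.add_eq_of_lt hL h1, max_eq_right h1.le]
    · rw [← h1, max_self]
      by_contra hne
      have hlt : β (x a + y) < β (x a) := by
        refine lt_of_le_of_ne ((β.add_le _ _).trans ?_) hne
        rw [← h1, max_self]
      have hpos : 0 < β (x a) := pos_of_gt hlt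
      have h2 := hle _ y (hyW (T.max' hT) fun i hi => T.le_max' i hi)
      have h3 : frobAct Φ β y < frobAct Φ β (x a) := by
        rw [heqs a _ hxa]
        refine h2.trans_lt ?_
        rw [← h1]
        refine mul_lt_mul_of_pos_right (NNReal.rpow_lt_rpow_of_exponent_lt hp1 ?_) hpos
        exact_mod_cast ha _ (T.max'_mem hT)
      have h4 := (frobAct Φ β).add_eq_of_lt hL h3
      have h5 := hle a (x a + y) (add_mem (hslope.mem_span_of_mem_slopePart hxa
        fun j hj => Finset.mem_filter.2 ⟨Finset.mem_univ _, hj.le⟩) (hyW a fun i hi => (ha i hi).le))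
      rw [h4, heqs a _ hxa] at h5
      exact absurd (le_of_mul_le_mul_left h5 (NNReal.rpow_pos hpp)) (not_le.2 hlt)
    · rw [β.add_eq_of_lt hL h1, max_eq_left h1.le]

end Equality
end SlopeBasis

section Displacement
variable {p : ℕ} [hp : Fact p.Prime] {k : Type*} [Field k] [CharP k p] [IsAlgClosed k]
variable {N : Type*} [AddCommGroup N] [Module (LField p k) N] [FiniteDimensional (LField p k) N]
  {Φ : N ≃ₛₗ[sigmaHom p k] N}

variable (Φ) in
theorem minNorms_nonempty : (minNorms Φ).Nonempty := by
  choose γ hγ using minSlope_nonempty Φ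
  obtain ⟨α, hα, hαγ⟩ := VNorm.exists_decomposesAlong isCompleteDiscrete_absL
    (isInternal_slopePart Φ) γ
  exact ⟨α, hα, fun r => hαγ r ▸ hγ r⟩

theorem isSplitBy_frobAct {r : ℚ} {γ : VNorm (LField p k) (absL p k) (slopePart Φ r)}
    (hγ : γ ∈ minSlope Φ r) {ι : Type*} {v : Module.Basis ι (LField p k) (slopePart Φ r)}
    (hv : γ.IsSplitBy v) : (frobAct (slopeFrob Φ r) γ).IsSplitBy v := by
  rw [VNorm.isSplitBy_iff isCompleteDiscrete_absL] at hv ⊢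
  intro x i
  rw [hγ, hγ, mul_left_comm]
  gcongr
  exact hv x i

theorem decomposesAlong_frobAct {α : VNorm (LField p k) (absL p k) N}
    (hα : α.DecomposesAlong (slopePart Φ)) : (frobAct Φ α).DecomposesAlong (slopePart Φ) := by
  intro s x hx
  rw [frobAct_apply, map_sum]
  exact hα s _ fun i hi => frob_symm_mem_slopePart Φ i (hx i hi)

/-- A norm in `minNorms` and its image under Frobenius are split by a common basis adapted to the
slope decomposition, ordered by decreasing slope. -/
theorem exists_isSlopeBasis {n : ℕ} (hn : Module.finrank (LField p k) N = n)
    {α : VNorm (LField p k) (absL p k) N} (hα : α ∈ minNorms Φ) :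
    ∃ (g : Module.Basis (Fin n) (LField p k) N) (r : Fin n → ℚ), IsSlopeBasis Φ g r ∧ Antitone r ∧
      α.Orth g ∧ (frobAct Φ α).Orth g := by
  have hL := isCompleteDiscrete_absL (p := p) (k := k)
  have hA := isInternal_slopePart Φ
  choose v hv using fun r => VNorm.exists_isSplitBy hL (α.restrict (slopePart Φ r))
  let c := hA.collectedBasis v
  have := Module.Finite.finite_basis c
  have := Fintype.ofFinite (Σ r, Fin (Module.finrank (LField p k) (slopePart Φ r)))
  have h1 : α.Orth c := (VNorm.isSplitBy_iff_orth hL).1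
    ((VNorm.isSplitBy_collectedBasis_iff hL hA v).2 ⟨hα.1, hv⟩)
  have h2 : (frobAct Φ α).Orth c := (VNorm.isSplitBy_iff_orth hL).1
    ((VNorm.isSplitBy_collectedBasis_iff hL hA v).2 ⟨decomposesAlong_frobAct hα.1,
      fun r => isSplitBy_frobAct (hα.2 r) (hv r)⟩)
  obtain ⟨e, he⟩ := exists_equiv_antitone (n := n)
    (by rw [← hn, Module.finrank_eq_card_basis c])
    fun x : Σ r, Fin (Module.finrank (LField p k) (slopePart Φ r)) => x.1
  refine ⟨c.reindex e.symm, fun i => (e i).1, ⟨fun i => ?_, fun s x hx i hi => ?_⟩, he, ?_, ?_⟩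
  · rw [Module.Basis.reindex_apply, Equiv.symm_symm]
    exact hA.collectedBasis_mem v _
  · rw [Module.Basis.repr_reindex_apply, Equiv.symm_symm]
    exact hA.collectedBasis_repr_of_mem_ne v (Ne.symm hi) hx
  · rw [Module.Basis.coe_reindex]
    exact h1.comp _ e.injective
  · rw [Module.Basis.coe_reindex]
    exact h2.comp _ e.injective

variable [MetricSpace (VNorm (LField p k) (absL p k) N)] {n : ℕ}
  {Q : QuadraticForm ℝ (Fin n → ℝ)}

/-- The displacement of a norm is at least the displacement of the norms in `minNorms`, with
equality only for norms in `minNorms`: the vector `u` of the logarithms of the ratios of `Φ · β`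
and `β` has larger partial sums than the vector `v` of slopes, and the same total sum. -/
theorem dist_frobAct_le (hn : Module.finrank (LField p k) N = n) (hpos : Q.PosDef)
    (hperm : ∀ (s : Equiv.Perm (Fin n)) v, Q (v ∘ s) = Q v)
    (hQ : ∀ (e : Module.Basis (Fin n) (LField p k) N) (α β : VNorm (LField p k) (absL p k) N),
      α.Orth e → β.Orth e →
        dist α β ^ 2 = Q fun i => Real.log (α (e i)) - Real.log (β (e i)))
    {α : VNorm (LField p k) (absL p k) N} (hα : α ∈ minNorms Φ)
    (β : VNorm (LField p k) (absL p k) N) :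
    dist α (frobAct Φ α) ≤ dist β (frobAct Φ β) ∧
      (dist β (frobAct Φ β) = dist α (frobAct Φ α) → β ∈ minNorms Φ) := by
  have hL := isCompleteDiscrete_absL (p := p) (k := k)
  obtain ⟨g, r, hslope, hr, hg, hg'⟩ := exists_isSlopeBasis hn hα
  obtain ⟨w, hw, hw', hanti⟩ := VNorm.exists_sorted_orth hL hn β (frobAct Φ β)
  have hlogp : 0 ≤ Real.log p := Real.log_natCast_nonneg p
  let u : Fin n → ℝ := fun i => logRatio Φ β (w i)
  let v : Fin n → ℝ := fun i => logRatio Φ α (g i)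
  have hdist : ∀ (γ : VNorm (LField p k) (absL p k) N) (e : Module.Basis (Fin n) (LField p k) N),
      γ.Orth e → (frobAct Φ γ).Orth e →
        dist γ (frobAct Φ γ) ^ 2 = Q fun i => logRatio Φ γ (e i) := by
    intro γ e he he'
    rw [hQ e _ _ he he', ← QuadraticMap.map_neg]
    congr 1
    funext i
    rw [logRatio, Pi.neg_apply, neg_sub]
  have hv : ∀ i j, r i ≤ r j → v i ≤ v j := by
    intro i j hij
    simp only [v]
    rw [hslope.logRatio_eq hα, hslope.logRatio_eq hα]
    exact mul_le_mul_of_nonneg_right (by exact_mod_cast hij) hlogp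
  have hganti : Antitone fun i => frobAct Φ α (g i) / α (g i) := fun i j hij =>
    (logRatio_le_iff (g.ne_zero _) (g.ne_zero _)).1 (hv j i (hr hij))
  have hsum : ∑ i, u i = ∑ i, v i := (sum_logRatio_eq hg hg' hganti hw hw' hanti).symm
  have hmain := quadratic_le_of_partial_sums hpos hperm hv hsum fun i =>
    sum_logRatio_le_of_isLowerSet hg hg' hw hanti
      (fun a ha b hba => Finset.mem_filter.2 ⟨Finset.mem_univ _,
        ((Finset.mem_filter.1 ha).2).trans (hr hba)⟩)
      (hslope.stable fun t => r i ≤ t)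
  have hnonneg := hpos.nonneg (u - v)
  have hdα : dist α (frobAct Φ α) ^ 2 = Q v := hdist α g hg hg'
  have hdβ : dist β (frobAct Φ β) ^ 2 = Q u := hdist β w hw hw'
  constructor
  · refine (sq_le_sq₀ dist_nonneg dist_nonneg).1 ?_
    rw [hdα, hdβ]
    linarith
  · intro h
    have h1 : Q (u - v) = 0 := by
      rw [h, hdα] at hdβ
      linarith
    have h2 : u - v = 0 := by
      by_contra h0
      exact (hpos _ h0).ne' h1
    refine mem_minNorms_of_logRatio_eq hslope hr hα hg hg' hw' hanti fun i => ?_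
    rw [← hslope.logRatio_eq hα]
    exact congrFun (sub_eq_zero.1 h2) i

/-- The set of minimal displacement consists of the norms that decompose along the slope
decomposition, with components in the `Min(Φ_r)`. -/
theorem minSet_frobAct (hn : Module.finrank (LField p k) N = n) (hpos : Q.PosDef)
    (hperm : ∀ (s : Equiv.Perm (Fin n)) v, Q (v ∘ s) = Q v)
    (hQ : ∀ (e : Module.Basis (Fin n) (LField p k) N) (α β : VNorm (LField p k) (absL p k) N),
      α.Orth e → β.Orth e →
        dist α β ^ 2 = Q fun i => Real.log (α (e i)) - Real.log (β (e i))) :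
    minSet (frobAct Φ) = minNorms Φ := by
  obtain ⟨α₀, hα₀⟩ := minNorms_nonempty Φ
  have hinf : ∀ α ∈ minNorms Φ, ⨅ β, dist β (frobAct Φ β) = dist α (frobAct Φ α) := by
    intro α hα
    have : Nonempty (VNorm (LField p k) (absL p k) N) := ⟨α⟩
    refine le_antisymm (ciInf_le ⟨0, ?_⟩ α) (le_ciInf fun β =>
      (dist_frobAct_le hn hpos hperm hQ hα β).1)
    rintro _ ⟨β, rfl⟩
    exact dist_nonneg
  ext β
  constructor
  · intro hβ
    refine (dist_frobAct_le hn hpos hperm hQ hα₀ β).2 ?_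
    rw [← hinf α₀ hα₀]
    exact hβ
  · exact fun hβ => (hinf β hβ).symm

end Displacement

/-! ### Automorphisms, and the building of `J` -/

section Restriction
variable {p : ℕ} [hp : Fact p.Prime] {k : Type*} [Field k] [CharP k p] [PerfectRing k p]
variable {N : Type*} [AddCommGroup N] [Module (LField p k) N] {Φ : N ≃ₛₗ[sigmaHom p k] N}

theorem isocAut_iterate (g : isocAut Φ) (n : ℕ) (x : N) : g.1 (Φ^[n] x) = Φ^[n] (g.1 x) := by
  induction n with
  | zero => rfl
  | succ n ih => rw [Function.iterate_succ_apply', g.2, ih, Function.iterate_succ_apply']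

theorem isocAut_mem_slopeFix (g : isocAut Φ) {r : ℚ} {x : N} (hx : x ∈ slopeFix Φ r) :
    g.1 x ∈ slopeFix Φ r := by
  rw [mem_slopeFix_iff, ← isocAut_iterate, hx.2, map_smul]

/-- The `D(r)`-linear automorphism of `N_r⁰` induced by an automorphism of the isocrystal. -/
noncomputable def isocAutFix (r : ℚ) (g : isocAut Φ) :
    slopeFix Φ r ≃ₗ[slopeAlg p k r] slopeFix Φ r where
  toFun x := ⟨g.1 x, isocAut_mem_slopeFix g x.2⟩
  invFun x := ⟨(g⁻¹ : isocAut Φ).1 x, isocAut_mem_slopeFix g⁻¹ x.2⟩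
  map_add' x y := Subtype.ext (map_add g.1 (x : N) y)
  map_smul' y x := by
    apply Subtype.ext
    change g.1 (rowAct Φ r (y.1 0) x) = rowAct Φ r (y.1 0) (g.1 x)
    rw [rowAct, rowAct, map_sum]
    exact Finset.sum_congr rfl fun j _ => by rw [map_smul, isocAut_iterate]
  left_inv x := Subtype.ext (g.1.symm_apply_apply x)
  right_inv x := Subtype.ext (g.1.apply_symm_apply x)

/-- Restriction of automorphisms of the isocrystal to the spaces `N_r⁰`. -/
noncomputable def isocAutRestrict :
    isocAut Φ →* ∀ r : ℚ, slopeFix Φ r ≃ₗ[slopeAlg p k r] slopeFix Φ r where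
  toFun g r := isocAutFix r g
  map_one' := rfl
  map_mul' _ _ := rfl

end Restriction

section Automorphisms
variable {p : ℕ} [hp : Fact p.Prime] {k : Type*} [Field k] [CharP k p] [IsAlgClosed k]
variable {N : Type*} [AddCommGroup N] [Module (LField p k) N] [FiniteDimensional (LField p k) N]
  {Φ : N ≃ₛₗ[sigmaHom p k] N} {r : ℚ}

attribute [local instance] moduleSlopeFix

theorem isocAut_mem_slopePart (g : isocAut Φ) {x : N} (hx : x ∈ slopePart Φ r) :
    g.1 x ∈ slopePart Φ r := by
  have h1 : slopePart Φ r ≤ (slopePart Φ r).comap g.1.toLinearMap := by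
    conv_lhs => rw [← span_slopeFix]
    rw [Submodule.span_le]
    exact fun y hy => (isocAut_mem_slopeFix g hy).1
  exact h1 hx

variable (Φ) in
/-- The union of `K(r)`-bases of the `N_r⁰` is an `L`-basis of `N`. -/
noncomputable def unionBasis {ι : ℚ → Type*}
    (b : ∀ r, Module.Basis (ι r) (fixedField p k r) (slopeFix Φ r)) :
    Module.Basis (Σ r, ι r) (LField p k) N :=
  (isInternal_slopePart Φ).collectedBasis fun r => slopePartBasis Φ (b r)

theorem unionBasis_apply {ι : ℚ → Type*}
    (b : ∀ r, Module.Basis (ι r) (fixedField p k r) (slopeFix Φ r)) (x : Σ r, ι r) :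
    unionBasis Φ b x = b x.1 x.2 := by
  rw [unionBasis, DirectSum.IsInternal.collectedBasis_coe]
  exact coe_slopePartBasis Φ _ _

theorem isocAutRestrict_injective : Function.Injective (isocAutRestrict (Φ := Φ)) := by
  intro g g' h
  let b := fun r => Module.Basis.ofVectorSpace (fixedField p k r) (slopeFix Φ r)
  apply Subtype.ext
  apply LinearEquiv.toLinearMap_injective
  refine (unionBasis Φ b).ext fun x => ?_
  rw [unionBasis_apply]
  exact congrArg Subtype.val (LinearEquiv.congr_fun (congrFun h x.1) (b x.1 x.2))

theorem map_fixedField_smul (τ : slopeFix Φ r ≃ₗ[slopeAlg p k r] slopeFix Φ r)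
    (a : fixedField p k r) (x : slopeFix Φ r) : τ (a • x) = a • τ x := by
  have h1 : τ (slopeIncl p k r a • x) = slopeIncl p k r a • τ x := τ.map_smul _ _
  rw [slopeIncl_smul, slopeIncl_smul] at h1
  exact h1

/-- A `D(r)`-linear automorphism of `N_r⁰` as a `K(r)`-linear one. -/
noncomputable def fixedFieldEquiv (τ : slopeFix Φ r ≃ₗ[slopeAlg p k r] slopeFix Φ r) :
    slopeFix Φ r ≃ₗ[fixedField p k r] slopeFix Φ r :=
  { τ.toAddEquiv with map_smul' := map_fixedField_smul τ }

/-- An `L`-linear map and a `D(r)`-linear one agree on `N_r⁰` if they agree on a `K(r)`-basis. -/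
theorem eq_of_eq_on_basis {ι : Type*} (b : Module.Basis ι (fixedField p k r) (slopeFix Φ r))
    (g : N ≃ₗ[LField p k] N) (τ : slopeFix Φ r ≃ₗ[slopeAlg p k r] slopeFix Φ r)
    (h : ∀ i, g (b i : N) = (τ (b i) : slopeFix Φ r)) (x : slopeFix Φ r) :
    g (x : N) = (τ x : slopeFix Φ r) := by
  have hx : x ∈ Submodule.span (fixedField p k r) (Set.range b) := by
    rw [b.span_eq]
    exact Submodule.mem_top
  induction hx using Submodule.span_induction with
  | mem x hx =>
    obtain ⟨i, rfl⟩ := hx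
    exact h i
  | zero =>
    have h0 : τ 0 = 0 := τ.toAddEquiv.map_zero
    rw [h0]
    exact g.map_zero
  | add x y _ _ hx hy =>
    have h0 : τ (x + y) = τ x + τ y := τ.toAddEquiv.map_add x y
    rw [h0]
    change g ((x : N) + y) = (τ x : N) + τ y
    rw [← hx, ← hy]
    exact g.map_add _ _
  | smul a x _ hx =>
    rw [map_fixedField_smul]
    change g ((a : LField p k) • (x : N)) = (a : LField p k) • (τ x : N)
    rw [← hx]
    exact g.map_smul _ _

/-- A family of `D(r)`-linear automorphisms extends to an `L`-linear automorphism of `N`, which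
commutes with `Φ` since `Φ` acts on `N_r⁰` as `π_r`. -/
theorem isocAutRestrict_surjective : Function.Surjective (isocAutRestrict (Φ := Φ)) := by
  intro τ
  let b := fun r => Module.Basis.ofVectorSpace (fixedField p k r) (slopeFix Φ r)
  let g : N ≃ₗ[LField p k] N := (unionBasis Φ b).equiv
    (unionBasis Φ fun r => (b r).map (fixedFieldEquiv (τ r))) (Equiv.refl _)
  have hg : ∀ r (x : slopeFix Φ r), g x = (τ r x : slopeFix Φ r) := by
    intro r x
    refine eq_of_eq_on_basis (b r) g (τ r) (fun i => ?_) x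
    have h1 := (unionBasis Φ b).equiv_apply ⟨r, i⟩
      (unionBasis Φ fun r => (b r).map (fixedFieldEquiv (τ r))) (Equiv.refl _)
    rw [unionBasis_apply, Equiv.refl_apply, unionBasis_apply, Module.Basis.map_apply] at h1
    exact h1
  have hgb : ∀ r (x : slopeFix Φ r), g (Φ x) = Φ (g x) := by
    intro r x
    have h2 : τ r (slopePi p k r • x) = slopePi p k r • τ r x := (τ r).map_smul _ _
    calc g (Φ x) = g (slopePi p k r • x : slopeFix Φ r) := congrArg g (slopePi_smul Φ r x).symm
      _ = (τ r (slopePi p k r • x) : slopeFix Φ r) := hg r _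
      _ = (slopePi p k r • τ r x : slopeFix Φ r) := congrArg Subtype.val h2
      _ = Φ (τ r x : slopeFix Φ r) := slopePi_smul Φ r _
      _ = Φ (g x) := congrArg Φ (hg r x).symm
  have hgΦ : ∀ x, g (Φ x) = Φ (g x) := by
    have h1 : g.toLinearMap.comp (Φ : N →ₛₗ[sigmaHom p k] N) =
        (Φ : N →ₛₗ[sigmaHom p k] N).comp g.toLinearMap := by
      refine (unionBasis Φ b).ext fun x => ?_
      rw [unionBasis_apply]
      exact hgb x.1 (b x.1 x.2)
    exact fun x => LinearMap.congr_fun h1 x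
  refine ⟨⟨g, hgΦ⟩, funext fun r => LinearEquiv.ext fun x => Subtype.ext ?_⟩
  exact hg r x

variable (Φ) in
/-- `J` is the product of the groups `Aut_{D(r)}(N_r⁰)`. -/
noncomputable def isocAutEquiv :
    isocAut Φ ≃* ∀ r : ℚ, slopeFix Φ r ≃ₗ[slopeAlg p k r] slopeFix Φ r :=
  MulEquiv.ofBijective isocAutRestrict ⟨isocAutRestrict_injective, isocAutRestrict_surjective⟩

theorem coe_isocAutEquiv (g : isocAut Φ) (r : ℚ) (x : slopeFix Φ r) :
    (isocAutEquiv Φ g r x : N) = g.1 x := rfl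

theorem smul_mem_minNorms (g : isocAut Φ) {α : VNorm (LField p k) (absL p k) N}
    (hα : α ∈ minNorms Φ) : g.1 • α ∈ minNorms Φ := by
  refine ⟨fun s x hx => ?_, fun r x => ?_⟩
  · rw [VNorm.smul_apply, map_sum]
    exact hα.1 s _ fun i hi => isocAut_mem_slopePart g⁻¹ (hx i hi)
  · have h1 : g.1.symm (Φ.symm (x : N)) = Φ.symm (g.1.symm x) := by
      have h2 := (g⁻¹ : isocAut Φ).2 (Φ.symm (x : N))
      rw [LinearEquiv.apply_symm_apply] at h2
      rw [LinearEquiv.eq_symm_apply]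
      exact h2.symm
    change α (g.1.symm (Φ.symm (x : N))) = _ * α (g.1.symm (x : N))
    rw [h1]
    exact frobAct_of_mem_minNorms hα (isocAut_mem_slopePart g⁻¹ x.2)

end Automorphisms

section NormBijection
variable {p : ℕ} [hp : Fact p.Prime] {k : Type*} [Field k] [CharP k p] [IsAlgClosed k]
variable {N : Type*} [AddCommGroup N] [Module (LField p k) N] [FiniteDimensional (LField p k) N]
  {Φ : N ≃ₛₗ[sigmaHom p k] N} {r : ℚ}

attribute [local instance] moduleSlopeFix

theorem absD_slopeIncl (a : fixedField p k r) : absD p k r (slopeIncl p k r a) = absK p k r a := by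
  have hL := isCompleteDiscrete_absL (p := p) (k := k)
  have hden : (r.den : ℝ) ≠ 0 := by exact_mod_cast r.den_nz
  change absL p k (inclMat p k r a).det ^ (1 / (r.den : ℝ)) = absL p k a
  rw [inclMat, Matrix.det_diagonal, hL.prod]
  simp only [absL_iterate_sigma]
  rw [Finset.prod_const, Finset.card_univ, Fintype.card_fin, ← NNReal.rpow_natCast,
    ← NNReal.rpow_mul, mul_one_div_cancel hden, NNReal.rpow_one]

theorem restrictFix_slopePi_smul {α : VNorm (LField p k) (absL p k) N} (hα : α ∈ minNorms Φ) (r : ℚ)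
    (x : slopeFix Φ r) : restrictFix (α.restrict (slopePart Φ r)) (slopePi p k r • x) =
      absD p k r (slopePi p k r) * restrictFix (α.restrict (slopePart Φ r)) x :=
  (mem_minSlope_iff_restrictFix (minSlope_subset_minSlopePow (hα.2 r))).1 (hα.2 r) x

/-- The restriction of a norm in `minNorms` to `N_r⁰`, as a `D(r)`-norm. -/
noncomputable def restrictSlopeAlg (α : minNorms Φ) (r : ℚ) :
    VNorm (slopeAlg p k r) (absD p k r) (slopeFix Φ r) where
  toFun x := α.1 x
  eq_zero_iff' x := (restrictFix (α.1.restrict (slopePart Φ r))).eq_zero_iff' x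
  add_le_max' _ _ := α.1.add_le _ _
  smul' y x := map_slopeAlg_smul (restrictFix_slopePi_smul α.2 r) y x

theorem restrictFix_restrict_apply (α : minNorms Φ) (r : ℚ) (x : slopeFix Φ r) :
    restrictFix (α.1.restrict (slopePart Φ r)) x = restrictSlopeAlg α r x := rfl

theorem bijective_restrictSlopeAlg : Function.Bijective (restrictSlopeAlg (Φ := Φ)) := by
  have hL := isCompleteDiscrete_absL (p := p) (k := k)
  have hA := isInternal_slopePart Φ
  constructor
  · intro α β h
    refine Subtype.ext (α.2.1.ext hA β.2.1 fun r => ?_)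
    refine restrictFix_injOn (minSlope_subset_minSlopePow (α.2.2 r))
      (minSlope_subset_minSlopePow (β.2.2 r)) (VNorm.ext fun x => ?_)
    exact congrArg (fun γ : VNorm (slopeAlg p k r) (absD p k r) (slopeFix Φ r) => γ x) (congrFun h r)
  · intro γ
    let β : ∀ r, VNorm (fixedField p k r) (absK p k r) (slopeFix Φ r) := fun r =>
      { toFun := γ r
        eq_zero_iff' := (γ r).eq_zero_iff'
        add_le_max' := (γ r).add_le_max'
        smul' := fun a x => by rw [← slopeIncl_smul, (γ r).smul', absD_slopeIncl] }
    choose δ hδ hδβ using fun r => exists_restrictFix_eq (β r)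
    obtain ⟨α, hα, hαδ⟩ := VNorm.exists_decomposesAlong hL hA δ
    have hmem : α ∈ minNorms Φ := by
      refine ⟨hα, fun r => ?_⟩
      rw [hαδ, mem_minSlope_iff_restrictFix (hδ r), hδβ]
      exact (γ r).smul' _
    refine ⟨⟨α, hmem⟩, funext fun r => VNorm.ext fun x => ?_⟩
    rw [← restrictFix_restrict_apply, hαδ, hδβ]

/-! ### Apartments -/

/-- The `K(r)`-basis `π_r^j B_i` of `N_r⁰` attached to a `D(r)`-basis `B`. -/
noncomputable def slopeAlgBasis {ι : Type*} [Fintype ι]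
    (B : Module.Basis ι (slopeAlg p k r) (slopeFix Φ r)) :
    Module.Basis (ι × Fin r.den) (fixedField p k r) (slopeFix Φ r) :=
  Module.Basis.mk (v := fun x : ι × Fin r.den => slopePi p k r ^ x.2.val • B x.1)
    (by
      rw [Fintype.linearIndependent_iff]
      intro c hc x
      rw [Fintype.sum_prod_type] at hc
      simp only [← rowElem_smul fun j => c (_, j)] at hc
      have h1 := Fintype.linearIndependent_iff.1 B.linearIndependent _ hc x.1
      have h2 := rowElem_row (fun j => c (x.1, j)) x.2
      rw [h1] at h2
      exact Subtype.ext h2.symm)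
    (by
      rintro x -
      rw [← B.sum_repr x]
      refine sum_mem fun i _ => ?_
      obtain ⟨c, hc⟩ := exists_eq_rowElem (B.repr x i)
      rw [hc, rowElem_smul]
      exact sum_mem fun j _ => Submodule.smul_mem _ _ (Submodule.subset_span ⟨(i, j), rfl⟩))

theorem slopeAlgBasis_apply {ι : Type*} [Fintype ι]
    (B : Module.Basis ι (slopeAlg p k r) (slopeFix Φ r)) (x : ι × Fin r.den) :
    slopeAlgBasis B x = slopePi p k r ^ x.2.val • B x.1 := by
  rw [slopeAlgBasis, Module.Basis.mk_apply]

theorem restrictSlopeAlg_pow_smul (α : minNorms Φ) (n : ℕ) (x : slopeFix Φ r) :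
    restrictSlopeAlg α r (slopePi p k r ^ n • x) = piAbs p r ^ n * restrictSlopeAlg α r x := by
  induction n with
  | zero => rw [pow_zero, pow_zero, one_smul, one_mul]
  | succ n ih => rw [pow_succ', mul_smul, VNorm.map_smul, ih, absD_slopePi, pow_succ]; ring

/-- A `D(r)`-basis that splits a `D(r)`-norm gives a `K(r)`-basis that splits it: the absolute
value of `∑ aⱼ π_r^j` is `max |aⱼ| |π_r|^j`. -/
theorem orth_slopeAlgBasis {ι : Type*} [Fintype ι]
    (B : Module.Basis ι (slopeAlg p k r) (slopeFix Φ r)) (α : minNorms Φ)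
    (hB : (restrictSlopeAlg α r).IsSplitBy B) :
    (restrictFix (α.1.restrict (slopePart Φ r))).Orth (slopeAlgBasis B) := by
  intro c x
  simp only [slopeAlgBasis_apply]
  have h1 : ∑ y : ι × Fin r.den, c y • (slopePi p k r ^ y.2.val • B y.1) =
      ∑ i, (rowElem r fun j => c (i, j)) • B i := by
    rw [Fintype.sum_prod_type]
    exact Finset.sum_congr rfl fun i _ => (rowElem_smul (fun j => c (i, j)) (B i)).symm
  have hl : restrictFix (α.1.restrict (slopePart Φ r)) (slopePi p k r ^ x.2.val • B x.1) =
      piAbs p r ^ x.2.val * restrictSlopeAlg α r (B x.1) :=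
    (restrictFix_restrict_apply α r _).trans (restrictSlopeAlg_pow_smul α _ _)
  have hr := (restrictFix_restrict_apply α r (∑ i, (rowElem r fun j => c (i, j)) • B i)).trans
    (hB _)
  rw [h1, hl, hr]
  by_cases hc : (rowElem r fun j => c (x.1, j)) = 0
  · have h2 := rowElem_row (fun j => c (x.1, j)) x.2
    rw [hc] at h2
    have h3 : absK p k r (c x) = 0 := by
      change absL p k (c x : LField p k) = 0
      rw [← h2]
      exact absL_zero
    rw [h3, zero_mul]
    exact zero_le
  · have h2 : absK p k r (c x) * piAbs p r ^ x.2.val ≤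
        absD p k r (rowElem r fun j => c (x.1, j)) := by
      rw [absD_eq_rowNorm]
      refine le_trans (le_of_eq ?_) (Finset.le_sup (Finset.mem_univ x.2))
      rw [rowElem_row]
      rfl
    rw [← mul_assoc]
    refine (mul_le_mul_left h2 _).trans ?_
    have h3 : ∀ i, B.repr (∑ i, (rowElem r fun j => c (i, j)) • B i) i =
        rowElem r fun j => c (i, j) := fun i => by rw [B.repr_sum_self]
    refine le_trans (le_of_eq ?_) (Finset.le_sup (b := x.1) ?_)
    · rw [h3]
    · rw [Finsupp.mem_support_iff, h3]
      exact hc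

theorem isSplitBy_unionBasis {m : ℚ → ℕ}
    (B : ∀ r : ℚ, Module.Basis (Fin (m r)) (slopeAlg p k r) (slopeFix Φ r)) (α : minNorms Φ)
    (hB : ∀ r, (restrictSlopeAlg α r).IsSplitBy (B r)) :
    α.1.IsSplitBy (unionBasis Φ fun r => slopeAlgBasis (B r)) := by
  have hL := isCompleteDiscrete_absL (p := p) (k := k)
  refine (VNorm.isSplitBy_collectedBasis_iff hL (isInternal_slopePart Φ) _).2 ⟨α.2.1, fun r => ?_⟩
  rw [VNorm.isSplitBy_iff_orth hL]
  exact orth_slopePartBasis (minSlope_subset_minSlopePow (α.2.2 r)) _ (orth_slopeAlgBasis _ α (hB r))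

/-- The contribution of `π_r^j` to the coordinates in the apartment of the basis `π_r^j B_i` does
not depend on the norm. -/
theorem log_unionBasis {m : ℚ → ℕ}
    (B : ∀ r : ℚ, Module.Basis (Fin (m r)) (slopeAlg p k r) (slopeFix Φ r)) (α β : minNorms Φ)
    (x : Σ r, Fin (m r) × Fin r.den) :
    Real.log (α.1 (unionBasis Φ (fun r => slopeAlgBasis (B r)) x)) -
        Real.log (β.1 (unionBasis Φ (fun r => slopeAlgBasis (B r)) x)) =
      Real.log (restrictSlopeAlg α x.1 (B x.1 x.2.1)) -
        Real.log (restrictSlopeAlg β x.1 (B x.1 x.2.1)) := by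
  obtain ⟨r, i, j⟩ := x
  have h1 : ∀ γ : minNorms Φ, Real.log (γ.1 (unionBasis Φ (fun r => slopeAlgBasis (B r)) ⟨r, i, j⟩)) =
      Real.log ((piAbs p r ^ j.val : ℝ≥0) : ℝ) + Real.log (restrictSlopeAlg γ r (B r i)) := by
    intro γ
    rw [unionBasis_apply]
    change Real.log (restrictSlopeAlg γ r (slopeAlgBasis (B r) (i, j))) = _
    rw [slopeAlgBasis_apply, restrictSlopeAlg_pow_smul, NNReal.coe_mul, Real.log_mul]
    · exact_mod_cast pow_ne_zero _ (piAbs_pos r).ne'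
    · have h0 : B r i ≠ 0 := by
        intro h
        have h2 := congrArg (fun y => (B r).repr y i) h
        simp only [Module.Basis.repr_self, Finsupp.single_eq_same, map_zero, Finsupp.zero_apply] at h2
        have h3 := congrFun (congrFun (congrArg Subtype.val h2) 0) 0
        change (1 : Matrix (Fin r.den) (Fin r.den) (LField p k)) 0 0 = 0 at h3
        rw [Matrix.one_apply_eq] at h3
        exact one_ne_zero h3
      exact_mod_cast ((restrictSlopeAlg γ r).pos h0).ne'
  rw [h1, h1, add_sub_add_left_eq_sub]

end NormBijection

/-! ### Invariant Euclidean metrics on the building of `GL(V)` -/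

section Building
variable {p : ℕ} [hp : Fact p.Prime] {k : Type*} [Field k] [CharP k p] [IsAlgClosed k]
variable {V : Type*} [AddCommGroup V] [Module ℚ_[p] V] [FiniteDimensional ℚ_[p] V]

/-- An invariant Euclidean metric is given on all apartments by the same quadratic form, which is
invariant under permutations of the coordinates. -/
theorem exists_quadraticForm [MetricSpace (NormBuilding p k V)] (hd : IsInvariantEuclidean p k V) :
    ∃ Q : QuadraticForm ℝ (Fin (Module.finrank (LField p k) (NSpace p k V)) → ℝ), Q.PosDef ∧
      (∀ (s : Equiv.Perm (Fin (Module.finrank (LField p k) (NSpace p k V)))) v, Q (v ∘ s) = Q v) ∧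
      ∀ (e : Module.Basis (Fin (Module.finrank (LField p k) (NSpace p k V))) (LField p k)
        (NSpace p k V)) (α β : NormBuilding p k V), α.Orth e → β.Orth e →
        dist α β ^ 2 = Q fun i => Real.log (α (e i)) - Real.log (β (e i)) := by
  have hL := isCompleteDiscrete_absL (p := p) (k := k)
  let e₀ := Module.finBasis (LField p k) (NSpace p k V)
  obtain ⟨Q, hpos, hQ⟩ := hd.euclidean _ e₀
  have key : ∀ (e : Module.Basis (Fin (Module.finrank (LField p k) (NSpace p k V))) (LField p k)
        (NSpace p k V)) (α β : NormBuilding p k V), α.Orth e → β.Orth e →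
        dist α β ^ 2 = Q fun i => Real.log (α (e i)) - Real.log (β (e i)) := by
    intro e α β hα hβ
    -- transport to the apartment of `e₀`
    let g : NSpace p k V ≃ₗ[LField p k] NSpace p k V := e.equiv e₀ (Equiv.refl _)
    have hg : ∀ i, g.symm (e₀ i) = e i := by
      intro i
      rw [LinearEquiv.symm_apply_eq, Module.Basis.equiv_apply, Equiv.refl_apply]
    have hsplit : ∀ γ : NormBuilding p k V, γ.Orth e → (g • γ).IsSplitBy e₀ := by
      intro γ hγ
      rw [VNorm.isSplitBy_iff_orth hL]
      intro c i
      rw [VNorm.smul_apply, VNorm.smul_apply, map_sum, hg]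
      simp only [map_smul, hg]
      exact hγ c i
    rw [← hd.dist_smul g α β, hQ _ _ (hsplit α hα) (hsplit β hβ)]
    simp only [VNorm.smul_apply, hg]
  refine ⟨Q, hpos, fun s v => ?_, key⟩
  let α := VNorm.ofBasis hL e₀ (fun i => Real.toNNReal (Real.exp (v i)))
    fun i => (Real.toNNReal_pos.2 (Real.exp_pos _)).ne'
  let β := VNorm.ofBasis hL e₀ (fun _ => 1) fun _ => one_ne_zero
  have hα : α.Orth e₀ := VNorm.orth_ofBasis hL e₀ _ _
  have hβ : β.Orth e₀ := VNorm.orth_ofBasis hL e₀ _ _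
  have hlog : ∀ i, Real.log (α (e₀ i)) - Real.log (β (e₀ i)) = v i := by
    intro i
    rw [VNorm.ofBasis_basis, VNorm.ofBasis_basis, NNReal.coe_one, Real.log_one, sub_zero,
      Real.coe_toNNReal _ (Real.exp_pos _).le, Real.log_exp]
  have h1 := key e₀ α β hα hβ
  have h2 := key (e₀.reindex s.symm) α β
    (by rw [Module.Basis.coe_reindex]; exact hα.comp _ s.injective)
    (by rw [Module.Basis.coe_reindex]; exact hβ.comp _ s.injective)
  simp only [Module.Basis.reindex_apply, Equiv.symm_symm, hlog] at h1 h2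
  rw [← h1, h2]
  rfl

end Building

/-! ### Restriction of norms to the spaces `N_r⁰` -/

section Equivalence
variable {p : ℕ} [hp : Fact p.Prime] {k : Type*} [Field k] [CharP k p] [IsAlgClosed k]
variable {N : Type*} [AddCommGroup N] [Module (LField p k) N] [FiniteDimensional (LField p k) N]
  {Φ : N ≃ₛₗ[sigmaHom p k] N} {r : ℚ}

theorem mem_minSlopePow_iff_eq {α : VNorm (LField p k) (absL p k) (slopePart Φ r)} :
    α ∈ minSlopePow Φ r ↔
      ∀ x, α ((slopeFrob Φ r)^[r.den] x) = α ((p : LField p k) ^ r.num • x) := by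
  rw [mem_minSlopePow_iff]
  refine forall_congr' fun x => ?_
  rw [α.map_smul, absL_p_zpow]

variable (Φ) in
/-- Restriction of norms as a bijection from the product of the `Min(Φ_r)` to the building of `J`.
-/
noncomputable def minNormsEquiv :
    minNorms Φ ≃ ∀ r : ℚ, VNorm (slopeAlg p k r) (absD p k r) (slopeFix Φ r) :=
  Equiv.ofBijective restrictSlopeAlg bijective_restrictSlopeAlg

theorem restrictSlopeAlg_smul (g : isocAut Φ) (α : minNorms Φ) (r : ℚ) :
    restrictSlopeAlg ⟨g.1 • α.1, smul_mem_minNorms g α.2⟩ r =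
      isocAutEquiv Φ g r • restrictSlopeAlg α r := by
  refine VNorm.ext fun x => ?_
  rfl

end Equivalence

/-! ### The metric on the building of `J` -/

section Apartment
variable {p : ℕ} [hp : Fact p.Prime] {k : Type*} [Field k] [CharP k p] [IsAlgClosed k]
variable {V : Type*} [AddCommGroup V] [Module ℚ_[p] V] [FiniteDimensional ℚ_[p] V]

/-- An invariant Euclidean metric is Euclidean on the apartments of the building of `J`: the
apartment attached to a family `B` of `D(r)`-bases lies in the apartment attached to the `L`-basis
`π_r^j B_i`, whose coordinates repeat those of `B`. -/
theorem exists_quadraticForm_apartment [MetricSpace (NormBuilding p k V)]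
    (hd : IsInvariantEuclidean p k V) (Φ : NSpace p k V ≃ₛₗ[sigmaHom p k] NSpace p k V) {m : ℚ → ℕ}
    (B : ∀ r : ℚ, Module.Basis (Fin (m r)) (slopeAlg p k r) (slopeFix Φ r)) :
    ∃ Q : QuadraticForm ℝ ((Σ r : ℚ, Fin (m r)) → ℝ), Q.PosDef ∧ ∀ α β : minNorms Φ,
      (∀ r, (restrictSlopeAlg α r).IsSplitBy (B r)) →
        (∀ r, (restrictSlopeAlg β r).IsSplitBy (B r)) →
          dist α.1 β.1 ^ 2 = Q fun i => Real.log (restrictSlopeAlg α i.1 (B i.1 i.2)) -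
            Real.log (restrictSlopeAlg β i.1 (B i.1 i.2)) := by
  let c := unionBasis Φ fun r => slopeAlgBasis (B r)
  have : Finite (Σ r : ℚ, Fin (m r) × Fin r.den) := Module.Finite.finite_basis c
  have := Fintype.ofFinite (Σ r : ℚ, Fin (m r) × Fin r.den)
  let s : (Σ r : ℚ, Fin (m r) × Fin r.den) ≃ Fin (Fintype.card (Σ r : ℚ, Fin (m r) × Fin r.den)) :=
    Fintype.equivFin _
  obtain ⟨Q, hpos, hQ⟩ := hd.euclidean _ (c.reindex s)
  let t : (Σ r : ℚ, Fin (m r) × Fin r.den) → Σ r : ℚ, Fin (m r) := fun x => ⟨x.1, x.2.1⟩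
  have ht : Function.Surjective t := fun x => ⟨⟨x.1, x.2, 0⟩, rfl⟩
  let f := t ∘ s.symm
  have hf : Function.Surjective f := ht.comp s.symm.surjective
  refine ⟨Q.comp (LinearMap.funLeft ℝ ℝ f), fun v hv => ?_, fun α β hα hβ => ?_⟩
  -- `t` is surjective since `r.den > 0`, so the restricted form is positive definite
  · refine hpos _ fun h => hv (LinearMap.funLeft_injective_of_surjective ℝ ℝ f hf ?_)
    rw [h, map_zero]
  · have hsplit : ∀ γ : minNorms Φ, (∀ r, (restrictSlopeAlg γ r).IsSplitBy (B r)) →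
        γ.1.IsSplitBy (c.reindex s) := by
      intro γ hγ
      have h1 := isSplitBy_unionBasis B γ hγ
      have hL := isCompleteDiscrete_absL (p := p) (k := k)
      rw [VNorm.isSplitBy_iff_orth hL] at h1 ⊢
      rw [Module.Basis.coe_reindex]
      exact h1.comp _ s.symm.injective
    rw [hQ _ _ (hsplit α hα) (hsplit β hβ), QuadraticMap.comp_apply]
    congr 1
    funext i
    rw [Module.Basis.reindex_apply]
    exact log_unionBasis B α β _

end Apartment

end IsocNorm

theorem mainTheorem3 (p : ℕ) [Fact p.Prime] (k : Type*) [Field k] [CharP k p] [IsAlgClosed k]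
    (V : Type*) [AddCommGroup V] [Module ℚ_[p] V] [FiniteDimensional ℚ_[p] V]
    [MetricSpace (NormBuilding p k V)] (hd : IsInvariantEuclidean p k V)
    (b : NSpace p k V ≃ₗ[LField p k] NSpace p k V) :
    -- the slope decomposition of `N`, and the division algebras `D(r)` with center `ℚ_p`
    DirectSum.IsInternal (fun r : ℚ => slopePart (twistFrob b) r) ∧
    (∀ r : ℚ, (∀ x : slopeAlg p k r, x ≠ 0 → IsUnit x) ∧
      ∀ x : slopeAlg p k r, x ∈ Subring.center (slopeAlg p k r) ↔
        ∃ a : ℚ_[p], x.1 = Matrix.scalar _ (algebraMap ℚ_[p] (LField p k) a)) ∧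
    -- the norms that decompose along `N = ⨁ N_r` are the families of norms of the `N_r`
    Function.Bijective (fun (α : {α : NormBuilding p k V //
      α.DecomposesAlong (slopePart (twistFrob b))}) (r : ℚ) =>
        α.1.restrict (slopePart (twistFrob b) r)) ∧
    -- `Min(Φ)` is the product of the `Min(Φ_r)`
    minSet (frobAct (twistFrob b)) = {α : NormBuilding p k V |
      α.DecomposesAlong (slopePart (twistFrob b)) ∧
        ∀ r : ℚ, α.restrict (slopePart (twistFrob b) r) ∈ minSlope (twistFrob b) r} ∧
    -- `Min(Φ_r) ⊆ Min(Φ_r^h)`, identified with `𝒩(N_r⁰, D(r)) ⊆ 𝒩(N_r⁰, K(r))`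
    (∀ r : ℚ, minSlope (twistFrob b) r ⊆ minSlopePow (twistFrob b) r ∧
      (∀ α, α ∈ minSlopePow (twistFrob b) r ↔
        ∀ x, α ((slopeFrob (twistFrob b) r)^[r.den] x) = α ((p : LField p k) ^ r.num • x)) ∧
      ∃ f : minSlopePow (twistFrob b) r ≃
          VNorm (fixedField p k r) (absK p k r) (slopeFix (twistFrob b) r),
        (∀ α x, f α x = α.1 ⟨x.1, x.2.1⟩) ∧
        (∀ α, α.1 ∈ minSlope (twistFrob b) r ↔
          ∀ x, f α (slopePi p k r • x) = absD p k r (slopePi p k r) * f α x) ∧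
        ∀ β : VNorm (fixedField p k r) (absK p k r) (slopeFix (twistFrob b) r),
          (∀ x, β (slopePi p k r • x) = absD p k r (slopePi p k r) * β x) ↔
            ∃ γ : VNorm (slopeAlg p k r) (absD p k r) (slopeFix (twistFrob b) r),
              ∀ x, γ x = β x) ∧
    -- `J(ℚ_p)` is the product of the groups `Aut_{D(r)}(N_r⁰)`
    ∃ ρ : isocAut (twistFrob b) ≃*
        (∀ r : ℚ, slopeFix (twistFrob b) r ≃ₗ[slopeAlg p k r] slopeFix (twistFrob b) r),
      (∀ g r x, (ρ g r x).1 = g.1 x.1) ∧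
      -- restriction of norms is a bijection of `Min(Φ)` with the product of the `𝒩(N_r⁰, D(r))`
      ∃ e : minSet (frobAct (twistFrob b)) ≃
          (∀ r : ℚ, VNorm (slopeAlg p k r) (absD p k r) (slopeFix (twistFrob b) r)),
        (∀ α r x, e α r x = α.1 x.1) ∧
        -- it is `J(ℚ_p)`-equivariant
        (∀ (g : isocAut (twistFrob b)) (α : minSet (frobAct (twistFrob b))),
          ∃ hg : g.1 • α.1 ∈ minSet (frobAct (twistFrob b)),
            ∀ r, e ⟨g.1 • α.1, hg⟩ r = ρ g r • e α r) ∧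
        -- the metric is Euclidean on the apartments of the product of the `𝒩(N_r⁰, D(r))`
        ∀ (m : ℚ → ℕ) (B : ∀ r : ℚ,
            Module.Basis (Fin (m r)) (slopeAlg p k r) (slopeFix (twistFrob b) r)),
          ∃ Q : QuadraticForm ℝ ((Σ r : ℚ, Fin (m r)) → ℝ), Q.PosDef ∧
            ∀ α β : minSet (frobAct (twistFrob b)),
              (∀ r, (e α r).IsSplitBy (B r)) → (∀ r, (e β r).IsSplitBy (B r)) →
                dist α.1 β.1 ^ 2 = Q fun i =>
                  Real.log (e α i.1 (B i.1 i.2)) - Real.log (e β i.1 (B i.1 i.2)) := by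
  obtain ⟨Q, hpos, hperm, hQ⟩ := exists_quadraticForm hd
  have hmin : minSet (frobAct (twistFrob b)) = minNorms (twistFrob b) :=
    minSet_frobAct rfl hpos hperm hQ
  refine ⟨isInternal_slopePart _,
    fun r => ⟨fun x => isUnit_of_ne_zero, mem_center_slopeAlg_iff⟩,
    VNorm.bijective_restrict isCompleteDiscrete_absL (isInternal_slopePart _), hmin,
    fun r => ⟨minSlope_subset_minSlopePow, fun α => mem_minSlopePow_iff_eq,
      minSlopePowEquiv _ r, minSlopePowEquiv_apply,
      fun α => mem_minSlope_iff_restrictFix α.2, exists_slopeAlg_norm_iff⟩,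
    isocAutEquiv _, coe_isocAutEquiv,
    (Equiv.setCongr hmin).trans (minNormsEquiv _), fun _ _ _ => rfl, fun g α => ?_, fun m B => ?_⟩
  · have hα : α.1 ∈ minNorms (twistFrob b) := hmin.subset α.2
    exact ⟨hmin.symm.subset (smul_mem_minNorms g hα), fun r => restrictSlopeAlg_smul g ⟨α.1, hα⟩ r⟩
  · obtain ⟨Q', hpos', hQ'⟩ := exists_quadraticForm_apartment hd (twistFrob b) B
    exact ⟨Q', hpos', fun α β hα hβ =>
      hQ' (Equiv.setCongr hmin α) (Equiv.setCongr hmin β) hα hβ⟩
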